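/- Let $G=\mathrm{SU}(2)$ with normalized Haar measure $dg$. Let $g_t=\mathrm{diag}(e^{it},e^{-it})$ for $t\in[0,\pi]$, let $\delta_t$ be the probability measure on the conjugacy class of $g_t$ given by $\int \delta_t(g)f(g)\,dg=\int_G f(xg_tx^{-1})\,dx$, and let $\Delta(t)^2=2\sin^2 t$, so that the Weyl integration formula reads $\int_G f(g)\,dg=\int_0^\pi \frac{dt}{\pi}\Delta(t)^2\int_G f(xg_tx^{-1})\,dx$. For $j\in\{0,\tfrac12,1,\dots\}$ let $\chi_j$ be the character of the spin-$j$ irreducible representation of $G$, let $\dim_j=2j+1$, and put $$\theta_{j_1j_2j_3}(y_1,y_2,y_3)=\int_G dg\,\chi_{j_1}(y_1^{-1}g)\,\chi_{j_2}(y_2^{-1}g)\,\chi_{j_3}(y_3^{-1}g).$$ For a measure $\mu$ on $G^3$, the product $\mu\cdot\delta_e(x_1^{-1}x_2^{-1}x_3^{-1})$ is said to exist if there is a finite measure $\nu$ on $G^3$ such that $k_n(x_1^{-1}x_2^{-1}x_3^{-1})\,\mu\to\nu$ weakly for every sequence of continuous functions $k_n\ge 0$ on $G$ with $\int_G k_n=1$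 whose supports shrink to $\{e\}$; the product is then $\nu$. Consider on $G^6$ the distributions $$\theta(x_1,y_1;x_2,y_2;x_3,y_3)=\delta_e(x_1^{-1}x_2^{-1}x_3^{-1})\int_G dg\,\delta_e(y_1^{-1}g)\,\delta_e(y_2^{-1}g)\,\delta_e(y_3^{-1}g),$$ $$\theta^{\theta_1,\theta_2,\theta_3}_{j_1,j_2,j_3}(x_1,y_1;x_2,y_2;x_3,y_3)=\delta_{\theta_1}(x_1)\,\delta_{\theta_2}(x_2)\,\delta_{\theta_3}(x_3)\,\delta_e(x_1^{-1}x_2^{-1}x_3^{-1})\,\theta_{j_1j_2j_3}(y_1,y_2,y_3).$$ The product of $\delta_e(x_1^{-1}x_2^{-1}x_3^{-1})$ with the Haar measure of $G^3$ exists, and so does its product with $\delta_{\theta_1}(x_1)\delta_{\theta_2}(x_2)\delta_{\theta_3}(x_3)$ for almost every $(\theta_1,\theta_2,\theta_3)\in[0,\pi]^3$. As distributions on $G^6$, $$\theta=\int_{[0,\pi]^3}\prod_{i=1}^3\frac{d\theta_i}{\pi}\,\Delta(\theta_i)^2\sum_{j_1,j_2,j_3}\dim_{j_1}\dim_{j_2}\dim_{j_3}\;\theta^{\theta_1,\theta_2,\theta_3}_{j_1,j_2,j_3}.$$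 That is, for every smooth test function $f$ on $G^6$, the series of pairings with $f$ converges absolutely for almost every $(\theta_1,\theta_2,\theta_3)$, its weighted sum is integrable over $[0,\pi]^3$, and the integral equals the pairing of $\theta$ with $f$. -/

import Mathlib

open MeasureTheory Filter Topology
open scoped ContDiff

/-! ### The group `SU(2)`, its Haar measure and its spin representations -/

/-- The compact group `SU(2)`. -/
abbrev SU2 : Type := Matrix.specialUnitaryGroup (Fin 2) ℂ

instance : IsTopologicalGroup SU2 where
  continuous_inv := continuous_induced_rng.mpr continuous_subtype_val.star

instance : CompactSpace SU2 := by
  have h : IsCompact {A : Fin 2 → Fin 2 → ℂ |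
      (Matrix.of A) ∈ Matrix.specialUnitaryGroup (Fin 2) ℂ} := by
    refine Metric.isCompact_of_isClosed_isBounded ?_ ?_
    · have e : {A : Fin 2 → Fin 2 → ℂ | (Matrix.of A) ∈ Matrix.specialUnitaryGroup (Fin 2) ℂ} =
          {A | star (Matrix.of A) * Matrix.of A = 1} ∩ {A | (Matrix.of A).det = 1} := by
        ext A
        simp only [Set.mem_ofPred_eq, Set.mem_inter_iff, Matrix.mem_specialUnitaryGroup_iff,
          Matrix.mem_unitaryGroup_iff']
      have c : Continuous fun A : Fin 2 → Fin 2 → ℂ => Matrix.of A := continuous_id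
      rw [e]
      exact (isClosed_eq (c.star.matrix_mul c) continuous_const).inter
        (isClosed_eq c.matrix_det continuous_const)
    · refine (Metric.isBounded_closedBall (x := (0 : Fin 2 → Fin 2 → ℂ)) (r := 1)).subset ?_
      intro A hA
      rw [mem_closedBall_zero_iff, pi_norm_le_iff_of_nonneg zero_le_one]
      intro i
      rw [pi_norm_le_iff_of_nonneg zero_le_one]
      intro j
      exact entry_norm_bound_of_unitary hA.1 i j
  exact isCompact_iff_compactSpace.mp h

noncomputable instance : MeasurableSpace SU2 := borel SU2

instance : BorelSpace SU2 := ⟨rfl⟩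

/-- The Haar measure `dg` on `SU(2)`, normalized to total mass one. -/
noncomputable def haarSU2 : Measure SU2 := Measure.haarMeasure ⊤

/-- The product Haar measure `dx₁ dx₂ dx₃` on `SU(2)³`. -/
noncomputable def haarSU2Cubed : Measure (Fin 3 → SU2) := Measure.pi fun _ => haarSU2

/-- The linear substitution `X_i ↦ ∑_k g_{k i} X_k` on polynomials in two variables. -/
noncomputable def linSubst (g : Matrix (Fin 2) (Fin 2) ℂ) :
    MvPolynomial (Fin 2) ℂ →ₐ[ℂ] MvPolynomial (Fin 2) ℂ :=
  MvPolynomial.aeval fun i => ∑ k, MvPolynomial.C (g k i) * MvPolynomial.X k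

lemma linSubst_mem (g : Matrix (Fin 2) (Fin 2) ℂ) (n : ℕ) (p : MvPolynomial (Fin 2) ℂ)
    (hp : p ∈ MvPolynomial.homogeneousSubmodule (Fin 2) ℂ n) :
    linSubst g p ∈ MvPolynomial.homogeneousSubmodule (Fin 2) ℂ n := by
  rw [MvPolynomial.mem_homogeneousSubmodule] at hp ⊢
  have := hp.aeval (n := 1) (fun i => ∑ k, MvPolynomial.C (g k i) * MvPolynomial.X k)
    (fun i => MvPolynomial.IsHomogeneous.sum _ _ _ fun k _ => by
      simpa using (MvPolynomial.isHomogeneous_C (Fin 2) (g k i)).mul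
        (MvPolynomial.isHomogeneous_X ℂ k))
  simpa [linSubst] using this

lemma linSubst_one : linSubst 1 = AlgHom.id ℂ _ := by
  refine MvPolynomial.algHom_ext fun i => ?_
  fin_cases i <;> simp [linSubst, Matrix.one_apply]

lemma linSubst_mul (g h : Matrix (Fin 2) (Fin 2) ℂ) :
    linSubst (g * h) = (linSubst g).comp (linSubst h) := by
  refine MvPolynomial.algHom_ext fun i => ?_
  simp [linSubst, Matrix.mul_apply, MvPolynomial.algebraMap_eq]
  ring

/-- The irreducible representation of `SU(2)` of spin `j = n / 2`: the `n`-th symmetric power of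
the defining representation, realized on the homogeneous polynomials of degree `n` in two
variables. Its dimension is `dim_j = 2 j + 1 = n + 1`. -/
noncomputable def spinRep (n : ℕ) :
    Representation ℂ SU2 (MvPolynomial.homogeneousSubmodule (Fin 2) ℂ n) where
  toFun g := (linSubst (g : Matrix (Fin 2) (Fin 2) ℂ)).toLinearMap.restrict
    (linSubst_mem (g : Matrix (Fin 2) (Fin 2) ℂ) n)
  map_one' := by
    ext p : 2
    simp [linSubst_one]
  map_mul' g h := by
    ext p : 2
    change linSubst ((g : Matrix (Fin 2) (Fin 2) ℂ) * (h : Matrix (Fin 2) (Fin 2) ℂ)) p.1 = _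
    rw [linSubst_mul]
    rfl

/-- The character `χ_j` of the spin `j = n / 2` representation. -/
noncomputable def spinChar (n : ℕ) (g : SU2) : ℂ := (spinRep n).character g

/-- `θ_{j₁ j₂ j₃}(y₁, y₂, y₃) = ∫ dg χ_{j₁}(y₁⁻¹ g) χ_{j₂}(y₂⁻¹ g) χ_{j₃}(y₃⁻¹ g)`, with
`j_i = n_i / 2`. -/
noncomputable def thetaSpin (n : Fin 3 → ℕ) (y : Fin 3 → SU2) : ℂ :=
  ∫ g, ∏ i, spinChar (n i) ((y i)⁻¹ * g) ∂haarSU2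

/-! ### Conjugacy classes and the Weyl measure -/

/-- The Cartan element `g_t = diag(e^{it}, e^{-it})`. -/
noncomputable def cartan (t : ℝ) : SU2 :=
  ⟨Matrix.diagonal ![Complex.exp (Complex.I * t), Complex.exp (-(Complex.I * t))], by
    rw [Matrix.mem_specialUnitaryGroup_iff, Matrix.mem_unitaryGroup_iff']
    refine ⟨?_, ?_⟩
    · ext i j
      fin_cases i <;> fin_cases j <;>
        simp [Matrix.star_eq_conjTranspose, Matrix.mul_apply,
          Matrix.diagonal, ← Complex.exp_conj, ← Complex.exp_add]
    · simp [Matrix.det_diagonal, Fin.prod_univ_two, ← Complex.exp_add]⟩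

/-- The delta function `δ_t` on the conjugacy class of `g_t`, as a measure:
`∫ δ_t(g) f(g) dg = ∫ f(x g_t x⁻¹) dx`. -/
noncomputable def classDelta (t : ℝ) : Measure SU2 :=
  haarSU2.map fun x => x * cartan t * x⁻¹

/-- The Weyl denominator `Δ(t)`, normalized so that the Weyl integration formula reads
`∫ f(g) dg = ∫_0^π (dt / π) Δ(t)² ∫ f(x g_t x⁻¹) dx`. -/
noncomputable def weylDelta (t : ℝ) : ℝ := √2 * Real.sin t

/-! ### Products with `δ_e` composed with a map into the group -/

/-- A delta sequence at the identity of `SU(2)`. -/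
structure IsDeltaSequence (k : ℕ → SU2 → ℝ) : Prop where
  continuous : ∀ n, Continuous (k n)
  nonneg : ∀ n x, 0 ≤ k n x
  integral_eq_one : ∀ n, ∫ x, k n x ∂haarSU2 = 1
  support_shrinks : ∀ U ∈ 𝓝 (1 : SU2), ∀ᶠ n in atTop, ∀ x ∉ U, k n x = 0

/-- `ν` is the product `μ · δ_e(m(·))`: for every delta sequence `k_n → δ_e`, the measures
`k_n(m(x)) dμ(x)` converge weakly to `ν`. -/
def IsDeltaProduct {X : Type*} [TopologicalSpace X] [MeasurableSpace X]
    (μ : Measure X) (m : X → SU2) (ν : Measure X) : Prop :=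
  IsFiniteMeasure ν ∧ ∀ k : ℕ → SU2 → ℝ, IsDeltaSequence k → ∀ φ : X → ℂ, Continuous φ →
    Tendsto (fun n => ∫ x, φ x * (k n (m x) : ℂ) ∂μ) atTop (𝓝 (∫ x, φ x ∂ν))

open Classical in
/-- The product `μ · δ_e(m(·))` when it exists, and `0` otherwise. -/
noncomputable def deltaProduct {X : Type*} [TopologicalSpace X] [MeasurableSpace X]
    (μ : Measure X) (m : X → SU2) : Measure X :=
  if h : ∃ ν, IsDeltaProduct μ m ν then h.choose else 0

/-- The argument `x₁⁻¹ x₂⁻¹ x₃⁻¹` of the delta function. -/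
def closing (x : Fin 3 → SU2) : SU2 := (x 0)⁻¹ * (x 1)⁻¹ * (x 2)⁻¹

/-- `δ_{t₁}(x₁) δ_{t₂}(x₂) δ_{t₃}(x₃)` as a measure on `SU(2)³`. -/
noncomputable def classDelta3 (t : Fin 3 → ℝ) : Measure (Fin 3 → SU2) :=
  Measure.pi fun i => classDelta (t i)

/-! ### The distributions on `SU(2)⁶`, through their pairing with test functions

A test function `f` takes `x = (x₁, x₂, x₃)` and `y = (y₁, y₂, y₃)`. -/

/-- Smooth functions on the compact submanifold `SU(2)⁶` of `M₂(ℂ)⁶`: the restrictions of smooth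
functions on the ambient real vector space. -/
def IsTestFunction (f : (Fin 3 → SU2) → (Fin 3 → SU2) → ℂ) : Prop :=
  ∃ F : (Fin 3 → Fin 2 → Fin 2 → ℂ) × (Fin 3 → Fin 2 → Fin 2 → ℂ) → ℂ,
    ContDiff ℝ ∞ F ∧ ∀ x y : Fin 3 → SU2,
      f x y = F (fun i a b => (x i : Matrix (Fin 2) (Fin 2) ℂ) a b,
        fun i a b => (y i : Matrix (Fin 2) (Fin 2) ℂ) a b)

/-- The pairing with `f` of
`θ(x₁,y₁;x₂,y₂;x₃,y₃) = δ_e(x₁⁻¹ x₂⁻¹ x₃⁻¹) ∫ dg δ_e(y₁⁻¹ g) δ_e(y₂⁻¹ g) δ_e(y₃⁻¹ g)`. -/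
noncomputable def thetaPairing (f : (Fin 3 → SU2) → (Fin 3 → SU2) → ℂ) : ℂ :=
  ∫ x, (∫ g, f x (fun _ => g) ∂haarSU2) ∂(deltaProduct haarSU2Cubed closing)

/-- The pairing with `f` of
`δ_{t₁}(x₁) δ_{t₂}(x₂) δ_{t₃}(x₃) δ_e(x₁⁻¹ x₂⁻¹ x₃⁻¹) θ_{j₁ j₂ j₃}(y₁, y₂, y₃)`, `j_i = n_i / 2`. -/
noncomputable def thetaCharPairing (t : Fin 3 → ℝ) (n : Fin 3 → ℕ)
    (f : (Fin 3 → SU2) → (Fin 3 → SU2) → ℂ) : ℂ :=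
  ∫ x, (∫ y, thetaSpin n y * f x y ∂haarSU2Cubed) ∂(deltaProduct (classDelta3 t) closing)

/-! ### Coordinates on `SU(2)` -/

namespace SU2

/-! The two groups of variables separate: `y` carries a Peter–Weyl expansion, and `x` carries the
geometry of triples taken from three conjugacy classes.

In `y`, the function `h ↦ f x (translate g h)` is expanded at `h = 1` in products of characters;
integrating over `g` turns its coefficients into pairings with `thetaSpin` (`spinCoeff_eq`). In the
class angles the coefficients are sine coefficients of a smooth periodic function, and four
integrations by parts in each angle bound the terms by a constant times `∏ (n i + 1)⁻³`, uniformly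
in `x` and `g` (`exists_norm_cubeCoeff_le`). Once the series is known to be summable, Abel summation
finds its value: the Abel means are integrals against nonnegative kernels concentrating at angle
zero (`tendsto_integral_abelKernel`, `hasSum_cubeCoeff`). The outcome is `exists_hasSum_spinCoeff`.

In `x`, the product of `δ_e` with Haar measure is the law of `(x, y, x⁻¹ y⁻¹)` for independent Haar
`x` and `y`. What is special to `SU(2)` is that the closing triples with given angles, the third one
regular, form at most one orbit under simultaneous conjugation (`exists_conj_tri`). For `x = g_a`
and `y = q g_b q⁻¹` the half trace of `x⁻¹ y⁻¹` is affine in `|ca q|²`, which is uniform on `[0, 1]`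
(`map_normSq_ca`). So the third angle `s` has density `sin s / (2 sin a sin b)` on an interval, that
is, density `triW` relative to the Weyl measure (`integral_classDelta_prod_eq`). Where `gram ≠ 0`
this density is continuous in `s`, and the product of `δ_e` with the three class measures is `triW`
times the orbit measure (`isDeltaProduct_classDelta3`); the excluded angles are null
(`ae_isGeneric`).

Weyl's formula in `x` and in `y`, followed by this disintegration, shows that the orbit measures,
weighted by `triW` and the three Weyl densities, integrate to the closed Haar measure
(`integral_weightedOrbital`). For each generic triple of angles the series is summed under the orbit
measure by dominated convergence, so the sum is never exchanged with the integral over the angles.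

Weyl's formula itself comes from moments: invariance under real rotations gives the moments of `|ca
g|²`, and averaging over the phase then gives the law of the half trace (`map_re_ca`), which
determines the class. -/

/-- The upper left entry. -/
def ca (g : SU2) : ℂ := (g : Matrix (Fin 2) (Fin 2) ℂ) 0 0

/-- The upper right entry. -/
def cb (g : SU2) : ℂ := (g : Matrix (Fin 2) (Fin 2) ℂ) 0 1

/-- The adjoint inverts `g` by unitarity, and so does the adjugate because the determinant is one.
This is what makes the first row determine `g`. -/
lemma star_eq_adjugate (g : SU2) :
    star (g : Matrix (Fin 2) (Fin 2) ℂ) = (g : Matrix (Fin 2) (Fin 2) ℂ).adjugate := by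
  have h := Matrix.mem_specialUnitaryGroup_iff.1 g.2
  have h1 := (Matrix.mem_unitaryGroup_iff').1 h.1
  have h2 := Matrix.mul_adjugate (g : Matrix (Fin 2) (Fin 2) ℂ)
  rw [h.2, one_smul] at h2
  calc star (g : Matrix (Fin 2) (Fin 2) ℂ)
      = star (g : Matrix (Fin 2) (Fin 2) ℂ) * ((g : Matrix (Fin 2) (Fin 2) ℂ) *
        (g : Matrix (Fin 2) (Fin 2) ℂ).adjugate) := by rw [h2, mul_one]
    _ = _ := by rw [← mul_assoc, h1, one_mul]

lemma entry_one_one (g : SU2) : (g : Matrix (Fin 2) (Fin 2) ℂ) 1 1 = star (ca g) := by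
  have := congrFun (congrFun (star_eq_adjugate g) 0) 0
  rw [Matrix.adjugate_fin_two] at this
  simpa [Matrix.star_apply, ca] using this.symm

lemma entry_one_zero (g : SU2) : (g : Matrix (Fin 2) (Fin 2) ℂ) 1 0 = -star (cb g) := by
  have := congrFun (congrFun (star_eq_adjugate g) 1) 0
  rw [Matrix.adjugate_fin_two] at this
  simp only [Matrix.star_apply, Matrix.of_apply, Matrix.cons_val'] at this
  rw [cb, this]
  simp

lemma eq_of (g : SU2) : (g : Matrix (Fin 2) (Fin 2) ℂ) =
    !![ca g, cb g; -star (cb g), star (ca g)] := by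
  ext i j
  fin_cases i <;> fin_cases j
  · rfl
  · rfl
  · exact entry_one_zero g
  · exact entry_one_one g

lemma normSq_add (g : SU2) : Complex.normSq (ca g) + Complex.normSq (cb g) = 1 := by
  have h := (Matrix.mem_specialUnitaryGroup_iff.1 g.2).2
  rw [eq_of, Matrix.det_fin_two_of] at h
  apply Complex.ofReal_injective
  push_cast
  rw [← Complex.mul_conj, ← Complex.mul_conj]
  simpa using h

lemma mul_star_add (g : SU2) : ca g * star (ca g) + cb g * star (cb g) = 1 := by
  have := congrArg (fun x : ℝ => (x : ℂ)) (normSq_add g)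
  push_cast at this
  rw [← Complex.mul_conj, ← Complex.mul_conj] at this
  exact this

@[ext] lemma ext' {g h : SU2} (h1 : ca g = ca h) (h2 : cb g = cb h) : g = h := by
  apply Subtype.ext
  rw [eq_of g, eq_of h, h1, h2]

/-- The element of `SU(2)` with first row `(a, b)`. -/
def mk (a b : ℂ) (h : Complex.normSq a + Complex.normSq b = 1) : SU2 :=
  ⟨!![a, b; -star b, star a], by
    have h' : a * star a + b * star b = 1 := by
      have := congrArg (fun x : ℝ => (x : ℂ)) h
      push_cast at this
      rw [← Complex.mul_conj, ← Complex.mul_conj] at this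
      exact this
    rw [Matrix.mem_specialUnitaryGroup_iff, Matrix.mem_unitaryGroup_iff]
    refine ⟨?_, ?_⟩
    · ext i j
      fin_cases i <;> fin_cases j
      · simpa [Matrix.mul_apply, Matrix.star_apply] using h'
      · simp [Matrix.mul_apply, Matrix.star_apply]; ring
      · simp [Matrix.mul_apply, Matrix.star_apply]; ring
      · simp [Matrix.mul_apply, Matrix.star_apply]
        rw [← h']; simp; ring
    · rw [Matrix.det_fin_two_of, ← h']; ring⟩

@[simp] lemma ca_mk (a b : ℂ) (h) : ca (mk a b h) = a := rfl
@[simp] lemma cb_mk (a b : ℂ) (h) : cb (mk a b h) = b := rfl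

lemma ca_mul (g h : SU2) : ca (g * h) = ca g * ca h - cb g * star (cb h) := by
  change ((g : Matrix (Fin 2) (Fin 2) ℂ) * (h : Matrix (Fin 2) (Fin 2) ℂ)) 0 0 = _
  rw [Matrix.mul_apply, Fin.sum_univ_two, entry_one_zero]
  simp only [ca, cb]; ring

lemma cb_mul (g h : SU2) : cb (g * h) = ca g * cb h + cb g * star (ca h) := by
  change ((g : Matrix (Fin 2) (Fin 2) ℂ) * (h : Matrix (Fin 2) (Fin 2) ℂ)) 0 1 = _
  rw [Matrix.mul_apply, Fin.sum_univ_two, entry_one_one]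
  simp only [ca, cb]

lemma coe_inv (g : SU2) : ((g⁻¹ : SU2) : Matrix (Fin 2) (Fin 2) ℂ) =
    star (g : Matrix (Fin 2) (Fin 2) ℂ) := rfl

@[simp] lemma ca_inv (g : SU2) : ca g⁻¹ = star (ca g) := rfl
@[simp] lemma cb_inv (g : SU2) : cb g⁻¹ = -cb g := by
  rw [cb, coe_inv, Matrix.star_apply, entry_one_zero]; simp
@[simp] lemma ca_one : ca 1 = 1 := rfl
@[simp] lemma cb_one : cb 1 = 0 := rfl
@[simp] lemma ca_cartan (t : ℝ) : ca (cartan t) = Complex.exp (Complex.I * t) := by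
  simp [ca, cartan]
@[simp] lemma cb_cartan (t : ℝ) : cb (cartan t) = 0 := by
  simp [cb, cartan]

lemma continuous_ca : Continuous ca :=
  (continuous_apply_apply (0 : Fin 2) (0 : Fin 2)).comp continuous_subtype_val
lemma continuous_cb : Continuous cb :=
  (continuous_apply_apply (0 : Fin 2) (1 : Fin 2)).comp continuous_subtype_val

lemma continuousAt_of_coords {X : Type*} [TopologicalSpace X] {f : X → SU2} {x : X}
    (h1 : ContinuousAt (fun x => ca (f x)) x) (h2 : ContinuousAt (fun x => cb (f x)) x) :
    ContinuousAt f x := by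
  rw [Topology.IsInducing.subtypeVal.continuousAt_iff]
  suffices h : ContinuousAt (fun x => (!![ca (f x), cb (f x); -star (cb (f x)), star (ca (f x))]
      : Matrix (Fin 2) (Fin 2) ℂ)) x from h.congr (.of_forall fun x => (eq_of (f x)).symm)
  refine continuousAt_pi.2 fun i => continuousAt_pi.2 fun j => ?_
  fin_cases i <;> fin_cases j
  · exact h1
  · exact h2
  · exact h2.star.neg
  · exact h1.star

lemma continuous_of_coords {X : Type*} [TopologicalSpace X] {f : X → SU2}
    (h1 : Continuous (fun x => ca (f x))) (h2 : Continuous (fun x => cb (f x))) :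
    Continuous f :=
  continuous_iff_continuousAt.2 fun _ => continuousAt_of_coords h1.continuousAt h2.continuousAt

lemma continuous_cartan : Continuous cartan :=
  continuous_of_coords (by simp only [ca_cartan]; fun_prop)
    (by simp only [cb_cartan]; fun_prop)

lemma cartan_add (s t : ℝ) : cartan (s + t) = cartan s * cartan t := by
  ext1
  · simp [ca_mul, mul_add, Complex.exp_add]
  · simp [cb_mul]

lemma cartan_zero : cartan 0 = 1 := by
  ext1 <;> simp

lemma cartan_neg (t : ℝ) : cartan (-t) = (cartan t)⁻¹ := by
  rw [eq_inv_iff_mul_eq_one, ← cartan_add, neg_add_cancel, cartan_zero]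

lemma exp_I_mul (t : ℝ) : Complex.exp (Complex.I * t) = Real.cos t + Real.sin t * Complex.I := by
  rw [mul_comm, Complex.exp_mul_I]; push_cast; rfl

lemma star_exp_I_mul (t : ℝ) :
    star (Complex.exp (Complex.I * t)) = Real.cos t - Real.sin t * Complex.I := by
  rw [exp_I_mul, Complex.star_def, map_add, map_mul, Complex.conj_ofReal, Complex.conj_ofReal,
    Complex.conj_I]
  ring

lemma re_ca_cartan (t : ℝ) : (ca (cartan t)).re = Real.cos t := by
  rw [ca_cartan, exp_I_mul]; simp [-Complex.ofReal_cos, -Complex.ofReal_sin]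

lemma re_ca_le (g : SU2) : |(ca g).re| ≤ 1 := by
  have h := normSq_add g
  rw [Complex.normSq_apply] at h
  rw [abs_le]
  constructor <;> nlinarith [Complex.normSq_nonneg (cb g), mul_self_nonneg (ca g).im]

/-- Conjugation preserves the real part of the diagonal entry, half the trace. -/
lemma re_ca_conj (r g : SU2) : (ca (r * g * r⁻¹)).re = (ca g).re := by
  have h := normSq_add r
  simp only [Complex.normSq_apply] at h
  simp [ca_mul, cb_mul, Complex.add_re, Complex.mul_re, Complex.mul_im]
  linear_combination (ca g).re * h

lemma eq_cartan_of_cb_eq_zero {z : SU2} (h : cb z = 0) : ∃ τ : ℝ, z = cartan τ := by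
  have h1 := normSq_add z
  rw [h, map_zero, add_zero, Complex.normSq_eq_norm_sq] at h1
  have h2 : ‖ca z‖ = 1 := by
    nlinarith [norm_nonneg (ca z)]
  refine ⟨Complex.arg (ca z), ?_⟩
  ext1
  · rw [ca_cartan, mul_comm]
    have := Complex.norm_mul_exp_arg_mul_I (ca z)
    rw [h2] at this
    simpa using this.symm
  · rw [h, cb_cartan]

/-- An element commuting with a regular diagonal element is diagonal. -/
lemma eq_cartan_of_commute {z : SU2} {t : ℝ} (ht : Real.sin t ≠ 0)
    (h : z * cartan t = cartan t * z) : ∃ τ : ℝ, z = cartan τ := by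
  apply eq_cartan_of_cb_eq_zero
  have h1 := congrArg cb h
  rw [cb_mul, cb_mul, ca_cartan, cb_cartan, star_exp_I_mul, exp_I_mul] at h1
  have h2 : (2 * Complex.I * Real.sin t) * cb z = 0 := by linear_combination -h1
  have h3 : (2 * Complex.I * (Real.sin t : ℂ)) ≠ 0 := by
    simp only [ne_eq, mul_eq_zero, Complex.I_ne_zero, OfNat.ofNat_ne_zero, or_self, false_or]
    exact_mod_cast ht
  exact (mul_eq_zero.1 h2).resolve_left h3

/-- Every element with half trace `cos t` is conjugate to `g_t`. -/
lemma exists_conj_cartan (g : SU2) {t : ℝ} (h : (ca g).re = Real.cos t) :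
    ∃ r : SU2, g = r * cartan t * r⁻¹ := by
  set e := Complex.exp (Complex.I * t) with he
  have hn : Complex.normSq (ca g) + Complex.normSq (cb g) = 1 := normSq_add g
  have hm := mul_star_add g
  have he1 : e * star e = 1 := by
    rw [he, star_exp_I_mul, exp_I_mul]
    have := Real.sin_sq_add_cos_sq t
    have h' := congrArg (fun x : ℝ => (x : ℂ)) this
    push_cast at h' ⊢
    linear_combination h' - (Complex.sin t)^2 * Complex.I_sq
  have hr : ca g + star (ca g) = e + star e := by
    have h1 : ca g + star (ca g) = ((2 * (ca g).re : ℝ) : ℂ) := by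
      simpa using Complex.add_conj (ca g)
    rw [h1, h, he, star_exp_I_mul, exp_I_mul]; push_cast; ring
  -- The trace is `e + star e` and the determinant is `e * star e = 1`, so `e` is a root of the
  -- characteristic polynomial.
  have hdet : Matrix.det ((g : Matrix (Fin 2) (Fin 2) ℂ) - e • (1 : Matrix (Fin 2) (Fin 2) ℂ))
      = 0 := by
    rw [eq_of g, Matrix.det_fin_two]
    simp
    simp only [Complex.star_def] at hm hr he1
    linear_combination hm - e * hr - he1
  obtain ⟨v, hv, hv0⟩ := Matrix.exists_mulVec_eq_zero_iff.2 hdet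
  have e0 := congrFun hv0 0
  have e1 := congrFun hv0 1
  rw [eq_of g] at e0 e1
  simp [Matrix.mulVec, dotProduct, Fin.sum_univ_two] at e0 e1
  set N := Real.sqrt (Complex.normSq (v 0) + Complex.normSq (v 1)) with hN
  have hpos : 0 < Complex.normSq (v 0) + Complex.normSq (v 1) := by
    by_contra hc
    apply hv
    have h0 : Complex.normSq (v 0) = 0 := by
      nlinarith [Complex.normSq_nonneg (v 0), Complex.normSq_nonneg (v 1)]
    have h1 : Complex.normSq (v 1) = 0 := by
      nlinarith [Complex.normSq_nonneg (v 0), Complex.normSq_nonneg (v 1)]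
    ext i
    fin_cases i
    · simpa using h0
    · simpa using h1
  have hNN : N * N = Complex.normSq (v 0) + Complex.normSq (v 1) := Real.mul_self_sqrt hpos.le
  have hN0 : N ≠ 0 := (Real.sqrt_pos.2 hpos).ne'
  have hunit : Complex.normSq (v 0 / N) + Complex.normSq (-star (v 1) / N) = 1 := by
    rw [Complex.normSq_div, Complex.normSq_div, Complex.normSq_ofReal, Complex.normSq_neg,
      Complex.star_def, Complex.normSq_conj, hNN, ← add_div, div_self hpos.ne']
  have hN' : (N : ℂ) ≠ 0 := by exact_mod_cast hN0
  -- The lower left entry of `mk a b` is `-star b`, so the first column of this matrix is the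
  -- normalized eigenvector.
  refine ⟨mk (v 0 / N) (-star (v 1) / N) hunit, ?_⟩
  rw [eq_mul_inv_iff_mul_eq]
  simp only [Complex.star_def] at hr
  have f0 : ca g * v 0 + cb g * v 1 = e * v 0 := by linear_combination e0
  have f1 : -star (cb g) * v 0 + star (ca g) * v 1 = e * v 1 := by
    simp only [Complex.star_def]; linear_combination e1
  have f1' := congrArg star f1
  have hs : star (N : ℂ) = N := by simp
  simp only [Complex.star_def, map_add, map_mul, map_neg, Complex.conj_conj] at f1'
  ext1
  · simp only [ca_mul, ca_mk, cb_mk, ca_cartan, cb_cartan]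
    simp only [Complex.star_def, map_div₀, map_neg, Complex.conj_conj, Complex.conj_ofReal]
    rw [← he]
    field_simp
    simp
    linear_combination f0
  · simp only [cb_mul, ca_mk, cb_mk, ca_cartan, cb_cartan]
    simp only [Complex.star_def, map_div₀, Complex.conj_ofReal]
    rw [← he]
    field_simp
    simp
    linear_combination -f1'

lemma exists_conj_cartan_arccos (g : SU2) :
    ∃ r : SU2, g = r * cartan (Real.arccos (ca g).re) * r⁻¹ := by
  apply exists_conj_cartan
  have := abs_le.1 (re_ca_le g)
  rw [Real.cos_arccos this.1 this.2]

end SU2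

/-! ### Invariance of the Haar measure -/

instance : haarSU2.IsHaarMeasure := by unfold haarSU2; infer_instance

instance : IsProbabilityMeasure haarSU2 := ⟨by
  have := Measure.haarMeasure_self (K₀ := (⊤ : TopologicalSpace.PositiveCompacts SU2))
  simpa [haarSU2] using this⟩

instance : SecondCountableTopology (Matrix (Fin 2) (Fin 2) ℂ) :=
  inferInstanceAs (SecondCountableTopology (Fin 2 → Fin 2 → ℂ))

instance : SecondCountableTopology SU2 :=
  Topology.IsInducing.subtypeVal.secondCountableTopology

instance : TopologicalSpace.PseudoMetrizableSpace (Matrix (Fin 2) (Fin 2) ℂ) :=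
  inferInstanceAs (TopologicalSpace.PseudoMetrizableSpace (Fin 2 → Fin 2 → ℂ))

instance : haarSU2.IsMulRightInvariant where
  map_mul_right_eq_self g := by
    have : IsProbabilityMeasure (Measure.map (· * g) haarSU2) :=
      Measure.isProbabilityMeasure_map (by fun_prop)
    exact Measure.isHaarMeasure_eq_of_isProbabilityMeasure _ _

instance : haarSU2.IsInvInvariant where
  inv_eq_self := by
    have h : IsProbabilityMeasure haarSU2.inv :=
      Measure.isProbabilityMeasure_map (by fun_prop)
    have : haarSU2.inv.IsHaarMeasure :=
      { lt_top_of_isCompact := fun _ _ => measure_lt_top _ _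
        map_mul_left_eq_self := fun g => map_mul_left_eq_self haarSU2.inv g
        open_pos := fun U hU hne => by
          rw [Measure.inv_apply]
          exact hU.inv.measure_ne_zero _ (Set.nonempty_inv.2 hne) }
    exact Measure.isHaarMeasure_eq_of_isProbabilityMeasure _ _

instance : IsProbabilityMeasure haarSU2Cubed := by unfold haarSU2Cubed; infer_instance

lemma Continuous.integrable_of_compactSpace {X E : Type*} [TopologicalSpace X] [CompactSpace X]
    [MeasurableSpace X] [OpensMeasurableSpace X] [NormedAddCommGroup E]
    {μ : Measure X} [IsFiniteMeasure μ] {f : X → E} (hf : Continuous f) : Integrable f μ :=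
  hf.integrable_of_hasCompactSupport (HasCompactSupport.of_compactSpace f)

/-- A continuous function of a parameter and of a compact variable has a continuous integral. -/
lemma continuous_integral_of_compactSpace {X Y : Type*} [TopologicalSpace X]
    [FirstCountableTopology X] [LocallyCompactSpace X] [TopologicalSpace Y] [CompactSpace Y]
    [MeasurableSpace Y] [OpensMeasurableSpace Y] {μ : Measure Y} [IsFiniteMeasure μ]
    {E : Type*} [NormedAddCommGroup E] [NormedSpace ℝ E] [SecondCountableTopology E]
    {f : X → Y → E} (hf : Continuous (Function.uncurry f)) :
    Continuous fun x => ∫ y, f x y ∂μ := by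
  simpa using continuous_parametric_integral_of_continuous (μ := μ) hf isCompact_univ

lemma measurable_conj (g : SU2) : Measurable fun x : SU2 => x * g * x⁻¹ :=
  Continuous.measurable (by fun_prop)

lemma classDelta_integral (t : ℝ) {f : SU2 → ℂ} (hf : Continuous f) :
    ∫ x, f x ∂(classDelta t) = ∫ r, f (r * cartan t * r⁻¹) ∂haarSU2 := by
  rw [classDelta, integral_map (measurable_conj _).aemeasurable hf.aestronglyMeasurable]

instance (t : ℝ) : IsProbabilityMeasure (classDelta t) :=
  Measure.isProbabilityMeasure_map (measurable_conj _).aemeasurable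

/-! ### The distribution of the coordinates under the Haar measure -/

instance : HasOuterApproxClosed SU2 := by
  have : TopologicalSpace.PseudoMetrizableSpace SU2 :=
    Topology.IsInducing.subtypeVal.pseudoMetrizableSpace
  infer_instance

lemma hasDerivAt_integral_of_compactSpace {Y : Type*} [TopologicalSpace Y] [CompactSpace Y]
    [MeasurableSpace Y] [OpensMeasurableSpace Y] {μ : Measure Y} [IsFiniteMeasure μ]
    {F F' : ℝ → Y → ℂ} (hF : Continuous (Function.uncurry F))
    (hF' : Continuous (Function.uncurry F')) (h : ∀ t y, HasDerivAt (F · y) (F' t y) t) (t : ℝ) :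
    HasDerivAt (fun t => ∫ y, F t y ∂μ) (∫ y, F' t y ∂μ) t := by
  obtain ⟨C, hC⟩ := ((isCompact_Icc (a := t - 1) (b := t + 1)).prod
    (isCompact_univ (X := Y))).exists_bound_of_continuousOn hF'.continuousOn
  have c1 : ∀ s, Continuous (F s) := fun s => hF.comp (Continuous.prodMk_right s)
  have c2 : ∀ s, Continuous (F' s) := fun s => hF'.comp (Continuous.prodMk_right s)
  refine (hasDerivAt_integral_of_dominated_loc_of_deriv_le (bound := fun _ => C)
    (Icc_mem_nhds (by linarith) (by linarith) : Set.Icc (t - 1) (t + 1) ∈ 𝓝 t)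
    (.of_forall fun s => (c1 s).integrable_of_compactSpace.aestronglyMeasurable)
    (c1 t).integrable_of_compactSpace (c2 t).integrable_of_compactSpace.aestronglyMeasurable
    (.of_forall fun y s hs => hC (s, y) ⟨hs, Set.mem_univ _⟩) (integrable_const _)
    (.of_forall fun y s _ => h s y)).2

/-- Two finite measures on a compact interval with equal moments coincide. -/
lemma Measure.ext_of_moments {a b : ℝ} {μ ν : Measure ℝ} [IsFiniteMeasure μ] [IsFiniteMeasure ν]
    (hμ : ∀ᵐ x ∂μ, x ∈ Set.Icc a b) (hν : ∀ᵐ x ∂ν, x ∈ Set.Icc a b)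
    (h : ∀ k : ℕ, ∫ x, x ^ k ∂μ = ∫ x, x ^ k ∂ν) : μ = ν := by
  have int : ∀ (m : Measure ℝ) [IsFiniteMeasure m], (∀ᵐ x ∂m, x ∈ Set.Icc a b) →
      ∀ f : ℝ → ℝ, Continuous f → Integrable f m := by
    intro m _ hm f hf
    obtain ⟨C, hC⟩ := (isCompact_Icc (a := a) (b := b)).exists_bound_of_continuousOn hf.continuousOn
    exact Integrable.of_bound hf.aestronglyMeasurable C (hm.mono fun x hx => hC x hx)
  have hp : ∀ p : Polynomial ℝ, ∫ x, p.eval x ∂μ = ∫ x, p.eval x ∂ν := by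
    intro p
    simp only [Polynomial.eval_eq_sum_range]
    rw [integral_finsetSum _ fun i _ => int μ hμ _ (by fun_prop),
      integral_finsetSum _ fun i _ => int ν hν _ (by fun_prop)]
    simp only [integral_const_mul, h]
  refine ext_of_forall_integral_eq_of_IsFiniteMeasure fun f => ?_
  set K := μ.real Set.univ + ν.real Set.univ with hK
  have hK0 : 0 ≤ K := by positivity
  rw [← sub_eq_zero, ← abs_eq_zero]
  refine le_antisymm (le_of_forall_pos_le_add fun ε hε => ?_) (abs_nonneg _)
  -- `K` is the sum of the two masses, so the two approximation errors add up to at most `ε`; the `+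
  -- 1` keeps the denominator positive.
  obtain ⟨p, hpε⟩ := exists_polynomial_near_of_continuousOn a b f f.continuous.continuousOn
    (ε / (K + 1)) (by positivity)
  have key : ∀ (m : Measure ℝ) [IsFiniteMeasure m], (∀ᵐ x ∂m, x ∈ Set.Icc a b) →
      |∫ x, p.eval x ∂m - ∫ x, f x ∂m| ≤ ε / (K + 1) * m.real Set.univ := by
    intro m _ hm
    rw [← integral_sub (int m hm _ p.continuous) (int m hm _ f.continuous)]
    rw [← Real.norm_eq_abs]
    exact norm_integral_le_of_norm_le_const (hm.mono fun x hx => by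
      rw [Real.norm_eq_abs]; exact (hpε x hx).le)
  have k1 := abs_le.1 (key μ hμ)
  have k2 := abs_le.1 (key ν hν)
  have hpp := hp p
  have e : ε / (K + 1) * μ.real Set.univ + ε / (K + 1) * ν.real Set.univ ≤ ε := by
    rw [← mul_add, ← hK, div_mul_eq_mul_div, div_le_iff₀ (by positivity)]
    nlinarith
  rw [zero_add, abs_le]
  constructor <;> linarith [k1.1, k1.2, k2.1, k2.2]

namespace SU2

lemma star_mul_self_exp (τ : ℝ) :
    star (Complex.exp (Complex.I * τ)) * Complex.exp (Complex.I * τ) = 1 := by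
  rw [star_exp_I_mul, exp_I_mul]
  have h := congrArg (fun x : ℝ => (x : ℂ)) (Real.sin_sq_add_cos_sq τ)
  push_cast at h ⊢
  linear_combination h - (Complex.sin τ) ^ 2 * Complex.I_sq

/-- Right translation by the torus multiplies a monomial in the entries by a phase. A monomial of
nonzero weight is killed by a `τ` whose phase is `-1`. -/
lemma integral_eq_zero_of_phase {Q : SU2 → ℂ} {τ : ℝ}
    (h : ∀ g, Q (g * cartan τ) = -Q g) : ∫ g, Q g ∂haarSU2 = 0 := by
  have h1 := integral_mul_right_eq_self (μ := haarSU2) Q (cartan τ)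
  simp only [h, integral_neg] at h1
  exact self_eq_neg.1 h1.symm

/-- Rotations in the real plane. -/
noncomputable def rot (θ : ℝ) : SU2 := mk (Real.cos θ) (Real.sin θ) (by
  rw [Complex.normSq_ofReal, Complex.normSq_ofReal]
  linarith [Real.sin_sq_add_cos_sq θ])

lemma star_ofReal (x : ℝ) : star (x : ℂ) = x := Complex.conj_ofReal x

lemma ca_mul_rot (g : SU2) (θ : ℝ) : ca (g * rot θ) = Real.cos θ * ca g - Real.sin θ * cb g := by
  rw [ca_mul, rot, ca_mk, cb_mk, star_ofReal]; ring

lemma cb_mul_rot (g : SU2) (θ : ℝ) : cb (g * rot θ) = Real.sin θ * ca g + Real.cos θ * cb g := by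
  rw [cb_mul, rot, ca_mk, cb_mk, star_ofReal]; ring

lemma continuous_star_ca : Continuous fun g : SU2 => star (ca g) := continuous_ca.star
lemma continuous_star_cb : Continuous fun g : SU2 => star (cb g) := continuous_cb.star

attribute [fun_prop] continuous_ca continuous_cb continuous_star_ca continuous_star_cb
  continuous_cartan

lemma ca_mul_cartan (g : SU2) (τ : ℝ) :
    ca (g * cartan τ) = ca g * Complex.exp (Complex.I * τ) := by simp [ca_mul]

lemma cb_mul_cartan (g : SU2) (τ : ℝ) :
    cb (g * cartan τ) = cb g * star (Complex.exp (Complex.I * τ)) := by simp [cb_mul]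

lemma exp_pi_div_two : Complex.exp (Complex.I * (Real.pi / 2 : ℝ)) = Complex.I := by
  rw [exp_I_mul]; simp

/-- The integral of `a ^ (k + 1) * star a ^ k * star b` after right translation by `rot θ` does not
depend on `θ`. Its derivative at `0` consists of the two integrals to be compared and of a monomial
of nonzero torus weight, which integrates to zero. -/
lemma moment_recursion (k : ℕ) :
    (k + 1 : ℂ) * ∫ g, (ca g * star (ca g)) ^ k * (cb g * star (cb g)) ∂haarSU2 =
      ∫ g, (ca g * star (ca g)) ^ (k + 1) ∂haarSU2 := by
  set A : ℝ → SU2 → ℂ := fun θ g => Real.cos θ * ca g - Real.sin θ * cb g with hA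
  set B : ℝ → SU2 → ℂ := fun θ g => Real.sin θ * ca g + Real.cos θ * cb g with hB
  set A' : ℝ → SU2 → ℂ := fun θ g => Real.cos θ * star (ca g) - Real.sin θ * star (cb g) with hA'
  set B' : ℝ → SU2 → ℂ := fun θ g => Real.sin θ * star (ca g) + Real.cos θ * star (cb g) with hB'
  have dc : ∀ t : ℝ, HasDerivAt (fun t : ℝ => (Real.cos t : ℂ)) (-(Real.sin t) : ℂ) t := by
    intro t; simpa using (Real.hasDerivAt_cos t).ofReal_comp
  have ds : ∀ t : ℝ, HasDerivAt (fun t : ℝ => (Real.sin t : ℂ)) (Real.cos t : ℂ) t := by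
    intro t; simpa using (Real.hasDerivAt_sin t).ofReal_comp
  have dA : ∀ t g, HasDerivAt (A · g) (-(B t g)) t := fun t g => by
    refine (((dc t).mul_const (ca g)).fun_sub ((ds t).mul_const (cb g))).congr_deriv ?_
    simp only [hB]; ring
  have dA' : ∀ t g, HasDerivAt (A' · g) (-(B' t g)) t := fun t g => by
    refine (((dc t).mul_const (star (ca g))).fun_sub
      ((ds t).mul_const (star (cb g)))).congr_deriv ?_
    simp only [hB']; ring
  have dB' : ∀ t g, HasDerivAt (B' · g) (A' t g) t := fun t g => by
    refine (((ds t).mul_const (star (ca g))).fun_add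
      ((dc t).mul_const (star (cb g)))).congr_deriv ?_
    simp only [hA']; ring
  have cs : Continuous fun t : ℝ => (Real.sin t : ℂ) :=
    Complex.continuous_ofReal.comp Real.continuous_sin
  have cc : Continuous fun t : ℝ => (Real.cos t : ℂ) :=
    Complex.continuous_ofReal.comp Real.continuous_cos
  have c1 : Continuous (Function.uncurry A) :=
    ((cc.comp continuous_fst).mul (continuous_ca.comp continuous_snd)).sub
      ((cs.comp continuous_fst).mul (continuous_cb.comp continuous_snd))
  have c2 : Continuous (Function.uncurry A') :=
    ((cc.comp continuous_fst).mul (continuous_star_ca.comp continuous_snd)).sub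
      ((cs.comp continuous_fst).mul (continuous_star_cb.comp continuous_snd))
  have c3 : Continuous (Function.uncurry B') :=
    ((cs.comp continuous_fst).mul (continuous_star_ca.comp continuous_snd)).add
      ((cc.comp continuous_fst).mul (continuous_star_cb.comp continuous_snd))
  have c4 : Continuous (Function.uncurry B) :=
    ((cs.comp continuous_fst).mul (continuous_ca.comp continuous_snd)).add
      ((cc.comp continuous_fst).mul (continuous_cb.comp continuous_snd))
  set Q : SU2 → ℂ := fun g => ca g ^ (k + 1) * star (ca g) ^ k * star (cb g) with hQ
  have hQ0 : ∫ g, Q g ∂haarSU2 = 0 := by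
    -- The monomial has weight two.
    refine integral_eq_zero_of_phase (τ := Real.pi / 2) fun g => ?_
    simp only [hQ, ca_mul_cartan, cb_mul_cartan, exp_pi_div_two, Complex.star_def, map_mul,
      map_neg, Complex.conj_I, mul_pow]
    have : Complex.I ^ (k + 1) * (-Complex.I) ^ k * Complex.I = -1 := by
      rw [show Complex.I ^ (k + 1) * (-Complex.I) ^ k * Complex.I =
        (Complex.I * -Complex.I) ^ k * (Complex.I * Complex.I) by rw [mul_pow]; ring]
      simp
    linear_combination (ca g ^ (k + 1) * (starRingEnd ℂ) (ca g) ^ k *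
      (starRingEnd ℂ) (cb g)) * this
  have hR0 : ∫ g, ca g ^ (k + 1) * ((k : ℂ) * star (ca g) ^ (k - 1)) * star (cb g) ^ 2 ∂haarSU2
      = 0 := by
    -- For `k = 0` the truncated exponent `k - 1` is harmless because of the factor `k`. Otherwise
    -- the monomial has weight four, hence the angle `π / 4`.
    rcases k with _ | k
    · simp
    have he : Complex.exp (Complex.I * (Real.pi / 4 : ℝ)) ^ 2 = Complex.I := by
      rw [← Complex.exp_nat_mul]
      refine Eq.trans (congrArg Complex.exp ?_) exp_pi_div_two
      push_cast; ring
    have he' := star_mul_self_exp (Real.pi / 4)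
    refine integral_eq_zero_of_phase (τ := Real.pi / 4) fun g => ?_
    simp only [ca_mul_cartan, cb_mul_cartan, star_mul', star_star, mul_pow, Nat.add_sub_cancel]
    have : Complex.exp (Complex.I * (Real.pi / 4 : ℝ)) ^ (k + 1 + 1) *
        star (Complex.exp (Complex.I * (Real.pi / 4 : ℝ))) ^ k *
        Complex.exp (Complex.I * (Real.pi / 4 : ℝ)) ^ 2 = -1 := by
      rw [show ∀ x y : ℂ, x ^ (k + 1 + 1) * y ^ k * x ^ 2 = (y * x) ^ k * x ^ 2 * x ^ 2 from
        fun x y => by rw [mul_pow]; ring, he', he]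
      simp
    linear_combination (ca g ^ (k + 1 + 1) * (((k + 1 : ℕ) : ℂ) * star (ca g) ^ k) *
      star (cb g) ^ 2) * this
  have hd := hasDerivAt_integral_of_compactSpace (μ := haarSU2)
    (F := fun θ g => A θ g ^ (k + 1) * A' θ g ^ k * B' θ g)
    (F' := fun θ g => ((((k + 1 : ℕ) : ℂ) * A θ g ^ k * (-(B θ g))) * A' θ g ^ k +
      A θ g ^ (k + 1) * ((k : ℂ) * A' θ g ^ (k - 1) * (-(B' θ g)))) * B' θ g +
      A θ g ^ (k + 1) * A' θ g ^ k * A' θ g)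
    (((c1.pow _).mul (c2.pow _)).mul c3)
    (((((continuous_const.mul (c1.pow _)).mul c4.neg).mul (c2.pow _)).add
      ((c1.pow _).mul ((continuous_const.mul (c2.pow _)).mul c3.neg))).mul c3 |>.add
      (((c1.pow _).mul (c2.pow _)).mul c2))
    (fun t g => by
      simpa only [Nat.add_sub_cancel] using
        (((dA t g).fun_pow (k + 1)).fun_mul ((dA' t g).fun_pow k)).fun_mul (dB' t g)) 0
  have hconst : (fun θ => ∫ g, A θ g ^ (k + 1) * A' θ g ^ k * B' θ g ∂haarSU2) = fun _ => 0 := by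
    ext1 θ
    rw [← hQ0, ← integral_mul_right_eq_self Q (rot θ)]
    refine integral_congr_ae (.of_forall fun g => ?_)
    simp only [hQ, ca_mul_rot, cb_mul_rot, hA, hA', hB', star_sub, star_add, star_mul',
      star_ofReal]
  rw [hconst] at hd
  have h0 := (hasDerivAt_const (0 : ℝ) (0 : ℂ)).unique hd
  simp only [hA, hA', hB, hB', Real.cos_zero, Real.sin_zero, Complex.ofReal_one,
    Complex.ofReal_zero, one_mul, zero_mul, sub_zero, zero_add] at h0
  have e : ∀ g : SU2, (((k + 1 : ℕ) : ℂ) * ca g ^ k * -cb g * star (ca g) ^ k +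
      ca g ^ (k + 1) * ((k : ℂ) * star (ca g) ^ (k - 1) * -star (cb g))) * star (cb g) +
      ca g ^ (k + 1) * star (ca g) ^ k * star (ca g) =
      (ca g * star (ca g)) ^ (k + 1) -
      (k + 1 : ℂ) * ((ca g * star (ca g)) ^ k * (cb g * star (cb g))) -
      ca g ^ (k + 1) * ((k : ℂ) * star (ca g) ^ (k - 1)) * star (cb g) ^ 2 := by
    intro g; push_cast; rw [mul_pow, mul_pow]; ring
  simp only [e] at h0
  rw [integral_sub, integral_sub, integral_const_mul, hR0, sub_zero] at h0
  · linear_combination h0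
  all_goals exact Continuous.integrable_of_compactSpace (by fun_prop)

/-- As `|a|² + |b|² = 1`, the recursion between consecutive moments reads `(k + 1) (M_k - M_{k+1}) =
M_{k+1}`. -/
lemma moment (k : ℕ) : ∫ g, (ca g * star (ca g)) ^ k ∂haarSU2 = 1 / (k + 1) := by
  induction k with
  | zero => simp
  | succ k ih =>
    have h := moment_recursion k
    have e : ∀ g : SU2, (ca g * star (ca g)) ^ k * (cb g * star (cb g)) =
        (ca g * star (ca g)) ^ k - (ca g * star (ca g)) ^ (k + 1) := by
      intro g; linear_combination (ca g * star (ca g)) ^ k * mul_star_add g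
    simp only [e] at h
    rw [integral_sub, ih] at h
    · have h1 : (k + 1 : ℂ) ≠ 0 := by exact_mod_cast k.succ_ne_zero
      have h2 : (k + 1 + 1 : ℂ) ≠ 0 := by exact_mod_cast (k + 1).succ_ne_zero
      push_cast
      field_simp
      field_simp at h
      linear_combination -h
    all_goals exact Continuous.integrable_of_compactSpace (by fun_prop)

lemma continuous_normSq_ca : Continuous fun g : SU2 => Complex.normSq (ca g) :=
  Complex.continuous_normSq.comp continuous_ca

lemma moment_normSq (k : ℕ) : ∫ g, Complex.normSq (ca g) ^ k ∂haarSU2 = 1 / (k + 1) := by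
  have h := moment k
  apply Complex.ofReal_injective
  rw [← integral_complex_ofReal]
  push_cast
  rw [← h]
  refine integral_congr_ae (.of_forall fun g => ?_)
  simp [Complex.mul_conj]

lemma normSq_ca_mem (g : SU2) : Complex.normSq (ca g) ∈ Set.Icc (0 : ℝ) 1 :=
  ⟨Complex.normSq_nonneg _, by linarith [normSq_add g, Complex.normSq_nonneg (cb g)]⟩

/-- The squared modulus of a matrix entry is uniformly distributed on `[0, 1]`. -/
lemma map_normSq_ca :
    haarSU2.map (fun g => Complex.normSq (ca g)) = volume.restrict (Set.Icc 0 1) := by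
  have hm : Measurable fun g : SU2 => Complex.normSq (ca g) := continuous_normSq_ca.measurable
  have := Measure.isProbabilityMeasure_map (μ := haarSU2) hm.aemeasurable
  refine Measure.ext_of_moments (a := 0) (b := 1) ?_ (ae_restrict_mem measurableSet_Icc) ?_
  · exact (ae_map_iff hm.aemeasurable measurableSet_Icc).2 (.of_forall normSq_ca_mem)
  · intro k
    rw [integral_map hm.aemeasurable (by fun_prop), moment_normSq, integral_Icc_eq_integral_Ioc,
      ← intervalIntegral.integral_of_le zero_le_one, integral_pow]
    simp

lemma integral_comp_normSq_ca {P : ℝ → ℂ} (hP : ContinuousOn P (Set.Icc 0 1)) :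
    ∫ g, P (Complex.normSq (ca g)) ∂haarSU2 = ∫ p in (0 : ℝ)..1, P p := by
  rw [intervalIntegral.integral_of_le zero_le_one, ← integral_Icc_eq_integral_Ioc,
    ← map_normSq_ca, integral_map continuous_normSq_ca.measurable.aemeasurable]
  rw [map_normSq_ca]
  exact hP.aestronglyMeasurable measurableSet_Icc

end SU2

/-! ### The Weyl integration formula -/

/-- The measure `Δ(t)² dt / 2π` on `(-π, π]`. -/
noncomputable def weylMeasure : Measure ℝ :=
  (volume.restrict (Set.Ioc (-Real.pi) Real.pi)).withDensity
    fun t => ((Real.sin t ^ 2 / Real.pi).toNNReal : NNReal)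

lemma integral_weylMeasure {E : Type*} [NormedAddCommGroup E] [NormedSpace ℝ E] (f : ℝ → E) :
    ∫ t, f t ∂weylMeasure = ∫ t in (-Real.pi)..Real.pi, (Real.sin t ^ 2 / Real.pi) • f t := by
  rw [weylMeasure, integral_withDensity_eq_integral_smul (Measurable.real_toNNReal (by fun_prop)),
    intervalIntegral.integral_of_le (by linarith [Real.pi_pos])]
  refine integral_congr_ae (.of_forall fun t => ?_)
  have : (0 : ℝ) ≤ Real.sin t ^ 2 / Real.pi := by positivity
  simp only [NNReal.smul_def, Real.coe_toNNReal _ this]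

instance : IsFiniteMeasure weylMeasure := by
  refine isFiniteMeasure_withDensity_ofReal ?_
  refine (Integrable.of_bound (by fun_prop) 1 (.of_forall fun t => ?_)).2
  rw [Real.norm_of_nonneg (by positivity), div_le_one Real.pi_pos]
  nlinarith [Real.sin_sq_le_one t, Real.pi_gt_three]

namespace SU2

lemma ca_cartan_mul (g : SU2) (τ : ℝ) :
    ca (cartan τ * g) = Complex.exp (Complex.I * τ) * ca g := by simp [ca_mul]

/-- The argument of `z` only shifts the angle, which does not matter over a full period. -/
lemma integral_re_phase_pow (z : ℂ) (k : ℕ) :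
    ∫ τ in (-Real.pi)..Real.pi, (Complex.exp (Complex.I * (τ : ℝ)) * z).re ^ k =
      ‖z‖ ^ k * ∫ τ in (-Real.pi)..Real.pi, Real.cos τ ^ k := by
  have h : ∀ τ : ℝ, (Complex.exp (Complex.I * τ) * z).re ^ k =
      ‖z‖ ^ k * Real.cos (τ + Complex.arg z) ^ k := by
    intro τ
    rw [← mul_pow]
    congr 1
    conv_lhs => rw [← Complex.norm_mul_exp_arg_mul_I z]
    rw [mul_left_comm, ← Complex.exp_add, Complex.re_ofReal_mul,
      show Complex.I * (τ : ℂ) + (Complex.arg z : ℂ) * Complex.I =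
        ((τ + Complex.arg z : ℝ) : ℂ) * Complex.I by push_cast; ring,
      Complex.exp_ofReal_mul_I_re]
  simp only [h]
  rw [intervalIntegral.integral_const_mul,
    intervalIntegral.integral_comp_add_right (fun τ => Real.cos τ ^ k)]
  congr 1
  have hp : Function.Periodic (fun τ : ℝ => Real.cos τ ^ k) (2 * Real.pi) := by
    intro τ; simp [Real.cos_add_two_pi]
  have := hp.intervalIntegral_add_eq (-Real.pi + Complex.arg z) (-Real.pi)
  rw [show Real.pi + Complex.arg z = -Real.pi + Complex.arg z + 2 * Real.pi by ring, this]
  congr 1; ring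

lemma integral_cos_pow_odd (j : ℕ) :
    ∫ τ in (-Real.pi)..Real.pi, Real.cos τ ^ (2 * j + 1) = 0 := by
  have h := integral_re_phase_pow (-1) (2 * j + 1)
  simp only [mul_neg, mul_one, Complex.neg_re, norm_neg, norm_one, one_pow, one_mul,
    mul_comm Complex.I, Complex.exp_ofReal_mul_I_re, Odd.neg_pow ⟨j, rfl⟩,
    intervalIntegral.integral_neg] at h
  linarith

/-- Left translation by the torus allows the phase of `ca g` to be averaged, which splits the moment
into one of `|ca g|` and one of the cosine. On the Weyl side `sin² = 1 - cos²` and the reduction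
formula give `C / (π (k + 2))`. For even `k` the two agree by `moment_normSq`; for odd `k` both
vanish. -/
lemma moment_re (k : ℕ) :
    ∫ g, (ca g).re ^ k ∂haarSU2 = ∫ t, Real.cos t ^ k ∂weylMeasure := by
  set C := ∫ τ in (-Real.pi)..Real.pi, Real.cos τ ^ k with hC
  have hpi := Real.pi_pos
  have h1 : ∫ τ in (-Real.pi)..Real.pi, (∫ g, (ca g).re ^ k ∂haarSU2) =
      (∫ g, ‖ca g‖ ^ k ∂haarSU2) * C := by
    have e : ∀ τ : ℝ, ∫ g, (ca g).re ^ k ∂haarSU2 =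
        ∫ g, (Complex.exp (Complex.I * τ) * ca g).re ^ k ∂haarSU2 := by
      intro τ
      rw [← integral_mul_left_eq_self (fun g => (ca g).re ^ k) (cartan τ)]
      simp only [ca_cartan_mul]
    rw [intervalIntegral.integral_congr (fun τ _ => e τ),
      intervalIntegral.integral_of_le (by linarith), integral_integral_swap]
    · simp only [← intervalIntegral.integral_of_le (show -Real.pi ≤ Real.pi by linarith),
        integral_re_phase_pow]
      rw [integral_mul_const]
    · refine Integrable.of_bound (C := 1) (Continuous.aestronglyMeasurable ?_)
        (.of_forall fun x => ?_)
      · exact (Complex.continuous_re.comp ((Continuous.cexp (by fun_prop)).mul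
          (continuous_ca.comp continuous_snd))).pow k
      · simp only [Function.uncurry, norm_pow]
        refine pow_le_one₀ (norm_nonneg _) ?_
        rw [← ca_cartan_mul]
        exact re_ca_le _
  rw [intervalIntegral.integral_const, smul_eq_mul] at h1
  rw [integral_weylMeasure]
  have h2 : ∫ t in (-Real.pi)..Real.pi, (Real.sin t ^ 2 / Real.pi) • Real.cos t ^ k =
      C / (Real.pi * (k + 2)) := by
    have e : ∀ t : ℝ, (Real.sin t ^ 2 / Real.pi) • Real.cos t ^ k =
        (Real.cos t ^ k - Real.cos t ^ (k + 2)) / Real.pi := by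
      intro t
      rw [smul_eq_mul, Real.sin_sq]; ring
    simp only [e]
    rw [intervalIntegral.integral_div, intervalIntegral.integral_sub, integral_cos_pow]
    · simp only [Real.sin_pi, Real.sin_neg, mul_zero, neg_zero, sub_zero, zero_div, zero_add]
      rw [← hC]
      have : (k + 2 : ℝ) ≠ 0 := by positivity
      field_simp
      ring
    all_goals exact Continuous.intervalIntegrable (by fun_prop) _ _
  rw [h2]
  rcases Nat.even_or_odd' k with ⟨j, hj | hj⟩
  · have h3 : ∫ g, ‖ca g‖ ^ k ∂haarSU2 = 1 / (j + 1) := by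
      rw [← moment_normSq j]
      simp only [hj, pow_mul, Complex.normSq_eq_norm_sq]
    rw [h3] at h1
    have h4 : (k : ℝ) = 2 * j := by exact_mod_cast hj
    rw [h4]
    have h5 : (j + 1 : ℝ) ≠ 0 := by positivity
    field_simp at h1 ⊢
    linarith
  · have : C = 0 := by rw [hC, hj, integral_cos_pow_odd]
    rw [this, mul_zero] at h1
    rw [this, zero_div]
    have h6 : Real.pi - -Real.pi ≠ 0 := by linarith
    exact (mul_eq_zero.1 h1).resolve_left h6

lemma continuous_re_ca : Continuous fun g : SU2 => (ca g).re :=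
  Complex.continuous_re.comp continuous_ca

/-- The distribution of half the trace. -/
lemma map_re_ca : haarSU2.map (fun g => (ca g).re) = weylMeasure.map Real.cos := by
  have hm : Measurable fun g : SU2 => (ca g).re := continuous_re_ca.measurable
  have := Measure.isProbabilityMeasure_map (μ := haarSU2) hm.aemeasurable
  have hc := Real.measurable_cos.aemeasurable (μ := weylMeasure)
  refine Measure.ext_of_moments (a := -1) (b := 1) ?_ ?_ ?_
  · exact (ae_map_iff hm.aemeasurable measurableSet_Icc).2
      (.of_forall fun g => abs_le.1 (re_ca_le g))
  · exact (ae_map_iff hc measurableSet_Icc).2 (.of_forall fun t => Real.cos_mem_Icc t)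
  · intro k
    rw [integral_map hm.aemeasurable (by fun_prop), integral_map hc (by fun_prop), moment_re]

/-- The average of a function over the conjugacy class of `g`. -/
noncomputable def conjAvg {E : Type*} [NormedAddCommGroup E] [NormedSpace ℝ E] (f : SU2 → E)
    (g : SU2) : E := ∫ r, f (r * g * r⁻¹) ∂haarSU2

lemma conjAvg_conj {E : Type*} [NormedAddCommGroup E] [NormedSpace ℝ E] (f : SU2 → E)
    (s g : SU2) : conjAvg f (s * g * s⁻¹) = conjAvg f g := by
  rw [conjAvg, conjAvg, ← integral_mul_right_eq_self (fun r => f (r * g * r⁻¹)) s]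
  simp only [mul_inv_rev, mul_assoc]

lemma conjAvg_eq_of_re {E : Type*} [NormedAddCommGroup E] [NormedSpace ℝ E] (f : SU2 → E)
    {g : SU2} {t : ℝ} (h : (ca g).re = Real.cos t) : conjAvg f g = conjAvg f (cartan t) := by
  obtain ⟨r, rfl⟩ := exists_conj_cartan g h
  exact conjAvg_conj f r _

lemma continuous_conjAvg {E : Type*} [NormedAddCommGroup E] [NormedSpace ℝ E]
    [SecondCountableTopology E] {f : SU2 → E} (hf : Continuous f) : Continuous (conjAvg f) :=
  continuous_integral_of_compactSpace (f := fun g r => f (r * g * r⁻¹))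
    (hf.comp (by fun_prop))

lemma integral_conjAvg {E : Type*} [NormedAddCommGroup E] [NormedSpace ℝ E]
    [SecondCountableTopology E] [CompleteSpace E] {f : SU2 → E} (hf : Continuous f) :
    ∫ g, conjAvg f g ∂haarSU2 = ∫ g, f g ∂haarSU2 := by
  unfold conjAvg
  rw [integral_integral_swap]
  · have : ∀ r : SU2, ∫ g, f (r * g * r⁻¹) ∂haarSU2 = ∫ g, f g ∂haarSU2 := by
      intro r
      rw [integral_mul_left_eq_self (fun g => f (g * r⁻¹)) r, integral_mul_right_eq_self]
    simp [this]
  · exact Continuous.integrable_of_compactSpace (hf.comp (by fun_prop))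

/-- Averaging over conjugation keeps the Haar integral and leaves a continuous function of the half
trace alone, whose law is `map_re_ca`. -/
lemma integral_eq_integral_conjAvg_cartan {E : Type*} [NormedAddCommGroup E] [NormedSpace ℝ E]
    [SecondCountableTopology E] [CompleteSpace E] {f : SU2 → E} (hf : Continuous f) :
    ∫ g, f g ∂haarSU2 = ∫ t, conjAvg f (cartan t) ∂weylMeasure := by
  have hc : Continuous fun x : ℝ => conjAvg f (cartan (Real.arccos x)) :=
    (continuous_conjAvg hf).comp (continuous_cartan.comp Real.continuous_arccos)
  have h1 : ∀ g, conjAvg f g = conjAvg f (cartan (Real.arccos (ca g).re)) := by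
    intro g
    have := abs_le.1 (re_ca_le g)
    exact conjAvg_eq_of_re f (by rw [Real.cos_arccos this.1 this.2])
  rw [← integral_conjAvg hf, integral_congr_ae (.of_forall h1),
    ← integral_map (φ := fun g => (ca g).re) continuous_re_ca.measurable.aemeasurable
      hc.aestronglyMeasurable, map_re_ca,
    integral_map Real.measurable_cos.aemeasurable hc.aestronglyMeasurable]
  refine integral_congr_ae (.of_forall fun t => ?_)
  exact conjAvg_eq_of_re f (by
    rw [re_ca_cartan, Real.cos_arccos (Real.neg_one_le_cos _) (Real.cos_le_one _)])

instance : IsProbabilityMeasure weylMeasure := by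
  have h := integral_eq_integral_conjAvg_cartan (f := fun _ => (1 : ℝ)) continuous_const
  refine ⟨?_⟩
  simp [conjAvg] at h
  rw [Measure.real, eq_comm, ENNReal.toReal_eq_one_iff] at h
  exact h

lemma continuous_conj_cartan : Continuous fun p : SU2 × ℝ => p.1 * cartan p.2 * p.1⁻¹ :=
  (continuous_fst.mul (continuous_cartan.comp continuous_snd)).mul continuous_fst.inv

/-- The Weyl integration formula, as an equality of measures. -/
lemma measurePreserving_conj_cartan :
    MeasurePreserving (fun p : SU2 × ℝ => p.1 * cartan p.2 * p.1⁻¹)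
      (haarSU2.prod weylMeasure) haarSU2 := by
  have hm : Measurable fun p : SU2 × ℝ => p.1 * cartan p.2 * p.1⁻¹ :=
    continuous_conj_cartan.measurable
  refine ⟨hm, ?_⟩
  have := Measure.isProbabilityMeasure_map (μ := haarSU2.prod weylMeasure) hm.aemeasurable
  refine ext_of_forall_integral_eq_of_IsFiniteMeasure fun f => ?_
  rw [integral_map hm.aemeasurable f.continuous.aestronglyMeasurable,
    integral_eq_integral_conjAvg_cartan f.continuous, integral_prod_symm]
  · rfl
  · refine Integrable.of_bound (f.continuous.comp continuous_conj_cartan).aestronglyMeasurable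
      ‖f‖ (.of_forall fun x => f.norm_coe_le_norm _)

/-- The Weyl integration formula. -/
lemma integral_weyl {f : SU2 → ℂ} (hf : Continuous f) :
    ∫ g, f g ∂haarSU2 = ∫ t in (0 : ℝ)..Real.pi, (2 * Real.sin t ^ 2 / Real.pi) •
      conjAvg f (cartan t) := by
  rw [integral_eq_integral_conjAvg_cartan hf, integral_weylMeasure]
  have hc : Continuous fun t : ℝ => (Real.sin t ^ 2 / Real.pi) • conjAvg f (cartan t) :=
    Continuous.smul (f := fun t : ℝ => Real.sin t ^ 2 / Real.pi) (by fun_prop) ((continuous_conjAvg hf).comp continuous_cartan)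
  rw [← intervalIntegral.integral_add_adjacent_intervals (b := 0)
    (hc.intervalIntegrable _ _) (hc.intervalIntegrable _ _)]
  -- The integrand is even: `g_{-t}` and `g_t` have the same half trace, hence are conjugate.
  have h1 : ∫ t in (-Real.pi)..0, (Real.sin t ^ 2 / Real.pi) • conjAvg f (cartan t) =
      ∫ t in (0 : ℝ)..Real.pi, (Real.sin t ^ 2 / Real.pi) • conjAvg f (cartan t) := by
    rw [← neg_zero, ← intervalIntegral.integral_comp_neg, neg_zero]
    refine intervalIntegral.integral_congr fun t _ => ?_
    simp only [Real.sin_neg, even_two.neg_pow]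
    rw [conjAvg_eq_of_re f (g := cartan (-t)) (t := t) (by rw [re_ca_cartan, Real.cos_neg])]
  rw [h1, ← two_mul, ← intervalIntegral.integral_const_mul]
  refine intervalIntegral.integral_congr fun t _ => ?_
  simp only [Complex.real_smul]
  push_cast
  ring

end SU2

/-! ### Triples of conjugacy classes -/

namespace SU2

/-- The imaginary part of the diagonal entry of the first element of the standard triple, clipped
so that the triple is defined for all angles. -/
noncomputable def triIm (a b s : ℝ) : ℝ :=
  max (-|Real.sin a|) (min |Real.sin a| ((Real.cos a * Real.cos s - Real.cos b) / Real.sin s))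

lemma triIm_sq_le (a b s : ℝ) : triIm a b s ^ 2 ≤ Real.sin a ^ 2 := by
  rw [sq_le_sq, abs_le]
  exact ⟨le_max_left _ _, max_le (by linarith [abs_nonneg (Real.sin a)]) (min_le_left _ _)⟩

/-- The first element of the standard triple. -/
noncomputable def tri0 (a b s : ℝ) : SU2 :=
  mk (Real.cos a + triIm a b s * Complex.I) (Real.sqrt (Real.sin a ^ 2 - triIm a b s ^ 2)) (by
    rw [Complex.normSq_add_mul_I, Complex.normSq_ofReal, Real.mul_self_sqrt
      (by linarith [triIm_sq_le a b s])]
    linarith [Real.sin_sq_add_cos_sq a])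

/-- The second element of the standard triple. -/
noncomputable def tri1 (a b s : ℝ) : SU2 := (cartan s)⁻¹ * (tri0 a b s)⁻¹

/-- The Gram determinant deciding whether the product of three conjugacy classes contains `1`. -/
noncomputable def gram (a b s : ℝ) : ℝ :=
  1 - Real.cos a ^ 2 - Real.cos b ^ 2 - Real.cos s ^ 2 + 2 * Real.cos a * Real.cos b * Real.cos s

/-- The density of the product of two conjugacy classes. -/
noncomputable def triW (a b s : ℝ) : ℝ :=
  if 0 ≤ gram a b s then Real.pi / (4 * Real.sin a * Real.sin b * Real.sin s) else 0

lemma continuousAt_triIm {a b s : ℝ} (hs : Real.sin s ≠ 0) :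
    ContinuousAt (fun p : ℝ × ℝ × ℝ => triIm p.1 p.2.1 p.2.2) (a, b, s) := by
  unfold triIm
  have h1 : ContinuousAt (fun p : ℝ × ℝ × ℝ => (Real.cos p.1 * Real.cos p.2.2 - Real.cos p.2.1) /
      Real.sin p.2.2) (a, b, s) :=
    ContinuousAt.div (by fun_prop) (by fun_prop) hs
  have h2 : ContinuousAt (fun p : ℝ × ℝ × ℝ => |Real.sin p.1|) (a, b, s) := by fun_prop
  exact h2.neg.max (h2.min h1)

lemma continuousAt_tri0 {a b s : ℝ} (hs : Real.sin s ≠ 0) :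
    ContinuousAt (fun p : ℝ × ℝ × ℝ => tri0 p.1 p.2.1 p.2.2) (a, b, s) := by
  have h := continuousAt_triIm (a := a) (b := b) hs
  have hc : ContinuousAt (fun p : ℝ × ℝ × ℝ => (Real.cos p.1 : ℂ)) (a, b, s) := by fun_prop
  have hs : ContinuousAt (fun p : ℝ × ℝ × ℝ => Real.sin p.1 ^ 2) (a, b, s) := by fun_prop
  refine continuousAt_of_coords ?_ ?_
  · exact hc.add ((Complex.continuous_ofReal.continuousAt.comp h).mul continuousAt_const)
  · exact Complex.continuous_ofReal.continuousAt.comp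
      (Real.continuous_sqrt.continuousAt.comp (hs.sub (h.pow 2)))

lemma continuousAt_tri1 {a b s : ℝ} (hs : Real.sin s ≠ 0) :
    ContinuousAt (fun p : ℝ × ℝ × ℝ => tri1 p.1 p.2.1 p.2.2) (a, b, s) :=
  ContinuousAt.mul (f := fun p : ℝ × ℝ × ℝ => (cartan p.2.2)⁻¹)
    (by fun_prop) (continuousAt_tri0 hs).inv

lemma star_exp (t : ℝ) :
    star (Complex.exp (Complex.I * t)) = Complex.exp (Complex.I * (-t : ℝ)) := by
  rw [← ca_cartan, ← ca_inv, ← cartan_neg, ca_cartan]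

/-- Two elements of given half traces whose product has a given half trace are simultaneously
conjugate to the standard ones. -/
lemma exists_conj_tri {a b s : ℝ} (hs : Real.sin s ≠ 0) {x y : SU2}
    (hx : (ca x).re = Real.cos a) (hy : (ca y).re = Real.cos b)
    (hxy : (ca (x⁻¹ * y⁻¹)).re = Real.cos s) :
    ∃ r, x = r * tri0 a b s * r⁻¹ ∧ y = r * tri1 a b s * r⁻¹ := by
  -- Once `x⁻¹ y⁻¹` is diagonal, the half trace of `x` gives the real part of the diagonal entry of
  -- `z`, that of `y` gives its imaginary part, and the norm condition gives the modulus of the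
  -- off-diagonal entry. In particular the clipping in `triIm` is inactive.
  obtain ⟨r, hr⟩ := exists_conj_cartan _ hxy
  obtain ⟨z, hz⟩ : ∃ z, z = r⁻¹ * x * r := ⟨_, rfl⟩
  have hxz : x = r * z * r⁻¹ := by rw [hz]; group
  have hyz : y = r * ((cartan s)⁻¹ * z⁻¹) * r⁻¹ := by
    have : y = (x⁻¹ * y⁻¹)⁻¹ * x⁻¹ := by group
    rw [this, hr, hxz]; group
  have hz1 : (ca z).re = Real.cos a := by rw [← hx, hxz, re_ca_conj]
  have hz2 : (ca ((cartan s)⁻¹ * z⁻¹)).re = Real.cos b := by rw [← hy, hyz, re_ca_conj]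
  have him : (ca z).im = (Real.cos a * Real.cos s - Real.cos b) / Real.sin s := by
    rw [ca_mul, ca_inv, ca_inv, cb_inv, cb_cartan, ca_cartan, star_exp_I_mul] at hz2
    simp only [Complex.star_def, neg_zero, zero_mul, sub_zero, Complex.mul_re, Complex.sub_re,
      Complex.sub_im, Complex.ofReal_re, Complex.ofReal_im, Complex.mul_im, Complex.I_re,
      Complex.I_im, Complex.conj_re, Complex.conj_im, hz1] at hz2
    field_simp
    linear_combination -hz2
  have hn := normSq_add z
  rw [Complex.normSq_apply (ca z), hz1] at hn
  have hle : |(ca z).im| ≤ |Real.sin a| := by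
    rw [← sq_le_sq]
    nlinarith [Complex.normSq_nonneg (cb z), Real.sin_sq_add_cos_sq a]
  have htri : triIm a b s = (ca z).im := by
    rw [triIm, ← him, min_eq_right (abs_le.1 hle).2, max_eq_right (abs_le.1 hle).1]
  have hcb : Real.sqrt (Real.sin a ^ 2 - triIm a b s ^ 2) = ‖cb z‖ := by
    rw [Real.sqrt_eq_iff_mul_self_eq (by linarith [triIm_sq_le a b s]) (norm_nonneg _),
      ← sq, ← Complex.normSq_eq_norm_sq, htri]
    linarith [Real.sin_sq_add_cos_sq a]
  -- Only the phase of the off-diagonal entry is still free. Conjugation by `g_τ` turns it by `2 τ`,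
  -- hence the half argument, and commutes with `g_s`.
  have key : z = cartan (Complex.arg (cb z) / 2) * tri0 a b s *
      (cartan (Complex.arg (cb z) / 2))⁻¹ := by
    rw [← cartan_neg]
    ext1
    · rw [ca_mul_cartan, ca_cartan_mul, mul_right_comm, ← Complex.exp_add, tri0, ca_mk, htri,
        ← hz1, Complex.re_add_im]
      simp
    · have h0 : cb (tri0 a b s) = ‖cb z‖ := by rw [tri0, cb_mk, hcb]
      have h1 : cb (cartan (Complex.arg (cb z) / 2) * tri0 a b s) =
          Complex.exp (Complex.I * (Complex.arg (cb z) / 2 : ℝ)) * ‖cb z‖ := by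
        rw [cb_mul, cb_cartan, ca_cartan, h0, zero_mul, add_zero]
      rw [cb_mul_cartan, h1, star_exp, neg_neg, mul_right_comm, ← Complex.exp_add]
      conv_lhs => rw [← Complex.norm_mul_exp_arg_mul_I (cb z)]
      rw [mul_comm]
      congr 2
      push_cast; ring
  refine ⟨r * cartan (Complex.arg (cb z) / 2), ?_, ?_⟩
  · conv_lhs => rw [hxz, key]
    group
  · conv_lhs => rw [hyz, key]
    have hcomm : (cartan s)⁻¹ * cartan (Complex.arg (cb z) / 2) =
        cartan (Complex.arg (cb z) / 2) * (cartan s)⁻¹ := by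
      rw [← cartan_neg, ← cartan_add, ← cartan_add, add_comm]
    rw [tri1]
    simp only [mul_inv_rev, inv_inv, ← mul_assoc]
    rw [mul_assoc r (cartan s)⁻¹, hcomm]
    simp only [← mul_assoc]

/-- The average of a function of two variables over simultaneous conjugation. -/
noncomputable def conjAvg2 (φ : SU2 → SU2 → ℂ) (x y : SU2) : ℂ :=
  ∫ r, φ (r * x * r⁻¹) (r * y * r⁻¹) ∂haarSU2

lemma conjAvg2_conj (φ : SU2 → SU2 → ℂ) (s x y : SU2) :
    conjAvg2 φ (s * x * s⁻¹) (s * y * s⁻¹) = conjAvg2 φ x y := by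
  rw [conjAvg2, conjAvg2,
    ← integral_mul_right_eq_self (fun r => φ (r * x * r⁻¹) (r * y * r⁻¹)) s]
  simp only [mul_inv_rev, mul_assoc]

lemma continuous_conjAvg2 {φ : SU2 → SU2 → ℂ} (hφ : Continuous (Function.uncurry φ)) :
    Continuous (Function.uncurry (conjAvg2 φ)) :=
  continuous_integral_of_compactSpace (f := fun (p : SU2 × SU2) r =>
      φ (r * p.1 * r⁻¹) (r * p.2 * r⁻¹))
    (hφ.comp (g := Function.uncurry φ) (f := fun q : (SU2 × SU2) × SU2 =>
      (q.2 * q.1.1 * q.2⁻¹, q.2 * q.1.2 * q.2⁻¹)) (by fun_prop))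

/-- By left invariance in `q`, the second element may be conjugated by the same `r` as the first, so
that the `r`-integral becomes a simultaneous average. -/
lemma integral_classDelta_prod (a b : ℝ) {φ : SU2 → SU2 → ℂ}
    (hφ : Continuous (Function.uncurry φ)) :
    ∫ x, ∫ y, φ x y ∂(classDelta b) ∂(classDelta a) =
      ∫ q, conjAvg2 φ (cartan a) (q * cartan b * q⁻¹) ∂haarSU2 := by
  have c1 : ∀ x, Continuous fun y => φ x y := fun x => hφ.comp (Continuous.prodMk_right x)
  simp only [fun x => classDelta_integral b (c1 x)]
  rw [classDelta_integral a]
  · have : ∀ r : SU2, ∫ q, φ (r * cartan a * r⁻¹) (q * cartan b * q⁻¹) ∂haarSU2 =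
        ∫ q, φ (r * cartan a * r⁻¹) (r * (q * cartan b * q⁻¹) * r⁻¹) ∂haarSU2 := by
      intro r
      rw [← integral_mul_left_eq_self (fun q => φ (r * cartan a * r⁻¹) (q * cartan b * q⁻¹)) r]
      simp only [mul_inv_rev, mul_assoc]
    simp only [this, conjAvg2]
    refine integral_integral_swap (Continuous.integrable_of_compactSpace ?_)
    exact hφ.comp (g := Function.uncurry φ) (f := fun p : SU2 × SU2 =>
      (p.1 * cartan a * p.1⁻¹, p.1 * (p.2 * cartan b * p.2⁻¹) * p.1⁻¹)) (by fun_prop)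
  · exact continuous_integral_of_compactSpace (hφ.comp (g := Function.uncurry φ)
      (f := fun p : SU2 × SU2 => (p.1, p.2 * cartan b * p.2⁻¹)) (by fun_prop))

/-- Since `normSq (ca q)` is uniform on `[0, 1]` and enters affinely, the half trace of the product
is uniform between `cos (a + b)` and `cos (a - b)`. This is the origin of `triW`. -/
lemma re_ca_inv_mul_inv (a b : ℝ) (q : SU2) :
    (ca ((cartan a)⁻¹ * (q * cartan b * q⁻¹)⁻¹)).re = Real.cos a * Real.cos b -
      Real.sin a * Real.sin b * (2 * Complex.normSq (ca q) - 1) := by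
  have h := normSq_add q
  have hc : ca (q * cartan b * q⁻¹) =
      Real.cos b + Real.sin b * Complex.I * ((2 * Complex.normSq (ca q) - 1 : ℝ) : ℂ) := by
    have h1 := mul_star_add q
    have h2 : ((2 * Complex.normSq (ca q) - 1 : ℝ) : ℂ) =
        ca q * star (ca q) - cb q * star (cb q) := by
      push_cast
      rw [← Complex.mul_conj, ← Complex.star_def]
      linear_combination h1
    rw [h2, ca_mul, ca_mul, cb_mul, ca_inv, cb_inv, cb_cartan, ca_cartan, star_exp_I_mul,
      exp_I_mul, star_zero, star_neg]
    linear_combination ((Real.cos b : ℂ)) * h1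
  rw [ca_mul, ca_inv, ca_inv, cb_inv, cb_cartan, ca_cartan, star_exp_I_mul, hc]
  simp [-Complex.ofReal_cos, -Complex.ofReal_sin, Complex.mul_re, Complex.mul_im]
  ring

/-- In this form `gram` is visibly nonnegative exactly when `cos s` lies between `cos (a + b)` and
`cos (a - b)`. -/
lemma gram_eq (a b s : ℝ) : gram a b s =
    (Real.sin a * Real.sin b) ^ 2 - (Real.cos s - Real.cos a * Real.cos b) ^ 2 := by
  rw [mul_pow, Real.sin_sq, Real.sin_sq, gram]; ring

/-- Admissible pairs of angles: those for which the product of the conjugacy classes avoids the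
center. -/
structure Regular (a b : ℝ) : Prop where
  a_mem : a ∈ Set.Ioo 0 Real.pi
  b_mem : b ∈ Set.Ioo 0 Real.pi
  ne : a ≠ b
  add_ne : a + b ≠ Real.pi

lemma Regular.cos_sub_lt {a b : ℝ} (h : Regular a b) : Real.cos (a - b) < 1 := by
  refine lt_of_le_of_ne (Real.cos_le_one _) fun hc => h.ne ?_
  rw [Real.cos_eq_one_iff_of_lt_of_lt (by linarith [h.a_mem.1, h.b_mem.2, Real.pi_pos])
    (by linarith [h.a_mem.2, h.b_mem.1, Real.pi_pos])] at hc
  linarith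

lemma Regular.lt_cos_add {a b : ℝ} (h : Regular a b) : -1 < Real.cos (a + b) := by
  refine lt_of_le_of_ne (Real.neg_one_le_cos _) fun hc => h.add_ne ?_
  have hc' : Real.cos (a + b - Real.pi) = 1 := by rw [Real.cos_sub_pi]; linarith
  rw [Real.cos_eq_one_iff_of_lt_of_lt (by linarith [h.a_mem.1, h.b_mem.1, Real.pi_pos])
    (by linarith [h.a_mem.2, h.b_mem.2, Real.pi_pos])] at hc'
  linarith

lemma sin_arccos_pos {c : ℝ} (h1 : -1 < c) (h2 : c < 1) : 0 < Real.sin (Real.arccos c) := by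
  rw [Real.sin_arccos]
  exact Real.sqrt_pos.2 (by nlinarith)

/-- Regularity keeps the half trace of `x⁻¹ y⁻¹` strictly inside `(-1, 1)`. There every pair is
conjugate to a standard one, and the standard pair varies continuously with `p`. -/
lemma integral_classDelta_prod_eq_interval {a b : ℝ} (h : Regular a b) {φ : SU2 → SU2 → ℂ}
    (hφ : Continuous (Function.uncurry φ)) :
    ∫ x, ∫ y, φ x y ∂(classDelta b) ∂(classDelta a) =
      ∫ p in (0 : ℝ)..1, conjAvg2 φ
        (tri0 a b (Real.arccos (Real.cos a * Real.cos b - Real.sin a * Real.sin b * (2 * p - 1))))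
        (tri1 a b (Real.arccos
          (Real.cos a * Real.cos b - Real.sin a * Real.sin b * (2 * p - 1)))) := by
  have hd : 0 < Real.sin a * Real.sin b :=
    mul_pos (Real.sin_pos_of_mem_Ioo h.a_mem) (Real.sin_pos_of_mem_Ioo h.b_mem)
  have hlt := h.cos_sub_lt
  have hgt := h.lt_cos_add
  rw [Real.cos_sub] at hlt
  rw [Real.cos_add] at hgt
  set c : ℝ → ℝ := fun p => Real.cos a * Real.cos b - Real.sin a * Real.sin b * (2 * p - 1) with hc
  have hc1 : ∀ p ∈ Set.Icc (0 : ℝ) 1, -1 < c p := fun p hp => by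
    simp only [hc]; nlinarith [hp.2]
  have hc2 : ∀ p ∈ Set.Icc (0 : ℝ) 1, c p < 1 := fun p hp => by
    simp only [hc]; nlinarith [hp.1]
  have hcc : Continuous fun p => Real.arccos (c p) :=
    Real.continuous_arccos.comp (by simp only [hc]; fun_prop)
  rw [integral_classDelta_prod a b hφ, ← integral_comp_normSq_ca]
  · refine integral_congr_ae (.of_forall fun q => ?_)
    have hq := normSq_ca_mem q
    obtain ⟨r, h1, h2⟩ := exists_conj_tri (a := a) (b := b)
      (s := Real.arccos (c (Complex.normSq (ca q))))
      (sin_arccos_pos (hc1 _ hq) (hc2 _ hq)).ne' (re_ca_cartan a)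
      (y := q * cartan b * q⁻¹) (by rw [re_ca_conj, re_ca_cartan])
      (by rw [re_ca_inv_mul_inv, Real.cos_arccos (hc1 _ hq).le (hc2 _ hq).le])
    change conjAvg2 φ (cartan a) (q * cartan b * q⁻¹) = _
    conv_lhs => rw [h1, h2]
    exact conjAvg2_conj φ r _ _
  · intro p hp
    apply ContinuousAt.continuousWithinAt
    have hs := (sin_arccos_pos (hc1 _ hp) (hc2 _ hp)).ne'
    have e : ContinuousAt (fun p => (a, b, Real.arccos (c p))) p := by fun_prop
    have e0 : ContinuousAt (fun p => tri0 a b (Real.arccos (c p))) p :=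
      ContinuousAt.comp (f := fun p => (a, b, Real.arccos (c p))) (continuousAt_tri0 hs) e
    have e1 : ContinuousAt (fun p => tri1 a b (Real.arccos (c p))) p :=
      ContinuousAt.comp (f := fun p => (a, b, Real.arccos (c p))) (continuousAt_tri1 hs) e
    exact ContinuousAt.comp (f := fun p => (tri0 a b (Real.arccos (c p)),
      tri1 a b (Real.arccos (c p)))) (continuous_conjAvg2 hφ).continuousAt (e0.prodMk e1)

/-- The disintegration of the product of two conjugacy classes. -/
lemma integral_classDelta_prod_eq {a b : ℝ} (h : Regular a b) {φ : SU2 → SU2 → ℂ}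
    (hφ : Continuous (Function.uncurry φ)) :
    ∫ x, ∫ y, φ x y ∂(classDelta b) ∂(classDelta a) =
      ∫ s in (0 : ℝ)..Real.pi, (2 * Real.sin s ^ 2 / Real.pi * triW a b s) •
        conjAvg2 φ (tri0 a b s) (tri1 a b s) := by
  rw [integral_classDelta_prod_eq_interval h hφ]
  have hsa := Real.sin_pos_of_mem_Ioo h.a_mem
  have hsb := Real.sin_pos_of_mem_Ioo h.b_mem
  set d := Real.sin a * Real.sin b with hdd
  set c := Real.cos a * Real.cos b with hcc
  have hd : 0 < d := mul_pos hsa hsb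
  have hlt := h.cos_sub_lt
  have hgt := h.lt_cos_add
  rw [Real.cos_sub] at hlt
  rw [Real.cos_add] at hgt
  set Y : ℝ → ℂ := fun s => conjAvg2 φ (tri0 a b s) (tri1 a b s) with hY
  have e1 : ∫ p in (0 : ℝ)..1, Y (Real.arccos (c - d * (2 * p - 1))) =
      (2 * d)⁻¹ • ∫ x in (c - d)..(c + d), Y (Real.arccos x) := by
    have h2 := intervalIntegral.integral_comp_sub_mul (a := 0) (b := 1)
      (fun x => Y (Real.arccos x)) (c := 2 * d) (by positivity) (c + d)
    rw [show c + d - 2 * d * 1 = c - d by ring, show c + d - 2 * d * 0 = c + d by ring] at h2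
    rw [← h2]
    refine intervalIntegral.integral_congr fun p _ => ?_
    congr 2; ring
  change ∫ p in (0 : ℝ)..1, Y (Real.arccos (c - d * (2 * p - 1))) = _
  rw [e1, intervalIntegral.integral_of_le (by linarith), ← integral_Icc_eq_integral_Ioc,
    intervalIntegral.integral_of_le Real.pi_pos.le, ← integral_Icc_eq_integral_Ioc]
  set S : Set ℝ := {s | 0 ≤ gram a b s} with hS
  have hSm : MeasurableSet S := measurableSet_le measurable_const (by unfold gram; fun_prop)
  have hSiff : ∀ s, s ∈ S ↔ Real.cos s ∈ Set.Icc (c - d) (c + d) := by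
    intro s
    change 0 ≤ gram a b s ↔ _
    rw [gram_eq, ← hdd, ← hcc, sub_nonneg, sq_le_sq, abs_of_pos hd, abs_le]
    constructor
    · rintro ⟨h1, h2⟩; constructor <;> linarith
    · rintro ⟨h1, h2⟩; constructor <;> linarith
  have himg : Set.Icc (c - d) (c + d) = Real.cos '' (Set.Icc 0 Real.pi ∩ S) := by
    ext x
    constructor
    · intro hx
      have hx1 : -1 ≤ x := by linarith [hx.1]
      have hx2 : x ≤ 1 := by linarith [hx.2]
      refine ⟨Real.arccos x, ⟨⟨Real.arccos_nonneg x, Real.arccos_le_pi x⟩, ?_⟩,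
        Real.cos_arccos hx1 hx2⟩
      rw [hSiff, Real.cos_arccos hx1 hx2]
      exact hx
    · rintro ⟨s, hs, rfl⟩
      exact (hSiff s).1 hs.2
  -- Substituting `x = cos s` turns the uniform density `1 / (2 d)` into `sin s / (2 d)`, which is
  -- `triW` times the Weyl density `2 sin² s / π`.
  rw [himg, integral_image_eq_integral_abs_deriv_smul (measurableSet_Icc.inter hSm)
    (fun s _ => (Real.hasDerivAt_cos s).hasDerivWithinAt)
    (Real.injOn_cos.mono Set.inter_subset_left), ← setIntegral_indicator hSm, ← integral_smul]
  refine setIntegral_congr_fun measurableSet_Icc fun s hs => ?_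
  have hs0 : 0 ≤ Real.sin s := Real.sin_nonneg_of_mem_Icc hs
  simp only [Set.indicator, triW]
  by_cases hg : s ∈ S
  · have hg' : 0 ≤ gram a b s := hg
    rw [if_pos hg, if_pos hg', Real.arccos_cos hs.1 hs.2, smul_smul, abs_neg, abs_of_nonneg hs0]
    congr 1
    rw [hdd]
    have := Real.pi_pos
    rcases hs0.eq_or_lt with h0 | h0
    · rw [← h0]; simp
    · field_simp
      ring
  · have hg' : ¬ 0 ≤ gram a b s := hg
    rw [if_neg hg, if_neg hg']
    simp

end SU2

/-! ### Products with the delta function -/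

/-- If a property holds near the fibre of a continuous map on a compact space, it holds on the
preimage of a neighbourhood. -/
lemma exists_nhds_forall_of_fiber {X Y : Type*} [TopologicalSpace X] [CompactSpace X]
    [TopologicalSpace Y] [T2Space Y] {m : X → Y} (hm : Continuous m) {y : Y} {P : X → Prop}
    (h : ∀ x, m x = y → ∀ᶠ x' in 𝓝 x, P x') : ∃ U ∈ 𝓝 y, ∀ x, m x ∈ U → P x := by
  -- The points where `P` may fail nearby form a compact set, whose image is closed and misses `y`.
  have hC : IsClosed (m '' (interior {x | P x})ᶜ) :=
    (isOpen_interior.isClosed_compl.isCompact.image hm).isClosed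
  refine ⟨(m '' (interior {x | P x})ᶜ)ᶜ, hC.isOpen_compl.mem_nhds ?_, fun x hx => ?_⟩
  · rintro ⟨x, hx, hxy⟩
    exact hx (mem_interior_iff_mem_nhds.2 (h x hxy))
  · by_contra hP
    exact hx ⟨x, fun hi => hP (interior_subset hi), rfl⟩

namespace SU2

lemma eq_one_of_re_ca {g : SU2} (h : (ca g).re = 1) : g = 1 := by
  have h1 := normSq_add g
  rw [Complex.normSq_apply (ca g), h] at h1
  have h2 : (ca g).im = 0 := by
    nlinarith [Complex.normSq_nonneg (cb g), mul_self_nonneg (ca g).im]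
  have h3 : Complex.normSq (cb g) = 0 := by rw [h2] at h1; linarith
  ext1
  · exact Complex.ext (by simp [h]) (by simp [h2])
  · simpa using h3

/-- Without a delta sequence the convergence in `IsDeltaProduct` would be vacuous. Since the half
trace equals `1` only at the identity, normalized truncations `max 0 (1 - n (1 - Re (ca g)))`
concentrate there. -/
lemma exists_isDeltaSequence : ∃ k, IsDeltaSequence k := by
  set f : ℕ → SU2 → ℝ := fun n g => max 0 (1 - n * (1 - (ca g).re)) with hf
  have hfc : ∀ n, Continuous (f n) := fun n =>
    continuous_const.max (continuous_const.sub (continuous_const.mul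
      (continuous_const.sub continuous_re_ca)))
  have hf0 : ∀ n g, 0 ≤ f n g := fun n g => le_max_left _ _
  have hpos : ∀ n, 0 < ∫ g, f n g ∂haarSU2 := fun n =>
    (hfc n).integral_pos_of_hasCompactSupport_nonneg_nonzero
      (HasCompactSupport.of_compactSpace _) (hf0 n) (x := 1) (by simp [hf])
  refine ⟨fun n g => f n g / ∫ g, f n g ∂haarSU2, fun n => (hfc n).div_const _,
    fun n g => div_nonneg (hf0 n g) (hpos n).le, fun n => ?_, fun U hU => ?_⟩
  · rw [integral_div, div_self (hpos n).ne']
  · have hK : IsCompact (interior U)ᶜ := isOpen_interior.isClosed_compl.isCompact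
    obtain ⟨δ, hδ, hδU⟩ : ∃ δ > 0, ∀ g ∉ U, δ ≤ 1 - (ca g).re := by
      rcases (interior U)ᶜ.eq_empty_or_nonempty with h | h
      · refine ⟨1, one_pos, fun g hg => ?_⟩
        have : g ∈ (interior U)ᶜ := fun h' => hg (interior_subset h')
        rw [h] at this
        exact this.elim
      · obtain ⟨g₀, hg₀, hmin⟩ := hK.exists_isMinOn h
          (continuous_const.sub continuous_re_ca).continuousOn (f := fun g => 1 - (ca g).re)
        refine ⟨1 - (ca g₀).re, ?_, fun g hg => hmin fun h' => hg (interior_subset h')⟩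
        have h1 := (abs_le.1 (re_ca_le g₀)).2
        refine sub_pos.2 (lt_of_le_of_ne h1 fun h2 => hg₀ ?_)
        rw [eq_one_of_re_ca h2]
        exact mem_interior_iff_mem_nhds.2 hU
    obtain ⟨N, hN⟩ := exists_nat_ge (1 / δ)
    filter_upwards [eventually_ge_atTop N] with n hn g hg
    have h1 : (1 / δ : ℝ) ≤ n := hN.trans (by exact_mod_cast hn)
    have h2 := hδU g hg
    have h3 : 1 ≤ n * δ := by rwa [div_le_iff₀ hδ] at h1
    have h4 : (n : ℝ) * δ ≤ n * (1 - (ca g).re) := by gcongr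
    have h5 : f n g = 0 := max_eq_left (by linarith)
    rw [h5, zero_div]

end SU2

lemma IsDeltaProduct.deltaProduct {X : Type*} [TopologicalSpace X] [MeasurableSpace X]
    {μ : Measure X} {m : X → SU2} {ν : Measure X} (h : IsDeltaProduct μ m ν) :
    IsDeltaProduct μ m (deltaProduct μ m) := by
  have h' : ∃ ν, IsDeltaProduct μ m ν := ⟨ν, h⟩
  rw [_root_.deltaProduct, dif_pos h']
  exact h'.choose_spec

/-- `deltaProduct` is an arbitrary witness. Uniqueness of limits along one delta sequence lets any
explicit `ν` replace it in integrals of continuous functions. -/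
lemma IsDeltaProduct.integral_deltaProduct {X : Type*} [TopologicalSpace X] [MeasurableSpace X]
    {μ : Measure X} {m : X → SU2} {ν : Measure X} (h : IsDeltaProduct μ m ν) {φ : X → ℂ}
    (hφ : Continuous φ) : ∫ x, φ x ∂(_root_.deltaProduct μ m) = ∫ x, φ x ∂ν := by
  obtain ⟨k, hk⟩ := SU2.exists_isDeltaSequence
  exact tendsto_nhds_unique (h.deltaProduct.2 k hk φ hφ) (h.2 k hk φ hφ)

/-! ### Integrals over triples -/

lemma continuous_vec3 {X Y : Type*} [TopologicalSpace X] [TopologicalSpace Y] {f g h : X → Y}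
    (hf : Continuous f) (hg : Continuous g) (hh : Continuous h) :
    Continuous fun x => (![f x, g x, h x] : Fin 3 → Y) :=
  continuous_pi fun i => by fin_cases i <;> assumption

lemma measurable_vec3 {X : Type*} [MeasurableSpace X] :
    Measurable fun p : (X × X) × X => (![p.1.1, p.1.2, p.2] : Fin 3 → X) :=
  measurable_pi_lambda _ fun i => by fin_cases i <;> simp <;> fun_prop

lemma measurePreserving_vec3 {X : Type*} [MeasurableSpace X] (μ : Fin 3 → Measure X)
    [∀ i, SigmaFinite (μ i)] :
    MeasurePreserving (fun p : (X × X) × X => (![p.1.1, p.1.2, p.2] : Fin 3 → X))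
      (((μ 0).prod (μ 1)).prod (μ 2)) (Measure.pi μ) := by
  refine ⟨measurable_vec3, (Measure.pi_eq fun s hs => ?_).symm⟩
  rw [Measure.map_apply measurable_vec3 (MeasurableSet.univ_pi hs)]
  have : (fun p : (X × X) × X => (![p.1.1, p.1.2, p.2] : Fin 3 → X)) ⁻¹' Set.univ.pi s =
      (s 0 ×ˢ s 1) ×ˢ s 2 := by
    ext p
    simp [Fin.forall_fin_succ, and_assoc]
  rw [this, Measure.prod_prod, Measure.prod_prod, Fin.prod_univ_three]

lemma integral_pi3 {X : Type*} [MeasurableSpace X] (μ : Fin 3 → Measure X)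
    [∀ i, SigmaFinite (μ i)] {F : (Fin 3 → X) → ℂ} (hF : Integrable F (Measure.pi μ)) :
    ∫ x, F x ∂(Measure.pi μ) = ∫ x, ∫ y, ∫ z, F ![x, y, z] ∂(μ 2) ∂(μ 1) ∂(μ 0) := by
  have h := measurePreserving_vec3 μ
  have hi : Integrable (fun p : (X × X) × X => F ![p.1.1, p.1.2, p.2])
    (((μ 0).prod (μ 1)).prod (μ 2)) := h.integrable_comp_of_integrable hF
  rw [← h.map_eq, integral_map h.aemeasurable (by rw [h.map_eq]; exact hF.aestronglyMeasurable),
    integral_prod _ hi, integral_prod _ hi.integral_prod_left]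

lemma integral_pi3_symm {X : Type*} [MeasurableSpace X] (μ : Fin 3 → Measure X)
    [∀ i, IsFiniteMeasure (μ i)] [TopologicalSpace X] [CompactSpace X] [BorelSpace X]
    [SecondCountableTopology X] {F : (Fin 3 → X) → ℂ} (hF : Continuous F) :
    ∫ x, F x ∂(Measure.pi μ) = ∫ z, ∫ x, ∫ y, F ![x, y, z] ∂(μ 1) ∂(μ 0) ∂(μ 2) := by
  have h := measurePreserving_vec3 μ
  have hF' : Integrable F (Measure.pi μ) := hF.integrable_of_compactSpace
  have hi : Integrable (fun p : (X × X) × X => F ![p.1.1, p.1.2, p.2])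
    (((μ 0).prod (μ 1)).prod (μ 2)) := h.integrable_comp_of_integrable hF'
  rw [← h.map_eq, integral_map h.aemeasurable (by rw [h.map_eq]; exact hF'.aestronglyMeasurable),
    integral_prod_symm _ hi]
  refine integral_congr_ae (.of_forall fun z => ?_)
  refine integral_prod _ (Continuous.integrable_of_compactSpace ?_)
  exact hF.comp (continuous_vec3 continuous_fst continuous_snd continuous_const)

/-- Averages of nearly constant functions. -/
lemma norm_integral_mul_sub_le {Y : Type*} [MeasurableSpace Y] {μ : Measure Y} {ψ : Y → ℂ}
    {κ : Y → ℝ} {w : ℂ} {ε : ℝ} (hκ : Integrable κ μ) (h0 : ∀ y, 0 ≤ κ y)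
    (hψ : Integrable (fun y => ψ y * κ y) μ) (h : ∀ y, κ y ≠ 0 → ‖ψ y - w‖ ≤ ε) :
    ‖∫ y, ψ y * κ y ∂μ - w * ∫ y, κ y ∂μ‖ ≤ ε * ∫ y, κ y ∂μ := by
  have hκ' : Integrable (fun y => (κ y : ℂ)) μ := hκ.ofReal
  rw [← integral_complex_ofReal, ← integral_const_mul, ← integral_sub hψ (hκ'.const_mul w),
    ← integral_const_mul]
  refine norm_integral_le_of_norm_le (hκ.const_mul ε) (.of_forall fun y => ?_)
  rw [← sub_mul, norm_mul, Complex.norm_real, Real.norm_of_nonneg (h0 y)]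
  by_cases hy : κ y = 0
  · simp [hy]
  · exact mul_le_mul_of_nonneg_right (h y hy) (h0 y)

lemma continuous_closing : Continuous closing :=
  (((continuous_apply 0).inv).mul (continuous_apply 1).inv).mul (continuous_apply 2).inv

lemma closing_vec3 (x y z : SU2) : closing ![x, y, z] = x⁻¹ * y⁻¹ * z⁻¹ := rfl

/-! ### The product with the Haar measure -/

/-- The Haar measure of `{x₁⁻¹ x₂⁻¹ x₃⁻¹ = 1}`. -/
noncomputable def closedHaar : Measure (Fin 3 → SU2) :=
  (haarSU2.prod haarSU2).map fun p => ![p.1, p.2, p.1⁻¹ * p.2⁻¹]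

lemma continuous_closedTriple :
    Continuous fun p : SU2 × SU2 => (![p.1, p.2, p.1⁻¹ * p.2⁻¹] : Fin 3 → SU2) :=
  continuous_vec3 (by fun_prop) (by fun_prop) (by fun_prop)

lemma integral_closedHaar {φ : (Fin 3 → SU2) → ℂ} (hφ : Continuous φ) :
    ∫ x, φ x ∂closedHaar = ∫ x, ∫ y, φ ![x, y, x⁻¹ * y⁻¹] ∂haarSU2 ∂haarSU2 := by
  rw [closedHaar, integral_map continuous_closedTriple.measurable.aemeasurable
    hφ.aestronglyMeasurable, integral_prod]
  exact (hφ.comp continuous_closedTriple).integrable_of_compactSpace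

/-- For fixed `x` and `y` the substitution `u = x⁻¹ y⁻¹ z⁻¹` makes the kernel `k n u`, so the inner
integral averages `φ` near `z = x⁻¹ y⁻¹`. Compactness makes the error uniform in `x` and `y`. -/
lemma isDeltaProduct_haarSU2Cubed : IsDeltaProduct haarSU2Cubed closing closedHaar := by
  refine ⟨Measure.isFiniteMeasure_map _ _, fun k hk φ hφ => ?_⟩
  rw [Metric.tendsto_atTop']
  intro ε hε
  obtain ⟨U, hU, hUφ⟩ := exists_nhds_forall_of_fiber (X := SU2 × SU2 × SU2) (y := (1 : SU2))
    (m := fun p => p.2.2)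
    (P := fun p => ‖φ ![p.1, p.2.1, p.2.2⁻¹ * (p.1⁻¹ * p.2.1⁻¹)] -
      φ ![p.1, p.2.1, p.1⁻¹ * p.2.1⁻¹]‖ < ε / 2) (by fun_prop) (by
      rintro ⟨x, y, u⟩ hu
      have hc : Continuous fun p : SU2 × SU2 × SU2 =>
          ‖φ ![p.1, p.2.1, p.2.2⁻¹ * (p.1⁻¹ * p.2.1⁻¹)] - φ ![p.1, p.2.1, p.1⁻¹ * p.2.1⁻¹]‖ :=
        ((hφ.comp (continuous_vec3 (by fun_prop) (by fun_prop) (by fun_prop))).sub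
          (hφ.comp (continuous_vec3 (by fun_prop) (by fun_prop) (by fun_prop)))).norm
      refine hc.continuousAt.eventually_lt continuousAt_const ?_
      simp only at hu
      simp [hu, hε])
  obtain ⟨N, hN⟩ := eventually_atTop.1 (hk.support_shrinks U hU)
  refine ⟨N, fun n hn => ?_⟩
  have hkc : Continuous (k n) := hk.continuous n
  have hkc' : Continuous fun g => (k n g : ℂ) := Complex.continuous_ofReal.comp hkc
  have hφk : Continuous fun x => φ x * (k n (closing x) : ℂ) :=
    hφ.mul (hkc'.comp continuous_closing)
  rw [haarSU2Cubed, integral_pi3 _ hφk.integrable_of_compactSpace, integral_closedHaar hφ]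
  have hsub : ∀ x y : SU2, ∫ z, φ ![x, y, z] * (k n (closing ![x, y, z]) : ℂ) ∂haarSU2 =
      ∫ u, φ ![x, y, u⁻¹ * (x⁻¹ * y⁻¹)] * (k n u : ℂ) ∂haarSU2 := by
    intro x y
    rw [← integral_inv_eq_self (fun u => φ ![x, y, u⁻¹ * (x⁻¹ * y⁻¹)] * (k n u : ℂ)),
      ← integral_mul_right_eq_self
        (fun z => φ ![x, y, z] * (k n (closing ![x, y, z]) : ℂ)) (x⁻¹ * y⁻¹)]
    refine integral_congr_ae (.of_forall fun z => ?_)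
    simp [closing_vec3, mul_assoc]
  have hb : ∀ x y : SU2, ‖∫ u, φ ![x, y, u⁻¹ * (x⁻¹ * y⁻¹)] * (k n u : ℂ) ∂haarSU2 -
      φ ![x, y, x⁻¹ * y⁻¹]‖ ≤ ε / 2 := by
    intro x y
    have := norm_integral_mul_sub_le (μ := haarSU2) (κ := k n) (ε := ε / 2)
      (ψ := fun u => φ ![x, y, u⁻¹ * (x⁻¹ * y⁻¹)]) (w := φ ![x, y, x⁻¹ * y⁻¹])
      hkc.integrable_of_compactSpace (hk.nonneg n)
      (((hφ.comp (continuous_vec3 (by fun_prop) (by fun_prop) (by fun_prop))).mul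
        hkc').integrable_of_compactSpace)
      (fun u hu => (hUφ (x, y, u) (by
        by_contra hc
        exact hu (hN n hn.le u hc))).le)
    simpa [hk.integral_eq_one n] using this
  simp only [hsub]
  have hc1 : Continuous fun p : SU2 × SU2 =>
      ∫ u, φ ![p.1, p.2, u⁻¹ * (p.1⁻¹ * p.2⁻¹)] * (k n u : ℂ) ∂haarSU2 :=
    continuous_integral_of_compactSpace
      ((hφ.comp (continuous_vec3 (by fun_prop) (by fun_prop) (by fun_prop))).mul
        (hkc'.comp continuous_snd))
  have hc2 : Continuous fun p : SU2 × SU2 => φ ![p.1, p.2, p.1⁻¹ * p.2⁻¹] :=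
    hφ.comp continuous_closedTriple
  rw [← integral_prod (fun p : SU2 × SU2 =>
      ∫ u, φ ![p.1, p.2, u⁻¹ * (p.1⁻¹ * p.2⁻¹)] * (k n u : ℂ) ∂haarSU2)
      hc1.integrable_of_compactSpace,
    ← integral_prod (fun p : SU2 × SU2 => φ ![p.1, p.2, p.1⁻¹ * p.2⁻¹])
      hc2.integrable_of_compactSpace, dist_eq_norm,
    ← integral_sub hc1.integrable_of_compactSpace hc2.integrable_of_compactSpace]
  refine lt_of_le_of_lt (norm_integral_le_of_norm_le_const (C := ε / 2)
    (.of_forall fun p => hb p.1 p.2)) ?_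
  simpa using hε

/-! ### The product with three conjugacy classes -/

namespace SU2

lemma continuous_conj (g : SU2) : Continuous fun r : SU2 => r * g * r⁻¹ := by fun_prop

/-- The average over right translations by the diagonal torus. -/
noncomputable def torusAvg (F : SU2 → ℂ) (r : SU2) : ℂ :=
  (2 * Real.pi)⁻¹ • ∫ τ in (0 : ℝ)..2 * Real.pi, F (r * cartan τ)

lemma cartan_periodic (τ : ℝ) : cartan (τ + 2 * Real.pi) = cartan τ := by
  ext1
  · rw [ca_cartan, ca_cartan]
    push_cast
    rw [mul_add, Complex.exp_add, show Complex.I * (2 * (Real.pi : ℂ)) = 2 * Real.pi * Complex.I by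
      ring, Complex.exp_two_pi_mul_I, mul_one]
  · simp

lemma torusAvg_mul_cartan (F : SU2 → ℂ) (r : SU2) (σ : ℝ) :
    torusAvg F (r * cartan σ) = torusAvg F r := by
  have hp : Function.Periodic (fun τ => F (r * cartan τ)) (2 * Real.pi) := by
    intro τ; simp only [cartan_periodic]
  have h := hp.intervalIntegral_add_eq σ 0
  simp only [torusAvg, mul_assoc, ← cartan_add]
  rw [intervalIntegral.integral_comp_add_left (fun τ => F (r * cartan τ)), add_zero, h, zero_add]

/-- Torus translation preserves both the Haar measure and `κ`, so all translates of `F` have the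
same integral against `κ`. -/
lemma integral_torusAvg_mul {F : SU2 → ℂ} (hF : Continuous F) {κ : SU2 → ℂ} (hκ : Continuous κ)
    (h : ∀ r τ, κ (r * cartan τ) = κ r) :
    ∫ r, torusAvg F r * κ r ∂haarSU2 = ∫ r, F r * κ r ∂haarSU2 := by
  have h1 : ∀ τ : ℝ, ∫ r, F (r * cartan τ) * κ r ∂haarSU2 = ∫ r, F r * κ r ∂haarSU2 := by
    intro τ
    rw [← integral_mul_right_eq_self (fun r => F r * κ r) (cartan τ)]
    simp only [h]
  have h2 : ∀ r, torusAvg F r * κ r =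
      (2 * Real.pi)⁻¹ • ∫ τ in Set.Ioc (0 : ℝ) (2 * Real.pi), F (r * cartan τ) * κ r := by
    intro r
    rw [torusAvg, intervalIntegral.integral_of_le (by positivity), smul_mul_assoc,
      ← integral_mul_const]
  simp only [h2]
  rw [integral_smul, integral_integral_swap]
  · simp only [h1]
    rw [setIntegral_const, smul_smul]
    have : (2 * Real.pi)⁻¹ * volume.real (Set.Ioc (0 : ℝ) (2 * Real.pi)) = 1 := by
      rw [Real.volume_real_Ioc_of_le (by positivity), sub_zero]
      exact inv_mul_cancel₀ (by positivity)
    rw [this, one_smul]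
  · obtain ⟨C, hC⟩ := (isCompact_univ (X := SU2)).exists_bound_of_continuousOn hF.continuousOn
    obtain ⟨D, hD⟩ := (isCompact_univ (X := SU2)).exists_bound_of_continuousOn hκ.continuousOn
    refine Integrable.of_bound (C := C * D) (Continuous.aestronglyMeasurable ?_)
      (.of_forall fun p => ?_)
    · exact (hF.comp (f := fun p : SU2 × ℝ => p.1 * cartan p.2) (by fun_prop)).mul
        (hκ.comp continuous_fst)
    · rw [Function.uncurry, norm_mul]
      exact mul_le_mul (hC _ (Set.mem_univ _)) (hD _ (Set.mem_univ _)) (norm_nonneg _)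
        ((norm_nonneg _).trans (hC 1 (Set.mem_univ _)))

lemma measurable_triW (a b : ℝ) : Measurable fun s => triW a b s := by
  unfold triW
  refine Measurable.ite (measurableSet_le measurable_const ?_) (by fun_prop) measurable_const
  unfold gram; fun_prop

/-- The Weyl density absorbs the pole of `triW` at `sin s = 0`, which leaves a weight bounded in
`s`. Vanishing sines are covered by the value `0` of division by zero. -/
lemma weight_eq (a b s : ℝ) : 2 * Real.sin s ^ 2 / Real.pi * triW a b s =
    if 0 ≤ gram a b s then Real.sin s / (2 * (Real.sin a * Real.sin b)) else 0 := by
  unfold triW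
  split_ifs
  · have := Real.pi_pos.ne'
    by_cases h1 : Real.sin a = 0
    · simp [h1]
    by_cases h2 : Real.sin b = 0
    · simp [h2]
    by_cases h3 : Real.sin s = 0
    · simp [h3]
    field_simp
    ring
  · simp

lemma triW_nonneg {a b s : ℝ} (ha : a ∈ Set.Ioo 0 Real.pi) (hb : b ∈ Set.Ioo 0 Real.pi)
    (hs : s ∈ Set.Ioo 0 Real.pi) : 0 ≤ triW a b s := by
  unfold triW
  split_ifs
  · have h1 := Real.sin_pos_of_mem_Ioo ha
    have h2 := Real.sin_pos_of_mem_Ioo hb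
    have h3 := Real.sin_pos_of_mem_Ioo hs
    have := Real.pi_pos
    positivity
  · exact le_rfl

/-- Inside `(0, π)`, `triW` can jump only on `gram = 0`: elsewhere it is locally zero or locally the
smooth quotient. This is why those angles are excluded. -/
lemma continuousAt_triW {a b s : ℝ} (ha : a ∈ Set.Ioo 0 Real.pi) (hb : b ∈ Set.Ioo 0 Real.pi)
    (hs : s ∈ Set.Ioo 0 Real.pi) (hg : gram a b s ≠ 0) : ContinuousAt (fun s => triW a b s) s := by
  have hgc : Continuous fun s => gram a b s := by unfold gram; fun_prop
  have h1 := Real.sin_pos_of_mem_Ioo ha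
  have h2 := Real.sin_pos_of_mem_Ioo hb
  have h3 := Real.sin_pos_of_mem_Ioo hs
  rcases lt_or_gt_of_ne hg with h | h
  · have he : (fun s => triW a b s) =ᶠ[𝓝 s] fun _ => 0 := by
      filter_upwards [hgc.continuousAt.eventually_lt continuousAt_const h] with s' hs'
      rw [triW, if_neg (not_le.2 hs')]
    exact continuousAt_const.congr he.symm
  · have he : (fun s => triW a b s) =ᶠ[𝓝 s]
        fun s => Real.pi / (4 * Real.sin a * Real.sin b * Real.sin s) := by
      filter_upwards [continuousAt_const.eventually_lt hgc.continuousAt h] with s' hs'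
      rw [triW, if_pos hs'.le]
    exact (ContinuousAt.div (by fun_prop) (by fun_prop) (by positivity)).congr he.symm

lemma continuousOn_tri (a b : ℝ) :
    ContinuousOn (fun s => (tri0 a b s, tri1 a b s)) (Set.Ioo 0 Real.pi) := by
  intro s hs
  have h := (Real.sin_pos_of_mem_Ioo hs).ne'
  have e : ContinuousAt (fun s : ℝ => (a, b, s)) s := by fun_prop
  exact ((ContinuousAt.comp (f := fun s => (a, b, s)) (continuousAt_tri0 h) e).prodMk
    (ContinuousAt.comp (f := fun s => (a, b, s)) (continuousAt_tri1 h) e)).continuousWithinAt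

lemma intervalIntegrable_tri {a b : ℝ} {φ : SU2 → SU2 → ℂ}
    (hφ : Continuous (Function.uncurry φ)) :
    IntervalIntegrable (fun s => (2 * Real.sin s ^ 2 / Real.pi * triW a b s) •
      conjAvg2 φ (tri0 a b s) (tri1 a b s)) volume 0 Real.pi := by
  rw [intervalIntegrable_iff_integrableOn_Ioo_of_le Real.pi_pos.le]
  obtain ⟨C, hC⟩ := (isCompact_univ (X := SU2 × SU2)).exists_bound_of_continuousOn
    (continuous_conjAvg2 hφ).continuousOn
  refine Integrable.of_bound (C := 1 / |2 * (Real.sin a * Real.sin b)| * C) ?_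
    (.of_forall fun s => ?_)
  · have h := measurable_triW a b
    have hA : AEStronglyMeasurable (fun s => 2 * Real.sin s ^ 2 / Real.pi * triW a b s)
        (volume.restrict (Set.Ioo 0 Real.pi)) := Measurable.aestronglyMeasurable (by fun_prop)
    have hB : AEStronglyMeasurable (fun s => conjAvg2 φ (tri0 a b s) (tri1 a b s))
        (volume.restrict (Set.Ioo 0 Real.pi)) := ((continuous_conjAvg2 hφ).comp_continuousOn
          (continuousOn_tri a b)).aestronglyMeasurable measurableSet_Ioo
    exact hA.smul hB
  · rw [norm_smul, weight_eq]
    refine mul_le_mul ?_ (hC (tri0 a b s, tri1 a b s) (Set.mem_univ _)) (norm_nonneg _)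
      (by positivity)
    split_ifs
    · rw [norm_div, Real.norm_eq_abs, Real.norm_eq_abs]
      gcongr
      exact Real.abs_sin_le_one s
    · simp only [norm_zero]; positivity

/-- The standard triple moved by conjugation. -/
noncomputable def orbit (a b s : ℝ) (r : SU2) : Fin 3 → SU2 :=
  ![r * tri0 a b s * r⁻¹, r * tri1 a b s * r⁻¹, r * cartan s * r⁻¹]

lemma continuous_orbit (a b s : ℝ) : Continuous (orbit a b s) :=
  continuous_vec3 (by fun_prop) (by fun_prop) (by fun_prop)

lemma tri_inv_mul_inv (a b s : ℝ) (r : SU2) :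
    (r * tri0 a b s * r⁻¹)⁻¹ * (r * tri1 a b s * r⁻¹)⁻¹ = r * cartan s * r⁻¹ := by
  rw [tri1]; group

lemma conj_mul_cartan (r : SU2) (s τ : ℝ) :
    r * cartan τ * cartan s * (r * cartan τ)⁻¹ = r * cartan s * r⁻¹ := by
  have h : cartan τ * cartan s = cartan s * cartan τ := by
    rw [← cartan_add, ← cartan_add, add_comm]
  rw [mul_assoc r, h]; group

/-- The measure on the triples of three conjugacy classes with product `1`. -/
noncomputable def closedClasses (a b s : ℝ) : Measure (Fin 3 → SU2) :=
  ENNReal.ofReal (triW a b s) • haarSU2.map (orbit a b s)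

lemma integral_closedClasses {a b s : ℝ} (ha : a ∈ Set.Ioo 0 Real.pi)
    (hb : b ∈ Set.Ioo 0 Real.pi) (hs : s ∈ Set.Ioo 0 Real.pi) {φ : (Fin 3 → SU2) → ℂ}
    (hφ : Continuous φ) :
    ∫ x, φ x ∂(closedClasses a b s) = triW a b s • ∫ r, φ (orbit a b s r) ∂haarSU2 := by
  rw [closedClasses, integral_smul_measure, ENNReal.toReal_ofReal (triW_nonneg ha hb hs),
    integral_map (continuous_orbit a b s).measurable.aemeasurable hφ.aestronglyMeasurable]

/-- The test function on the first two classes, for a given element of the third. -/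
def slice (φ : (Fin 3 → SU2) → ℂ) (z x y r : SU2) : ℂ := φ ![r * x * r⁻¹, r * y * r⁻¹, z]

lemma continuous_slice {φ : (Fin 3 → SU2) → ℂ} (hφ : Continuous φ) (z x y : SU2) :
    Continuous (slice φ z x y) :=
  hφ.comp (continuous_vec3 (by fun_prop) (by fun_prop) (by fun_prop))

lemma continuous_torusAvg_slice {φ : (Fin 3 → SU2) → ℂ} (hφ : Continuous φ) :
    Continuous fun p : SU2 × SU2 × SU2 × SU2 => torusAvg (slice φ p.1 p.2.1 p.2.2.1) p.2.2.2 := by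
  unfold torusAvg slice
  have hc : Continuous (Function.uncurry fun (p : SU2 × SU2 × SU2 × SU2) (τ : ℝ) =>
      φ ![p.2.2.2 * cartan τ * p.2.1 * (p.2.2.2 * cartan τ)⁻¹,
        p.2.2.2 * cartan τ * p.2.2.1 * (p.2.2.2 * cartan τ)⁻¹, p.1]) := by
    refine hφ.comp (f := fun q : (SU2 × SU2 × SU2 × SU2) × ℝ =>
      ![q.1.2.2.2 * cartan q.2 * q.1.2.1 * (q.1.2.2.2 * cartan q.2)⁻¹,
        q.1.2.2.2 * cartan q.2 * q.1.2.2.1 * (q.1.2.2.2 * cartan q.2)⁻¹, q.1.1])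
      (continuous_vec3 ?_ ?_ ?_) <;> fun_prop
  exact (intervalIntegral.continuous_parametric_intervalIntegral_of_continuous' hc
    0 (2 * Real.pi)).const_smul ((2 * Real.pi)⁻¹)

lemma torusAvg_slice_eq (φ : (Fin 3 → SU2) → ℂ) (a b s : ℝ) (r : SU2) :
    torusAvg (slice φ (r * cartan s * r⁻¹) (tri0 a b s) (tri1 a b s)) r =
      torusAvg (fun r => φ (orbit a b s r)) r := by
  simp only [torusAvg, slice, orbit, conj_mul_cartan]

/-- If the two conjugates coincide, their half traces give `s = s₀`, and `r⁻¹ c` commutes with the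
regular element `g_{s₀}`, hence lies in the torus. The torus average does not see this ambiguity, so
the two terms agree there. Continuity and compactness of the parameter space extend this to a
neighbourhood. -/
lemma exists_nhds_torusAvg_close {a b s₀ : ℝ} (ha : a ∈ Set.Ioo 0 Real.pi)
    (hb : b ∈ Set.Ioo 0 Real.pi) (hs₀ : s₀ ∈ Set.Ioo 0 Real.pi) (hg : gram a b s₀ ≠ 0)
    {φ : (Fin 3 → SU2) → ℂ} (hφ : Continuous φ) {ε : ℝ} (hε : 0 < ε) :
    ∃ U ∈ 𝓝 (1 : SU2), ∀ s ∈ Set.Icc 0 Real.pi, ∀ r c : SU2,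
      r * cartan s * r⁻¹ * (c * cartan s₀ * c⁻¹)⁻¹ ∈ U →
      ‖triW a b s • torusAvg (slice φ (c * cartan s₀ * c⁻¹) (tri0 a b s) (tri1 a b s)) r -
        triW a b s₀ • torusAvg (fun r => φ (orbit a b s₀ r)) c‖ < ε := by
  suffices key : ∀ p : Set.Icc (0 : ℝ) Real.pi × SU2 × SU2,
      p.2.1 * cartan p.1 * p.2.1⁻¹ * (p.2.2 * cartan s₀ * p.2.2⁻¹)⁻¹ = 1 →
      ∀ᶠ p' in 𝓝 p, ‖triW a b p'.1 • torusAvg (slice φ (p'.2.2 * cartan s₀ * p'.2.2⁻¹)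
        (tri0 a b p'.1) (tri1 a b p'.1)) p'.2.1 -
          triW a b s₀ • torusAvg (fun r => φ (orbit a b s₀ r)) p'.2.2‖ < ε by
    obtain ⟨U, hU, h⟩ := exists_nhds_forall_of_fiber (by fun_prop) key
    exact ⟨U, hU, fun s hs r c => h (⟨s, hs⟩, r, c)⟩
  rintro ⟨⟨s, hs⟩, r, c⟩ hm
  simp only at hm
  rw [mul_inv_eq_one] at hm
  have hss : s = s₀ := by
    refine Real.injOn_cos hs ⟨hs₀.1.le, hs₀.2.le⟩ ?_
    rw [← re_ca_cartan, ← re_ca_cartan, ← re_ca_conj r, hm, re_ca_conj]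
  subst hss
  have hsin := (Real.sin_pos_of_mem_Ioo hs₀).ne'
  have hcomm : r⁻¹ * c * cartan s = cartan s * (r⁻¹ * c) := by
    have : cartan s = r⁻¹ * (c * cartan s * c⁻¹) * r := by rw [← hm]; group
    conv_rhs => rw [this]
    group
  obtain ⟨σ, hσ⟩ := eq_cartan_of_commute hsin hcomm
  have hc : c = r * cartan σ := by rw [← hσ]; group
  have hval : triW a b s • torusAvg (slice φ (c * cartan s * c⁻¹) (tri0 a b s) (tri1 a b s)) r -
      triW a b s • torusAvg (fun r => φ (orbit a b s r)) c = 0 := by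
    rw [← hm, torusAvg_slice_eq, hc, torusAvg_mul_cartan, sub_self]
  have e : ContinuousAt (fun p : Set.Icc (0 : ℝ) Real.pi × SU2 × SU2 => (a, b, (p.1 : ℝ)))
      (⟨s, hs⟩, r, c) := by fun_prop
  have e0 := ContinuousAt.comp (f := fun p : Set.Icc (0 : ℝ) Real.pi × SU2 × SU2 =>
    (a, b, (p.1 : ℝ))) (x := (⟨s, hs⟩, r, c)) (continuousAt_tri0 hsin) e
  have e1 := ContinuousAt.comp (f := fun p : Set.Icc (0 : ℝ) Real.pi × SU2 × SU2 =>
    (a, b, (p.1 : ℝ))) (x := (⟨s, hs⟩, r, c)) (continuousAt_tri1 hsin) e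
  have eW := ContinuousAt.comp (f := fun p : Set.Icc (0 : ℝ) Real.pi × SU2 × SU2 => (p.1 : ℝ))
    (x := (⟨s, hs⟩, r, c)) (continuousAt_triW ha hb hs₀ hg) (by fun_prop)
  have e2 : ContinuousAt (fun p : Set.Icc (0 : ℝ) Real.pi × SU2 × SU2 =>
      p.2.2 * cartan s * p.2.2⁻¹) (⟨s, hs⟩, r, c) := by fun_prop
  have e3 : ContinuousAt (fun p : Set.Icc (0 : ℝ) Real.pi × SU2 × SU2 => p.2.1)
    (⟨s, hs⟩, r, c) := by fun_prop
  have e4 : ContinuousAt (fun p : Set.Icc (0 : ℝ) Real.pi × SU2 × SU2 =>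
      torusAvg (slice φ (p.2.2 * cartan s * p.2.2⁻¹) (tri0 a b p.1) (tri1 a b p.1)) p.2.1)
      (⟨s, hs⟩, r, c) :=
    ContinuousAt.comp (f := fun p : Set.Icc (0 : ℝ) Real.pi × SU2 × SU2 =>
      (p.2.2 * cartan s * p.2.2⁻¹, tri0 a b p.1, tri1 a b p.1, p.2.1))
      (continuous_torusAvg_slice hφ).continuousAt (e2.prodMk (e0.prodMk (e1.prodMk e3)))
  have e5 : Continuous fun c => torusAvg (fun r => φ (orbit a b s r)) c := by
    refine ((continuous_torusAvg_slice hφ).comp (f := fun c => (c * cartan s * c⁻¹, tri0 a b s,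
      tri1 a b s, c)) (by fun_prop)).congr fun c => ?_
    exact torusAvg_slice_eq φ a b s c
  have e6 := ((eW.smul e4).sub ((e5.continuousAt.comp (f := fun p :
    Set.Icc (0 : ℝ) Real.pi × SU2 × SU2 => p.2.2) (x := (⟨s, hs⟩, r, c))
    (by fun_prop)).const_smul (triW a b s))).norm
  refine e6.eventually_lt continuousAt_const ?_
  exact lt_of_eq_of_lt ((congrArg norm hval).trans norm_zero) hε

lemma integral_torusAvg_orbit {φ : (Fin 3 → SU2) → ℂ} (hφ : Continuous φ) (a b s : ℝ) :
    ∫ c, torusAvg (fun r => φ (orbit a b s r)) c ∂haarSU2 =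
      ∫ r, φ (orbit a b s r) ∂haarSU2 := by
  simpa using integral_torusAvg_mul (F := fun r => φ (orbit a b s r))
    (hφ.comp (continuous_orbit a b s)) (κ := fun _ => 1) continuous_const (fun _ _ => rfl)

lemma continuous_torusAvg_orbit {φ : (Fin 3 → SU2) → ℂ} (hφ : Continuous φ) (a b s : ℝ) :
    Continuous fun c => torusAvg (fun r => φ (orbit a b s r)) c := by
  refine ((continuous_torusAvg_slice hφ).comp (f := fun c => (c * cartan s * c⁻¹, tri0 a b s,
    tri1 a b s, c)) (by fun_prop)).congr fun c => ?_
  exact torusAvg_slice_eq φ a b s c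

/-- On the orbit of the standard pair the kernel sees `r` only through `r * cartan s * r⁻¹`, which
is torus invariant, so the slice can be replaced by its torus average. -/
lemma conjAvg2_mul_eq {φ : (Fin 3 → SU2) → ℂ} (hφ : Continuous φ) {κ : SU2 → ℝ}
    (hκ : Continuous κ) (z : SU2) (a b s : ℝ) :
    conjAvg2 (fun x y => φ ![x, y, z] * (κ (x⁻¹ * y⁻¹ * z⁻¹) : ℂ)) (tri0 a b s)
      (tri1 a b s) = ∫ r, torusAvg (slice φ z (tri0 a b s) (tri1 a b s)) r *
        (κ (r * cartan s * r⁻¹ * z⁻¹) : ℂ) ∂haarSU2 := by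
  have hκs : Continuous fun r => κ (r * cartan s * r⁻¹ * z⁻¹) :=
    hκ.comp ((continuous_conj (cartan s)).mul continuous_const)
  have hκ' : Continuous fun r => (κ (r * cartan s * r⁻¹ * z⁻¹) : ℂ) :=
    Complex.continuous_ofReal.comp hκs
  rw [integral_torusAvg_mul (continuous_slice hφ z _ _) hκ'
    (fun r τ => by rw [conj_mul_cartan])]
  refine integral_congr_ae (.of_forall fun r => ?_)
  simp only [slice, tri_inv_mul_inv]

/-- The integral of a class function against half of the Weyl measure, scaled. -/
lemma integral_weyl_translate {κ : SU2 → ℝ} (hκ : Continuous κ) (h1 : ∫ g, κ g ∂haarSU2 = 1)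
    (z : SU2) : ∫ s in (0 : ℝ)..Real.pi, (2 * Real.sin s ^ 2 / Real.pi) *
      ∫ r, κ (r * cartan s * r⁻¹ * z⁻¹) ∂haarSU2 = 1 := by
  have hκ' : Continuous fun g => (κ g : ℂ) := Complex.continuous_ofReal.comp hκ
  have hz : Continuous fun g => (κ (g * z⁻¹) : ℂ) :=
    hκ'.comp (continuous_mul_const z⁻¹)
  have := integral_weyl hz
  rw [integral_mul_right_eq_self (fun g => (κ g : ℂ)), integral_complex_ofReal, h1] at this
  apply Complex.ofReal_injective
  rw [← intervalIntegral.integral_ofReal, this]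
  refine intervalIntegral.integral_congr fun s _ => ?_
  simp only [Complex.real_smul, conjAvg, integral_complex_ofReal]
  push_cast
  rfl

/-- After disintegration the double integral is an average of `triW • torusAvg` over `(s, r)`, with
a nonnegative weight of mass one by `integral_weyl_translate`. Such an average stays within `ε` of
`w` if the averaged function does so on the support. -/
lemma norm_integral_classDelta_prod_sub_le {a b : ℝ} (h : Regular a b) {φ : (Fin 3 → SU2) → ℂ}
    (hφ : Continuous φ) {κ : SU2 → ℝ} (hκ : Continuous κ) (h0 : ∀ g, 0 ≤ κ g)
    (h1 : ∫ g, κ g ∂haarSU2 = 1) {z : SU2} {w : ℂ} {ε : ℝ}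
    (hw : ∀ s ∈ Set.Icc 0 Real.pi, ∀ r, κ (r * cartan s * r⁻¹ * z⁻¹) ≠ 0 →
      ‖triW a b s • torusAvg (slice φ z (tri0 a b s) (tri1 a b s)) r - w‖ ≤ ε) :
    ‖∫ x, ∫ y, φ ![x, y, z] * κ (x⁻¹ * y⁻¹ * z⁻¹) ∂(classDelta b) ∂(classDelta a) - w‖ ≤ ε := by
  have hκ' : Continuous fun g => (κ g : ℂ) := Complex.continuous_ofReal.comp hκ
  have hc : Continuous (Function.uncurry fun x y => φ ![x, y, z] * (κ (x⁻¹ * y⁻¹ * z⁻¹) : ℂ)) :=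
    (hφ.comp (continuous_vec3 (by fun_prop) (by fun_prop) (by fun_prop))).mul
      (hκ'.comp (f := fun p : SU2 × SU2 => p.1⁻¹ * p.2⁻¹ * z⁻¹) (by fun_prop))
  rw [integral_classDelta_prod_eq h hc]
  have hintR := integral_weyl_translate hκ h1 z
  set K : ℝ → ℝ := fun s => ∫ r, κ (r * cartan s * r⁻¹ * z⁻¹) ∂haarSU2 with hK
  have hKc : Continuous K :=
    continuous_integral_of_compactSpace (f := fun s r => κ (r * cartan s * r⁻¹ * z⁻¹))
      (hκ.comp (f := fun p : ℝ × SU2 => p.2 * cartan p.1 * p.2⁻¹ * z⁻¹) (by fun_prop))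
  change ∫ s in (0 : ℝ)..Real.pi, (2 * Real.sin s ^ 2 / Real.pi) * K s = 1 at hintR
  have hKC : Continuous fun s => (K s : ℂ) := Complex.continuous_ofReal.comp hKc
  have hK2 : Continuous fun s => (2 * Real.sin s ^ 2 / Real.pi) • (w * (K s : ℂ)) :=
    Continuous.smul (f := fun s => 2 * Real.sin s ^ 2 / Real.pi) (by fun_prop)
      (continuous_const.mul hKC)
  have hwint : w = ∫ s in (0 : ℝ)..Real.pi, (2 * Real.sin s ^ 2 / Real.pi) • (w * (K s : ℂ)) := by
    have e : ∀ s : ℝ, (2 * Real.sin s ^ 2 / Real.pi) • (w * (K s : ℂ)) =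
        w * ((2 * Real.sin s ^ 2 / Real.pi * K s : ℝ) : ℂ) := by
      intro s; rw [Complex.real_smul]; push_cast; ring
    simp only [e]
    rw [intervalIntegral.integral_const_mul, intervalIntegral.integral_ofReal, hintR,
      Complex.ofReal_one, mul_one]
  conv_lhs => rw [hwint]
  rw [← intervalIntegral.integral_sub (intervalIntegrable_tri hc) (hK2.intervalIntegrable _ _),
    ← mul_one ε, ← hintR, ← intervalIntegral.integral_const_mul]
  refine intervalIntegral.norm_integral_le_of_norm_le Real.pi_pos.le
    (.of_forall fun s hs => ?_) (Continuous.intervalIntegrable (by fun_prop) _ _)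
  have hs' : s ∈ Set.Icc 0 Real.pi := ⟨hs.1.le, hs.2⟩
  have hκs : Continuous fun r => κ (r * cartan s * r⁻¹ * z⁻¹) :=
    hκ.comp ((continuous_conj (cartan s)).mul continuous_const)
  have e := conjAvg2_mul_eq hφ hκ z a b s
  have hT : Continuous fun r => torusAvg (slice φ z (tri0 a b s) (tri1 a b s)) r :=
    (continuous_torusAvg_slice hφ).comp (f := fun r => (z, tri0 a b s, tri1 a b s, r))
      (by fun_prop)
  have hbound := norm_integral_mul_sub_le (μ := haarSU2)
    (κ := fun r => κ (r * cartan s * r⁻¹ * z⁻¹)) (ε := ε) (w := w)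
    (ψ := fun r => triW a b s • torusAvg (slice φ z (tri0 a b s) (tri1 a b s)) r)
    hκs.integrable_of_compactSpace (fun r => h0 _)
    ((hT.const_smul (triW a b s)).mul
      (Complex.continuous_ofReal.comp hκs)).integrable_of_compactSpace (fun r hr => hw s hs' r hr)
  simp only [smul_mul_assoc, integral_smul] at hbound
  rw [mul_smul, ← smul_sub, e, norm_smul, Real.norm_of_nonneg (by positivity)]
  calc 2 * Real.sin s ^ 2 / Real.pi * ‖_‖
      ≤ 2 * Real.sin s ^ 2 / Real.pi * (ε * K s) :=
        mul_le_mul_of_nonneg_left hbound (by positivity)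
    _ = ε * (2 * Real.sin s ^ 2 / Real.pi * K s) := by ring

/-- With the third element fixed at `c g_{t 2} c⁻¹`, the integral over the first two classes tends
to the torus-averaged orbit function at `c` times `triW`, uniformly in `c`. Integrating over `c`
removes the torus average. -/
lemma isDeltaProduct_classDelta3 {t : Fin 3 → ℝ} (h : Regular (t 0) (t 1))
    (hs : t 2 ∈ Set.Ioo 0 Real.pi) (hg : gram (t 0) (t 1) (t 2) ≠ 0) :
    IsDeltaProduct (classDelta3 t) closing (closedClasses (t 0) (t 1) (t 2)) := by
  refine ⟨?_, fun k hk φ hφ => ?_⟩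
  · have : IsFiniteMeasure (haarSU2.map (orbit (t 0) (t 1) (t 2))) :=
      Measure.isFiniteMeasure_map _ _
    exact Measure.smul_finite _ ENNReal.ofReal_ne_top
  rw [Metric.tendsto_atTop']
  intro ε hε
  obtain ⟨U, hU, hUφ⟩ := exists_nhds_torusAvg_close h.a_mem h.b_mem hs hg hφ (half_pos hε)
  obtain ⟨N, hN⟩ := eventually_atTop.1 (hk.support_shrinks U hU)
  refine ⟨N, fun n hn => ?_⟩
  have hkc : Continuous (k n) := hk.continuous n
  have hkc' : Continuous fun g => (k n g : ℂ) := Complex.continuous_ofReal.comp hkc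
  have hφk : Continuous fun x => φ x * (k n (closing x) : ℂ) :=
    hφ.mul (hkc'.comp continuous_closing)
  have hc1 : Continuous fun z => ∫ x, ∫ y, φ ![x, y, z] * (k n (closing ![x, y, z]) : ℂ)
      ∂(classDelta (t 1)) ∂(classDelta (t 0)) := by
    refine continuous_integral_of_compactSpace (f := fun z x => ∫ y, φ ![x, y, z] *
      (k n (closing ![x, y, z]) : ℂ) ∂(classDelta (t 1))) ?_
    refine continuous_integral_of_compactSpace (f := fun (p : SU2 × SU2) y => φ ![p.2, y, p.1] *
      (k n (closing ![p.2, y, p.1]) : ℂ)) ?_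
    exact hφk.comp (f := fun q : (SU2 × SU2) × SU2 => ![q.1.2, q.2, q.1.1])
      (continuous_vec3 (by fun_prop) (by fun_prop) (by fun_prop))
  have hc2 : Continuous fun c => triW (t 0) (t 1) (t 2) •
      torusAvg (fun r => φ (orbit (t 0) (t 1) (t 2) r)) c :=
    (continuous_torusAvg_orbit hφ (t 0) (t 1) (t 2)).const_smul (triW (t 0) (t 1) (t 2))
  have hc3 := hc1.comp (f := fun r : SU2 => r * cartan (t 2) * r⁻¹) (by fun_prop)
  rw [classDelta3, integral_pi3_symm _ hφk, classDelta_integral _ hc1,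
    integral_closedClasses h.a_mem h.b_mem hs hφ, ← integral_torusAvg_orbit hφ, ← integral_smul,
    dist_eq_norm]
  change ‖∫ r, ((fun z => ∫ x, ∫ y, φ ![x, y, z] * (k n (closing ![x, y, z]) : ℂ)
      ∂(classDelta (t 1)) ∂(classDelta (t 0))) ∘ fun r : SU2 => r * cartan (t 2) * r⁻¹) r ∂haarSU2 -
      _‖ < _
  rw [← integral_sub hc3.integrable_of_compactSpace hc2.integrable_of_compactSpace]
  refine lt_of_le_of_lt (norm_integral_le_of_norm_le_const (C := ε / 2)
    (.of_forall fun c => ?_)) (by simpa using hε)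
  refine norm_integral_classDelta_prod_sub_le h hφ hkc (hk.nonneg n) (hk.integral_eq_one n)
    fun s hs' r hr => (hUφ s hs' r c ?_).le
  by_contra hc
  exact hr (hN n hn.le _ hc)

end SU2

/-! ### Characters -/

namespace SU2

/-- The exponents of the monomials of degree `n` in two variables. -/
noncomputable def antidiagonalEquiv (n : ℕ) :
    {d : Fin 2 →₀ ℕ | d.degree = n} ≃ Finset.HasAntidiagonal.antidiagonal n where
  toFun d := ⟨(d.1 0, d.1 1), by
    have := d.2
    rw [Set.mem_ofPred_eq, Finsupp.degree_eq_sum, Fin.sum_univ_two] at this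
    exact Finset.HasAntidiagonal.mem_antidiagonal.2 this⟩
  invFun p := ⟨Finsupp.single 0 p.1.1 + Finsupp.single 1 p.1.2, by
    have := Finset.HasAntidiagonal.mem_antidiagonal.1 p.2
    rw [Set.mem_ofPred_eq, Finsupp.degree_eq_sum, Fin.sum_univ_two]
    simpa using this⟩
  left_inv d := by
    ext i
    fin_cases i <;> simp
  right_inv p := by
    ext
    · simp

lemma homogeneousSubmodule_eq_restrictSupport (n : ℕ) :
    MvPolynomial.restrictSupport ℂ {d : Fin 2 →₀ ℕ | d.degree = n} =
      MvPolynomial.homogeneousSubmodule (Fin 2) ℂ n :=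
  (MvPolynomial.homogeneousSubmodule_eq_finsupp_supported (Fin 2) ℂ n).symm

/-- The monomial basis of the homogeneous polynomials of degree `n`. -/
noncomputable def monomialBasis (n : ℕ) :
    Module.Basis (Finset.HasAntidiagonal.antidiagonal n) ℂ (MvPolynomial.homogeneousSubmodule (Fin 2) ℂ n) :=
  ((MvPolynomial.basisRestrictSupport ℂ {d : Fin 2 →₀ ℕ | d.degree = n}).map
    (LinearEquiv.ofEq _ _ (homogeneousSubmodule_eq_restrictSupport n))).reindex
    (antidiagonalEquiv n)

lemma coe_monomialBasis (n : ℕ) (p : Finset.HasAntidiagonal.antidiagonal n) :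
    (monomialBasis n p : MvPolynomial (Fin 2) ℂ) =
      MvPolynomial.X 0 ^ p.1.1 * MvPolynomial.X 1 ^ p.1.2 := by
  have h : (monomialBasis n p : MvPolynomial (Fin 2) ℂ) =
      MvPolynomial.monomial (Finsupp.single 0 p.1.1 + Finsupp.single 1 p.1.2) 1 := by
    rw [monomialBasis, Module.Basis.reindex_apply, Module.Basis.map_apply]
    rw [LinearEquiv.coe_ofEq_apply]
    change ((AddMonoidAlgebra.supportedEquivFinsupp _).symm (Finsupp.single _ 1)).1 = _
    simp [AddMonoidAlgebra.supportedEquivFinsupp]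
    rfl
  rw [h, ← one_mul (1 : ℂ), MvPolynomial.monomial_mul.symm, MvPolynomial.X_pow_eq_monomial,
    MvPolynomial.X_pow_eq_monomial]

lemma linSubst_cartan_X (t : ℝ) (i : Fin 2) :
    linSubst (cartan t : Matrix (Fin 2) (Fin 2) ℂ) (MvPolynomial.X i) =
      MvPolynomial.C (![Complex.exp (Complex.I * t), Complex.exp (-(Complex.I * t))] i) *
        MvPolynomial.X i := by
  rw [linSubst, MvPolynomial.aeval_X, Fin.sum_univ_two]
  fin_cases i <;> simp [cartan]

lemma spinRep_cartan (n : ℕ) (t : ℝ) (p : Finset.HasAntidiagonal.antidiagonal n) :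
    spinRep n (cartan t) (monomialBasis n p) =
      (Complex.exp (Complex.I * t) ^ p.1.1 * Complex.exp (-(Complex.I * t)) ^ p.1.2) •
        monomialBasis n p := by
  apply Subtype.ext
  change linSubst (cartan t : Matrix (Fin 2) (Fin 2) ℂ) (monomialBasis n p).1 = _
  rw [Submodule.coe_smul, coe_monomialBasis, map_mul, map_pow, map_pow, linSubst_cartan_X,
    linSubst_cartan_X, MvPolynomial.smul_eq_C_mul]
  simp only [Matrix.cons_val_zero, Matrix.cons_val_one, map_mul, map_pow]
  ring

lemma spinChar_cartan_eq_sum (n : ℕ) (t : ℝ) :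
    spinChar n (cartan t) = ∑ p ∈ Finset.HasAntidiagonal.antidiagonal n,
      Complex.exp (Complex.I * t) ^ p.1 * Complex.exp (-(Complex.I * t)) ^ p.2 := by
  rw [spinChar, Representation.character, LinearMap.trace_eq_matrix_trace ℂ (monomialBasis n),
    Matrix.trace, ← Finset.sum_coe_sort (Finset.HasAntidiagonal.antidiagonal n)]
  refine Finset.sum_congr rfl fun p _ => ?_
  rw [Matrix.diag_apply, LinearMap.toMatrix_apply, spinRep_cartan, map_smul]
  simp

/-- With `z w = 1` and `z + w = 2 cos t` this is the recursion of the Chebyshev polynomials `U`. -/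
lemma sum_antidiagonal_recursion (z w : ℂ) (n : ℕ) :
    ∑ p ∈ Finset.HasAntidiagonal.antidiagonal (n + 2), z ^ p.1 * w ^ p.2 =
      (z + w) * ∑ p ∈ Finset.HasAntidiagonal.antidiagonal (n + 1), z ^ p.1 * w ^ p.2 -
        z * w * ∑ p ∈ Finset.HasAntidiagonal.antidiagonal n, z ^ p.1 * w ^ p.2 := by
  have h : ∀ n : ℕ, ∑ p ∈ Finset.HasAntidiagonal.antidiagonal (n + 1), z ^ p.1 * w ^ p.2 =
      w ^ (n + 1) + z * ∑ p ∈ Finset.HasAntidiagonal.antidiagonal n, z ^ p.1 * w ^ p.2 := by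
    intro n
    rw [Finset.Nat.sum_antidiagonal_succ, Finset.mul_sum, pow_zero, one_mul]
    congr 1
    exact Finset.sum_congr rfl fun p _ => by ring
  rw [h (n + 1), h n]
  ring

/-- The character formula. -/
lemma spinChar_eq (n : ℕ) (g : SU2) :
    spinChar n g = ((Polynomial.Chebyshev.U ℝ n).eval (ca g).re : ℝ) := by
  obtain ⟨r, hr⟩ := exists_conj_cartan_arccos g
  set t := Real.arccos (ca g).re with ht
  have hcos : (ca g).re = Real.cos t := by rw [hr, re_ca_conj, re_ca_cartan]
  have h1 : spinChar n g = spinChar n (cartan t) := by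
    conv_lhs => rw [hr]
    exact Representation.char_conj _ _ _
  rw [h1, spinChar_cartan_eq_sum, hcos]
  set z := Complex.exp (Complex.I * t)
  set w := Complex.exp (-(Complex.I * t))
  have hzw : z * w = 1 := by rw [← Complex.exp_add, add_neg_cancel, Complex.exp_zero]
  have hadd : z + w = 2 * (Real.cos t : ℂ) := by
    rw [Complex.ofReal_cos, Complex.cos]
    simp only [z, w]
    rw [neg_mul, mul_comm (t : ℂ)]
    ring
  clear h1
  induction n using Nat.twoStepInduction with
  | zero => simp
  | one =>
    simp [Finset.Nat.antidiagonal_succ]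
    rw [add_comm, hadd, Complex.ofReal_cos]
  | more n h1 h2 =>
    rw [sum_antidiagonal_recursion, h1, h2, hzw, hadd]
    push_cast
    rw [Polynomial.Chebyshev.U_add_two]
    simp

lemma continuous_spinChar (n : ℕ) : Continuous (spinChar n) := by
  have : spinChar n = fun g => (((Polynomial.Chebyshev.U ℝ n).eval (ca g).re : ℝ) : ℂ) :=
    funext (spinChar_eq n)
  rw [this]
  exact Complex.continuous_ofReal.comp ((Polynomial.continuous _).comp continuous_re_ca)

/-- The product form remains valid at the centre, where `sin t = 0`; the Weyl density supplies the
factor `sin t`. -/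
lemma spinChar_conj_cartan (n : ℕ) (r : SU2) (t : ℝ) :
    spinChar n (r * cartan t * r⁻¹) * Real.sin t = Real.sin ((n + 1) * t) := by
  rw [spinChar_eq, re_ca_conj, re_ca_cartan, ← Complex.ofReal_mul,
    Polynomial.Chebyshev.U_real_cos]
  simp

end SU2

/-! ### Decay of sine coefficients of smooth periodic functions -/

/-- Lebesgue measure on the cube `(-π, π]³`. -/
noncomputable def cubeMeasure : Measure (Fin 3 → ℝ) :=
  Measure.pi fun _ => volume.restrict (Set.Ioc (-Real.pi) Real.pi)

lemma cubeMeasure_eq :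
    cubeMeasure = volume.restrict (Set.univ.pi fun _ => Set.Ioc (-Real.pi) Real.pi) := by
  rw [cubeMeasure, volume_pi, Measure.restrict_pi_pi]

instance : IsFiniteMeasure cubeMeasure := by
  rw [cubeMeasure]; infer_instance

lemma ae_cubeMeasure_mem_Icc :
    ∀ᵐ t ∂cubeMeasure, t ∈ Set.Icc (fun _ : Fin 3 => -Real.pi) (fun _ => Real.pi) := by
  rw [cubeMeasure_eq]
  filter_upwards [ae_restrict_mem (MeasurableSet.univ_pi fun _ => measurableSet_Ioc)] with t ht
  exact ⟨fun i => (ht i trivial).1.le, fun i => (ht i trivial).2⟩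

lemma Continuous.integrable_cubeMeasure {E : Type*} [NormedAddCommGroup E] {F : (Fin 3 → ℝ) → E}
    (hF : Continuous F) : Integrable F cubeMeasure := by
  rw [cubeMeasure_eq]
  refine (hF.continuousOn.integrableOn_compact (isCompact_Icc
    (a := fun _ : Fin 3 => -Real.pi) (b := fun _ => Real.pi))).mono_set ?_
  exact fun t ht => ⟨fun i => (ht i trivial).1.le, fun i => (ht i trivial).2⟩

lemma integral_cubeMeasure_insertNth (i : Fin 3) {F : (Fin 3 → ℝ) → ℂ} (hF : Continuous F) :
    ∫ t, F t ∂cubeMeasure = ∫ r : Fin 2 → ℝ, (∫ x in (-Real.pi)..Real.pi,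
      F (Fin.insertNth i x r)) ∂(Measure.pi fun _ => volume.restrict (Set.Ioc (-Real.pi) Real.pi)) := by
  have h := (measurePreserving_piFinSuccAbove
    (fun _ : Fin 3 => volume.restrict (Set.Ioc (-Real.pi) Real.pi)) i).symm
  have hi := h.integrable_comp_of_integrable hF.integrable_cubeMeasure
  rw [cubeMeasure, ← h.map_eq, integral_map h.aemeasurable hF.aestronglyMeasurable]
  refine (integral_prod_symm _ hi).trans ?_
  simp only [intervalIntegral.integral_of_le (show -Real.pi ≤ Real.pi by linarith [Real.pi_pos])]
  rfl

/-- Two integrations by parts. The first boundary term vanishes because `sin (m π) = 0`, so `ψ'`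
need not be periodic; the second vanishes by `hp` and the evenness of the cosine. -/
lemma integral_sin_mul_deriv_deriv {ψ ψ' ψ'' : ℝ → ℂ} (m : ℕ) (h : ∀ x, HasDerivAt ψ (ψ' x) x)
    (h' : ∀ x, HasDerivAt ψ' (ψ'' x) x) (hc : Continuous ψ'')
    (hp : ψ Real.pi = ψ (-Real.pi)) :
    ∫ x in (-Real.pi)..Real.pi, (Real.sin (m * x) : ℂ) * ψ'' x =
      -(m : ℂ) ^ 2 * ∫ x in (-Real.pi)..Real.pi, (Real.sin (m * x) : ℂ) * ψ x := by
  have hs : ∀ x : ℝ, HasDerivAt (fun x : ℝ => (Real.sin (m * x) : ℂ))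
      ((m : ℂ) * (Real.cos (m * x) : ℂ)) x := fun x => by
    have := (((hasDerivAt_id x).const_mul (m : ℝ)).sin).ofReal_comp
    refine this.congr_deriv ?_
    simp [mul_comm]
  have hcos : ∀ x : ℝ, HasDerivAt (fun x : ℝ => (m : ℂ) * (Real.cos (m * x) : ℂ))
      (-(m : ℂ) ^ 2 * (Real.sin (m * x) : ℂ)) x := fun x => by
    have := ((((hasDerivAt_id x).const_mul (m : ℝ)).cos).ofReal_comp).const_mul (m : ℂ)
    refine this.congr_deriv ?_
    simp only [id, mul_one, Complex.ofReal_mul, Complex.ofReal_neg, Complex.ofReal_natCast]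
    ring
  have hψ : Continuous ψ := continuous_iff_continuousAt.2 fun x => (h x).continuousAt
  have hψ' : Continuous ψ' := continuous_iff_continuousAt.2 fun x => (h' x).continuousAt
  have e1 := intervalIntegral.integral_mul_deriv_eq_deriv_mul (a := -Real.pi) (b := Real.pi)
    (fun x _ => hs x) (fun x _ => h' x) (Continuous.intervalIntegrable (by fun_prop) _ _)
    (hc.intervalIntegrable _ _)
  have e2 := intervalIntegral.integral_mul_deriv_eq_deriv_mul (a := -Real.pi) (b := Real.pi)
    (fun x _ => hcos x) (fun x _ => h x) (Continuous.intervalIntegrable (by fun_prop) _ _)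
    (hψ'.intervalIntegrable _ _)
  rw [e1, e2, hp]
  simp only [mul_neg, Real.sin_neg, Real.cos_neg, Real.sin_nat_mul_pi, mul_assoc,
    intervalIntegral.integral_const_mul]
  simp

section Periodic

variable {E : Type*} [NormedAddCommGroup E] [NormedSpace ℝ E]

/-- The partial derivative in the `i`-th angle. -/
noncomputable def anglePartial (i : Fin 3) (F : E × (Fin 3 → ℝ) → ℂ) (v : E × (Fin 3 → ℝ)) : ℂ :=
  fderiv ℝ F v (0, Pi.single i 1)

/-- Smooth functions of parameters and of three angles. -/
structure SmoothPeriodic (F : E × (Fin 3 → ℝ) → ℂ) : Prop where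
  contDiff : ContDiff ℝ ∞ F
  periodic : ∀ i v, F (v + (0, Pi.single i (2 * Real.pi))) = F v

lemma SmoothPeriodic.anglePartial {F : E × (Fin 3 → ℝ) → ℂ} (hF : SmoothPeriodic F) (i : Fin 3) :
    SmoothPeriodic (anglePartial i F) where
  contDiff := (hF.contDiff.fderiv_right (m := ∞) (by simp)).clm_apply contDiff_const
  periodic j v := by
    rw [_root_.anglePartial, _root_.anglePartial, ← fderiv_comp_add_right]
    simp only [hF.periodic]

lemma SmoothPeriodic.hasDerivAt_insertNth {F : E × (Fin 3 → ℝ) → ℂ} (hF : SmoothPeriodic F)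
    (i : Fin 3) (e : E) (r : Fin 2 → ℝ) (x : ℝ) :
    HasDerivAt (fun x => F (e, Fin.insertNth i x r))
      (_root_.anglePartial i F (e, Fin.insertNth i x r)) x := by
  have h1 : HasDerivAt (fun x : ℝ => (Fin.insertNth i x r : Fin 3 → ℝ)) (Pi.single i 1) x := by
    rw [hasDerivAt_pi]
    intro j
    rcases Fin.eq_self_or_eq_succAbove i j with rfl | ⟨k, rfl⟩
    · simpa using hasDerivAt_id' x
    · simpa [Fin.succAbove_ne] using hasDerivAt_const x (r k)
  exact ((hF.contDiff.differentiable (by simp)) _).hasFDerivAt.comp_hasDerivAt x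
    ((hasDerivAt_const x e).prodMk h1)

/-- The triple sine coefficients. -/
noncomputable def sineCoeff (F : E × (Fin 3 → ℝ) → ℂ) (m : Fin 3 → ℕ) (e : E) : ℂ :=
  ∫ t, (∏ i, (Real.sin (m i * t i) : ℂ)) * F (e, t) ∂cubeMeasure

lemma SmoothPeriodic.sineCoeff_anglePartial {F : E × (Fin 3 → ℝ) → ℂ} (hF : SmoothPeriodic F)
    (i : Fin 3) (m : Fin 3 → ℕ) (e : E) :
    sineCoeff (_root_.anglePartial i (_root_.anglePartial i F)) m e =
      -(m i : ℂ) ^ 2 * sineCoeff F m e := by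
  have hF' := hF.anglePartial i
  have hF'' := hF'.anglePartial i
  have hcF := hF.contDiff.continuous
  have hcF'' := hF''.contDiff.continuous
  rw [sineCoeff, sineCoeff, integral_cubeMeasure_insertNth i (by fun_prop),
    integral_cubeMeasure_insertNth i (by fun_prop), ← integral_const_mul]
  refine integral_congr_ae (.of_forall fun r => ?_)
  simp only [Fin.prod_univ_succAbove _ i, Fin.insertNth_apply_same, Fin.insertNth_apply_succAbove]
  have key := integral_sin_mul_deriv_deriv (m i) (hF.hasDerivAt_insertNth i e r)
    (hF'.hasDerivAt_insertNth i e r)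
    (continuous_iff_continuousAt.2 fun x => (hF''.hasDerivAt_insertNth i e r x).continuousAt) (by
      rw [← hF.periodic i (e, Fin.insertNth i (-Real.pi) r)]
      congr 1
      refine Prod.ext (by simp) (funext fun j => ?_)
      rcases Fin.eq_self_or_eq_succAbove i j with rfl | ⟨k, rfl⟩
      · simp; ring
      · simp [Fin.succAbove_ne])
  set P : ℂ := ∏ j, (Real.sin (m (i.succAbove j) * r j) : ℂ) with hP
  have e1 : ∀ G : ℝ → ℂ, ∫ x in (-Real.pi)..Real.pi, (Real.sin (m i * x) : ℂ) * P * G x =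
      P * ∫ x in (-Real.pi)..Real.pi, (Real.sin (m i * x) : ℂ) * G x := by
    intro G
    rw [← intervalIntegral.integral_const_mul]
    congr 1; ext x; ring
  rw [e1, e1, key]
  ring

lemma norm_sineCoeff_le {V : Type*} {F : V × (Fin 3 → ℝ) → ℂ} {C : ℝ} {e : V}
    (hC : ∀ t ∈ Set.Icc (fun _ : Fin 3 => -Real.pi) (fun _ => Real.pi), ‖F (e, t)‖ ≤ C)
    (m : Fin 3 → ℕ) : ‖sineCoeff F m e‖ ≤ C * cubeMeasure.real Set.univ := by
  refine norm_integral_le_of_norm_le_const ?_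
  filter_upwards [ae_cubeMeasure_mem_Icc] with t ht
  rw [norm_mul]
  refine (mul_le_of_le_one_left (norm_nonneg _) ?_).trans (hC t ht)
  rw [norm_prod]
  refine Finset.prod_le_one (fun _ _ => norm_nonneg _) fun i _ => ?_
  rw [Complex.norm_real, Real.norm_eq_abs]
  exact Real.abs_sin_le_one _

/-- Four derivatives are taken in each angle: the dimension factor costs one power of `m i`, so two
would leave a divergent `1 / m i`. The iterated derivative is continuous, hence bounded over the
compact `K` times the closed cube. -/
lemma SmoothPeriodic.exists_sineCoeff_bound {F : E × (Fin 3 → ℝ) → ℂ} (hF : SmoothPeriodic F)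
    {K : Type*} [TopologicalSpace K] [CompactSpace K] {κ : K → E} (hκ : Continuous κ) :
    ∃ C, ∀ k m, (∏ i, (m i : ℝ) ^ 4) * ‖sineCoeff F m (κ k)‖ ≤ C := by
  have h0 := (hF.anglePartial 0).anglePartial 0
  have h00 := (h0.anglePartial 0).anglePartial 0
  have h1 := (h00.anglePartial 1).anglePartial 1
  have h11 := (h1.anglePartial 1).anglePartial 1
  have h2 := (h11.anglePartial 2).anglePartial 2
  have h22 := (h2.anglePartial 2).anglePartial 2
  obtain ⟨C, hC⟩ := ((isCompact_univ (X := K)).prod (isCompact_Icc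
    (a := fun _ : Fin 3 => -Real.pi) (b := fun _ => Real.pi))).exists_bound_of_continuousOn
    (f := fun p => _ ) (h22.contDiff.continuous.comp
      ((hκ.comp continuous_fst).prodMk continuous_snd)).continuousOn
  refine ⟨C * cubeMeasure.real Set.univ, fun k m => ?_⟩
  have := norm_sineCoeff_le (e := κ k) (fun t ht => hC (k, t) ⟨trivial, ht⟩) m
  refine le_of_eq_of_le ?_ this
  rw [h2.sineCoeff_anglePartial, h11.sineCoeff_anglePartial, h1.sineCoeff_anglePartial,
    h00.sineCoeff_anglePartial, h0.sineCoeff_anglePartial, hF.sineCoeff_anglePartial]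
  simp only [norm_mul, norm_neg, norm_pow, Complex.norm_natCast, Fin.prod_univ_three]
  ring

end Periodic

/-! ### Abel summation of the character expansion at the identity -/

lemma integral_cos_int_mul (k : ℤ) :
    ∫ t in (0 : ℝ)..Real.pi, Real.cos (k * t) = if k = 0 then Real.pi else 0 := by
  split_ifs with h
  · simp [h]
  · have hk : (k : ℝ) ≠ 0 := by exact_mod_cast h
    rw [intervalIntegral.integral_comp_mul_left (fun t => Real.cos t) hk]
    simp [Real.sin_int_mul_pi]

/-- The kernel whose moments are the Abel sums. -/
noncomputable def abelKernel (r t : ℝ) : ℝ :=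
  2 / Real.pi * (Real.sin t * (Real.sin t * (1 - r ^ 2) / (1 - 2 * r * Real.cos t + r ^ 2) ^ 2))

lemma abelKernel_nonneg {r : ℝ} (h0 : 0 ≤ r) (h1 : r < 1) (t : ℝ) : 0 ≤ abelKernel r t := by
  have h2 : 0 ≤ 1 - r ^ 2 := by nlinarith
  have h3 := Real.pi_pos
  rw [abelKernel, mul_div_assoc, ← mul_assoc (Real.sin t)]
  have := mul_self_nonneg (Real.sin t)
  positivity

lemma abelKernel_denom_pos {r : ℝ} (h0 : 0 ≤ r) (h1 : r < 1) (t : ℝ) :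
    0 < 1 - 2 * r * Real.cos t + r ^ 2 := by
  nlinarith [Real.cos_le_one t, mul_nonneg h0 (sub_nonneg.2 (Real.cos_le_one t)),
    sq_pos_of_pos (sub_pos.2 h1)]

lemma continuous_abelKernel {r : ℝ} (h0 : 0 ≤ r) (h1 : r < 1) : Continuous (abelKernel r) := by
  unfold abelKernel
  refine continuous_const.mul (Real.continuous_sin.mul (Continuous.div (by fun_prop)
    (by fun_prop) fun t => (pow_pos (abelKernel_denom_pos h0 h1 t) 2).ne'))

/-- Imaginary part of `∑ (n + 1) z (r z) ^ n = z / (1 - r z) ^ 2` at `z = e^{it}`, where `|1 - r z|²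
= 1 - 2 r cos t + r²`. -/
lemma hasSum_sin_powerSeries {r : ℝ} (h0 : 0 ≤ r) (h1 : r < 1) (t : ℝ) :
    HasSum (fun n : ℕ => ((n : ℝ) + 1) * r ^ n * Real.sin ((n + 1) * t))
      (Real.sin t * (1 - r ^ 2) / (1 - 2 * r * Real.cos t + r ^ 2) ^ 2) := by
  set z : ℂ := Complex.exp (t * Complex.I) with hz
  have hzn : ‖z‖ = 1 := Complex.norm_exp_ofReal_mul_I t
  have hw : ‖(r : ℂ) * z‖ < 1 := by
    rw [norm_mul, hzn, mul_one, Complex.norm_real, Real.norm_of_nonneg h0]; exact h1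
  have h := Complex.hasSum_im ((hasSum_choose_mul_geometric_of_norm_lt_one 1 hw).mul_left z)
  convert h using 1
  · ext n
    have : z * (((n + 1).choose 1 : ℕ) * ((r : ℂ) * z) ^ n) =
        (((n + 1) * r ^ n : ℝ) : ℂ) * Complex.exp (((n + 1) * t : ℝ) * Complex.I) := by
      rw [Nat.choose_one_right, mul_pow, hz, ← Complex.exp_nat_mul]
      push_cast
      rw [show ((n : ℂ) + 1) * t * Complex.I = t * Complex.I + n * (t * Complex.I) by ring,
        Complex.exp_add]
      ring
    rw [this, Complex.im_ofReal_mul, Complex.exp_ofReal_mul_I_im]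
  · have hre : z.re = Real.cos t := Complex.exp_ofReal_mul_I_re t
    have him : z.im = Real.sin t := Complex.exp_ofReal_mul_I_im t
    have hn : (1 - (r : ℂ) * z) * (1 - r * (starRingEnd ℂ z)) =
        ((1 - 2 * r * Real.cos t + r ^ 2 : ℝ) : ℂ) := by
      have hzz : z * starRingEnd ℂ z = 1 := by
        rw [Complex.mul_conj, Complex.normSq_eq_norm_sq, hzn]; simp
      have hs : z + starRingEnd ℂ z = ((2 * Real.cos t : ℝ) : ℂ) := by
        rw [Complex.add_conj, hre]
      have hs' : ((Real.cos t : ℝ) : ℂ) = (z + starRingEnd ℂ z) / 2 := by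
        rw [hs]; push_cast; ring
      push_cast
      rw [← Complex.ofReal_cos, hs']
      linear_combination (r : ℂ) ^ 2 * hzz
    have hpos := abelKernel_denom_pos h0 h1 t
    set D : ℝ := 1 - 2 * r * Real.cos t + r ^ 2
    have hD : (D : ℂ) ≠ 0 := by exact_mod_cast hpos.ne'
    have hne : (1 - (r : ℂ) * z) ≠ 0 := fun h => hD (by rw [← hn, h, zero_mul])
    have e : z * (1 / (1 - (r : ℂ) * z) ^ (1 + 1)) =
        z * (1 - r * (starRingEnd ℂ z)) ^ 2 * ((1 / D ^ 2 : ℝ) : ℂ) := by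
      push_cast
      rw [← hn]
      have hne' : (1 - (r : ℂ) * starRingEnd ℂ z) ≠ 0 :=
        fun h => hD (by rw [← hn, h, mul_zero])
      field_simp
    rw [e, Complex.im_mul_ofReal]
    have hsc := Real.sin_sq_add_cos_sq t
    simp only [pow_two, Complex.mul_im, Complex.mul_re, Complex.sub_re, Complex.sub_im,
      Complex.one_re, Complex.one_im, Complex.ofReal_re, Complex.ofReal_im, Complex.conj_re,
      Complex.conj_im, hre, him]
    rw [div_eq_mul_one_div]
    congr 1
    linear_combination (r ^ 2 * Real.sin t) * hsc

/-- The coefficients `dim_j ∫ χ_j φ` of a class function, in the angle. -/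
noncomputable def angleCoeff (ψ : ℝ → ℂ) (n : ℕ) : ℂ :=
  ((n : ℂ) + 1) * ∫ t in (0 : ℝ)..Real.pi,
    ((2 / Real.pi * (Real.sin t * Real.sin ((n + 1) * t)) : ℝ) : ℂ) * ψ t

lemma hasSum_angleCoeff_mul_pow {ψ : ℝ → ℂ} (hψ : Continuous ψ) {r : ℝ} (h0 : 0 ≤ r)
    (h1 : r < 1) :
    HasSum (fun n => angleCoeff ψ n * (r : ℂ) ^ n)
      (∫ t in (0 : ℝ)..Real.pi, (abelKernel r t : ℂ) * ψ t) := by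
  obtain ⟨B, hB⟩ := (isCompact_Icc (a := (0 : ℝ)) (b := Real.pi)).exists_bound_of_continuousOn
    hψ.continuousOn
  have hs : Summable fun n : ℕ => ((n : ℝ) + 1) * r ^ n := by
    have := (hasSum_choose_mul_geometric_of_norm_lt_one (𝕜 := ℝ) 1 (r := r)
      (by rwa [Real.norm_of_nonneg h0])).summable
    simpa using this
  have h := intervalIntegral.hasSum_integral_of_dominated_convergence (μ := volume) (a := 0)
    (b := Real.pi) (F := fun (n : ℕ) t => ((2 / Real.pi * (Real.sin t *
      (((n : ℝ) + 1) * r ^ n * Real.sin ((n + 1) * t))) : ℝ) : ℂ) * ψ t)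
    (f := fun t => (abelKernel r t : ℂ) * ψ t)
    (fun n _ => 2 / Real.pi * (((n : ℝ) + 1) * r ^ n) * B) ?_ ?_ ?_ ?_ ?_
  · refine h.congr_fun fun n => ?_
    rw [angleCoeff, mul_right_comm, ← intervalIntegral.integral_const_mul]
    congr 1; ext t
    push_cast; ring
  · intro n
    exact Continuous.aestronglyMeasurable (by fun_prop)
  · intro n
    refine .of_forall fun t ht => ?_
    rw [Set.uIoc_of_le Real.pi_pos.le] at ht
    have hBt := hB t ⟨ht.1.le, ht.2⟩
    rw [norm_mul, Complex.norm_real]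
    have hpi := Real.pi_pos
    refine mul_le_mul ?_ hBt (norm_nonneg _) (by positivity)
    rw [norm_mul, Real.norm_of_nonneg (by positivity : 0 ≤ 2 / Real.pi)]
    refine mul_le_mul_of_nonneg_left ?_ (by positivity)
    rw [norm_mul, norm_mul, Real.norm_of_nonneg (by positivity : 0 ≤ ((n : ℝ) + 1) * r ^ n)]
    have s1 := Real.abs_sin_le_one t
    have s2 := Real.abs_sin_le_one ((n + 1) * t)
    rw [← Real.norm_eq_abs] at s1 s2
    calc _ ≤ 1 * (((n : ℝ) + 1) * r ^ n * 1) := by gcongr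
      _ = _ := by ring
  · exact .of_forall fun t _ => (hs.mul_left _).mul_right B
  · exact intervalIntegrable_const
  · refine .of_forall fun t _ => ?_
    have := ((hasSum_sin_powerSeries h0 h1 t).mul_left (Real.sin t)).mul_left (2 / Real.pi)
    exact ((Complex.hasSum_ofReal.2 this).mul_right (ψ t))

/-- The functions `1` and `cos t` are multiples of the characters of spin `0` and `1 / 2`, so each
has a single coefficient. They yield the mass and the cosine moment of `abelKernel`. -/
lemma angleCoeff_one (n : ℕ) : angleCoeff 1 n = if n = 0 then 1 else 0 := by
  have e : ∀ t : ℝ, ((2 / Real.pi * (Real.sin t * Real.sin ((n + 1) * t)) : ℝ) : ℂ) *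
      (1 : ℝ → ℂ) t = (((Real.cos ((n : ℤ) * t) - Real.cos (((n + 2 : ℕ) : ℤ) * t)) / Real.pi : ℝ) : ℂ) := by
    intro t
    rw [Pi.one_apply, mul_one]
    congr 1
    have e1 : (((n : ℤ) : ℝ)) * t = (n + 1) * t - t := by push_cast; ring
    have e2 : ((((n + 2 : ℕ) : ℤ) : ℝ)) * t = (n + 1) * t + t := by push_cast; ring
    rw [e1, e2, Real.cos_sub, Real.cos_add]
    ring
  simp only [angleCoeff, e]
  rw [intervalIntegral.integral_ofReal, intervalIntegral.integral_div,
    intervalIntegral.integral_sub (Continuous.intervalIntegrable (by fun_prop) _ _)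
      (Continuous.intervalIntegrable (by fun_prop) _ _), integral_cos_int_mul,
    integral_cos_int_mul]
  have hpi := Real.pi_ne_zero
  by_cases hn : n = 0
  · subst hn; simp [hpi]
  · have h2 : ((n + 2 : ℕ) : ℤ) ≠ 0 := by omega
    have h3 : (n : ℤ) ≠ 0 := by omega
    rw [if_neg h2, if_neg h3, if_neg hn]
    simp

lemma angleCoeff_cos (n : ℕ) :
    angleCoeff (fun t => (Real.cos t : ℂ)) n = if n = 1 then 1 else 0 := by
  have e : ∀ t : ℝ, ((2 / Real.pi * (Real.sin t * Real.sin ((n + 1) * t)) : ℝ) : ℂ) *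
      (Real.cos t : ℂ) = (((Real.cos (((n : ℤ) - 1 : ℤ) * t) -
        Real.cos (((n + 3 : ℕ) : ℤ) * t)) / (2 * Real.pi) : ℝ) : ℂ) := by
    intro t
    rw [← Complex.ofReal_mul]
    congr 1
    have e1 : (((n : ℤ) - 1 : ℤ) : ℝ) * t = (n + 1) * t - 2 * t := by push_cast; ring
    have e2 : ((((n + 3 : ℕ) : ℤ) : ℝ)) * t = (n + 1) * t + 2 * t := by push_cast; ring
    rw [e1, e2, Real.cos_sub, Real.cos_add, Real.sin_two_mul]
    field_simp
    ring
  simp only [angleCoeff, e]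
  rw [intervalIntegral.integral_ofReal, intervalIntegral.integral_div,
    intervalIntegral.integral_sub (Continuous.intervalIntegrable (by fun_prop) _ _)
      (Continuous.intervalIntegrable (by fun_prop) _ _), integral_cos_int_mul,
    integral_cos_int_mul]
  have hpi := Real.pi_ne_zero
  have h2 : ((n + 3 : ℕ) : ℤ) ≠ 0 := by omega
  by_cases hn : n = 1
  · subst hn; simp; field_simp; norm_num
  · have h3 : (n : ℤ) - 1 ≠ 0 := by omega
    rw [if_neg h2, if_neg h3, if_neg hn]
    simp

lemma integral_abelKernel {r : ℝ} (h0 : 0 ≤ r) (h1 : r < 1) :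
    ∫ t in (0 : ℝ)..Real.pi, abelKernel r t = 1 := by
  have h := hasSum_angleCoeff_mul_pow (ψ := 1) continuous_one h0 h1
  have h' : HasSum (fun n => angleCoeff 1 n * (r : ℂ) ^ n) (angleCoeff 1 0 * (r : ℂ) ^ 0) :=
    hasSum_single 0 fun n hn => by simp [angleCoeff_one, hn]
  have := h.unique h'
  simp only [Pi.one_apply, mul_one, intervalIntegral.integral_ofReal, angleCoeff_one, if_true,
    pow_zero] at this
  exact_mod_cast this

lemma integral_abelKernel_mul_cos {r : ℝ} (h0 : 0 ≤ r) (h1 : r < 1) :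
    ∫ t in (0 : ℝ)..Real.pi, abelKernel r t * Real.cos t = r := by
  have h := hasSum_angleCoeff_mul_pow (ψ := fun t => (Real.cos t : ℂ)) (by fun_prop) h0 h1
  have h' : HasSum (fun n => angleCoeff (fun t => (Real.cos t : ℂ)) n * (r : ℂ) ^ n)
      (angleCoeff (fun t => (Real.cos t : ℂ)) 1 * (r : ℂ) ^ 1) :=
    hasSum_single 1 fun n hn => by rw [angleCoeff_cos, if_neg hn, zero_mul]
  have := h.unique h'
  simp only [← Complex.ofReal_mul, intervalIntegral.integral_ofReal, angleCoeff_cos, if_true,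
    pow_one, one_mul] at this
  exact_mod_cast this

/-- Near `0` continuity suffices; away from `0` the function `1 - cos` is bounded below, and a
multiple of it dominates. -/
lemma exists_norm_sub_le_add_one_sub_cos {ψ : ℝ → ℂ} (hψ : Continuous ψ) {ε : ℝ} (hε : 0 < ε) :
    ∃ C, 0 ≤ C ∧ ∀ t ∈ Set.Icc 0 Real.pi, ‖ψ t - ψ 0‖ ≤ ε + C * (1 - Real.cos t) := by
  obtain ⟨B, hB⟩ := (isCompact_Icc (a := (0 : ℝ)) (b := Real.pi)).exists_bound_of_continuousOn
    (f := fun t => ψ t - ψ 0) (by fun_prop)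
  obtain ⟨δ, hδ, h⟩ := Metric.continuous_iff.1 hψ 0 ε hε
  set d := min δ Real.pi
  have hd : 0 < d := lt_min hδ Real.pi_pos
  have hc : 0 < 1 - Real.cos d := by
    have := Real.cos_lt_cos_of_nonneg_of_le_pi le_rfl (min_le_right δ Real.pi) hd
    rw [Real.cos_zero] at this
    linarith
  have hB0 : 0 ≤ B := (norm_nonneg _).trans (hB 0 ⟨le_rfl, Real.pi_pos.le⟩)
  refine ⟨B / (1 - Real.cos d), by positivity, fun t ht => ?_⟩
  rcases lt_or_ge t d with htd | htd
  · have h1 := (h t (by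
      rw [Real.dist_eq, sub_zero, abs_of_nonneg ht.1]
      exact htd.trans_le (min_le_left _ _))).le
    rw [dist_eq_norm] at h1
    have h2 : 0 ≤ B / (1 - Real.cos d) * (1 - Real.cos t) :=
      mul_nonneg (by positivity) (sub_nonneg.2 (Real.cos_le_one t))
    linarith
  · have h1 : Real.cos t ≤ Real.cos d := Real.cos_le_cos_of_nonneg_of_le_pi hd.le ht.2 htd
    have h2 : B ≤ B / (1 - Real.cos d) * (1 - Real.cos t) := by
      rw [div_mul_eq_mul_div, le_div_iff₀ hc]
      exact mul_le_mul_of_nonneg_left (by linarith) hB0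
    linarith [hB t ht]

/-- Korovkin's argument: the kernel is nonnegative of mass one and integrates `1 - cos t` to `1 -
r`, so the majorant above bounds the error by `ε / 2 + C (1 - r)`. -/
lemma tendsto_integral_abelKernel {ψ : ℝ → ℂ} (hψ : Continuous ψ) :
    Tendsto (fun r => ∫ t in (0 : ℝ)..Real.pi, (abelKernel r t : ℂ) * ψ t) (𝓝[<] 1)
      (𝓝 (ψ 0)) := by
  rw [Metric.tendsto_nhds]
  intro ε hε
  obtain ⟨C, hC0, hC⟩ := exists_norm_sub_le_add_one_sub_cos hψ (half_pos hε)
  have hev : ∀ᶠ r : ℝ in 𝓝[<] 1, 0 ≤ r ∧ r < 1 ∧ C * (1 - r) < ε / 2 := by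
    have hlim : Tendsto (fun r : ℝ => C * (1 - r)) (𝓝[<] 1) (𝓝 (C * (1 - 1))) :=
      (Continuous.tendsto (by fun_prop) 1).mono_left nhdsWithin_le_nhds
    rw [sub_self, mul_zero] at hlim
    filter_upwards [hlim.eventually (gt_mem_nhds (half_pos hε)), self_mem_nhdsWithin,
      nhdsWithin_le_nhds (lt_mem_nhds zero_lt_one)] with r a b c
    exact ⟨c.le, b, a⟩
  filter_upwards [hev] with r ⟨h0, h1, h2⟩
  have hk := continuous_abelKernel h0 h1
  have e : (∫ t in (0 : ℝ)..Real.pi, (abelKernel r t : ℂ) * ψ t) - ψ 0 =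
      ∫ t in (0 : ℝ)..Real.pi, (abelKernel r t : ℂ) * (ψ t - ψ 0) := by
    simp only [mul_sub]
    rw [intervalIntegral.integral_sub (Continuous.intervalIntegrable (by fun_prop) _ _)
      (Continuous.intervalIntegrable (by fun_prop) _ _), intervalIntegral.integral_mul_const,
      intervalIntegral.integral_ofReal, integral_abelKernel h0 h1]
    simp
  rw [dist_eq_norm, e]
  have hle : ‖∫ t in (0 : ℝ)..Real.pi, (abelKernel r t : ℂ) * (ψ t - ψ 0)‖ ≤
      ∫ t in (0 : ℝ)..Real.pi, ((ε / 2 + C) * abelKernel r t -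
        C * (abelKernel r t * Real.cos t)) := by
    refine intervalIntegral.norm_integral_le_of_norm_le Real.pi_pos.le
      (.of_forall fun t ht => ?_) (Continuous.intervalIntegrable (by fun_prop) _ _)
    rw [norm_mul, Complex.norm_real, Real.norm_of_nonneg (abelKernel_nonneg h0 h1 t)]
    have := mul_le_mul_of_nonneg_left (hC t ⟨ht.1.le, ht.2⟩) (abelKernel_nonneg h0 h1 t)
    linarith
  rw [intervalIntegral.integral_sub (Continuous.intervalIntegrable (by fun_prop) _ _)
      (Continuous.intervalIntegrable (by fun_prop) _ _), intervalIntegral.integral_const_mul,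
      intervalIntegral.integral_const_mul, integral_abelKernel h0 h1,
      integral_abelKernel_mul_cos h0 h1] at hle
  linarith

/-- By Abel's limit theorem a convergent series has its Abel limit as sum, and that limit is `ψ 0`.
-/
lemma hasSum_angleCoeff {ψ : ℝ → ℂ} (hψ : Continuous ψ) (hs : Summable (angleCoeff ψ)) :
    HasSum (angleCoeff ψ) (ψ 0) := by
  obtain ⟨l, hl⟩ := hs
  have h1 := Complex.tendsto_tsum_powerSeries_nhdsWithin_lt hl.tendsto_sum_nat
  rw [tendsto_map'_iff] at h1
  have h2 := tendsto_integral_abelKernel hψ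
  have h3 : l = ψ 0 := by
    refine tendsto_nhds_unique_of_eventuallyEq h1 h2 ?_
    filter_upwards [self_mem_nhdsWithin, nhdsWithin_le_nhds (lt_mem_nhds zero_lt_one)] with r a b
    exact (hasSum_angleCoeff_mul_pow hψ (le_of_lt b) a).tsum_eq
  rwa [h3] at hl

namespace SU2

lemma integral_spinChar_mul {φ : SU2 → ℂ} (hφ : Continuous φ) (n : ℕ) :
    ((n : ℂ) + 1) * ∫ h, spinChar n h * φ h ∂haarSU2 =
      angleCoeff (fun t => conjAvg φ (cartan t)) n := by
  rw [integral_weyl (f := fun h => spinChar n h * φ h) ((continuous_spinChar n).mul hφ), angleCoeff]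
  congr 2
  ext t
  have e : conjAvg (fun h => spinChar n h * φ h) (cartan t) =
      spinChar n (cartan t) * conjAvg φ (cartan t) := by
    rw [conjAvg, conjAvg, ← integral_const_mul]
    refine integral_congr_ae (.of_forall fun r => ?_)
    simp only [spinChar, Representation.char_conj]
  have h := spinChar_conj_cartan n 1 t
  rw [one_mul, inv_one, mul_one] at h
  rw [e, Complex.real_smul]
  push_cast at h ⊢
  linear_combination (2 / (Real.pi : ℂ) * Complex.sin t * conjAvg φ (cartan t)) * h

/-- The character expansion at the identity of a continuous function. -/
lemma hasSum_spinChar {φ : SU2 → ℂ} (hφ : Continuous φ)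
    (hs : Summable fun n : ℕ => ((n : ℂ) + 1) * ∫ h, spinChar n h * φ h ∂haarSU2) :
    HasSum (fun n : ℕ => ((n : ℂ) + 1) * ∫ h, spinChar n h * φ h ∂haarSU2) (φ 1) := by
  simp only [integral_spinChar_mul hφ] at hs ⊢
  have := hasSum_angleCoeff ((continuous_conjAvg hφ).comp continuous_cartan) hs
  have e : (conjAvg φ ∘ cartan) 0 = φ 1 := by simp [conjAvg, cartan_zero]
  rwa [e] at this

end SU2

/-! ### The triple character expansion -/

/-- Triples as nested pairs. -/
def finThreeArrowEquivProd (X : Type*) : (X × X) × X ≃ (Fin 3 → X) where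
  toFun p := ![p.1.1, p.1.2, p.2]
  invFun n := ((n 0, n 1), n 2)
  left_inv _ := rfl
  right_inv n := by ext i; fin_cases i <;> rfl

lemma integral_pi_weylMeasure {F : (Fin 3 → ℝ) → ℂ} (hF : Continuous F) {C : ℝ}
    (hC : ∀ t, ‖F t‖ ≤ C) :
    ∫ t, F t ∂(Measure.pi fun _ : Fin 3 => weylMeasure) =
      ∫ t, ((∏ i, Real.sin (t i) ^ 2 / Real.pi : ℝ) : ℂ) * F t ∂cubeMeasure := by
  have hle : -Real.pi ≤ Real.pi := by linarith [Real.pi_pos]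
  have hG : Continuous fun t => ((∏ i, Real.sin (t i) ^ 2 / Real.pi : ℝ) : ℂ) * F t := by
    fun_prop
  have hi := hG.integrable_cubeMeasure
  rw [cubeMeasure] at hi ⊢
  rw [integral_pi3 _ (Integrable.of_bound hF.aestronglyMeasurable C (.of_forall hC)),
    integral_pi3 _ hi]
  simp only [integral_weylMeasure, ← intervalIntegral.integral_of_le hle]
  simp only [Fin.prod_univ_three, Matrix.cons_val_zero, Matrix.cons_val_one,
    Matrix.cons_val, ← intervalIntegral.integral_smul]
  refine intervalIntegral.integral_congr fun x _ => ?_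
  refine intervalIntegral.integral_congr fun y _ => ?_
  refine intervalIntegral.integral_congr fun z _ => ?_
  simp only [Complex.real_smul]
  push_cast
  ring

lemma MeasureTheory.MeasurePreserving.pi_prod {ι X Y Z : Type*} [Fintype ι] [MeasurableSpace X]
    [MeasurableSpace Y] [MeasurableSpace Z] {μ : Measure X} {ν : Measure Y} {ρ : Measure Z}
    [SigmaFinite μ] [SigmaFinite ν] [SigmaFinite ρ] {κ : X × Y → Z}
    (h : MeasurePreserving κ (μ.prod ν) ρ) :
    MeasurePreserving (fun p : (ι → X) × (ι → Y) => (fun i => κ (p.1 i, p.2 i) : ι → Z))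
      ((Measure.pi fun _ => μ).prod (Measure.pi fun _ => ν)) (Measure.pi fun _ => ρ) :=
  (measurePreserving_pi (fun _ : ι => μ.prod ν) (fun _ => ρ) (fun _ => h)).comp
    (measurePreserving_arrowProdEquivProdArrow X Y ι (fun _ => μ) (fun _ => ν)).symm

namespace SU2

lemma continuous_conj_cartan3 (a : Fin 3 → SU2) : Continuous fun t : Fin 3 → ℝ =>
    (fun i => a i * cartan (t i) * (a i)⁻¹ : Fin 3 → SU2) :=
  continuous_pi fun i => continuous_conj_cartan.comp
    (f := fun t : Fin 3 → ℝ => (a i, t i)) (by fun_prop)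

lemma measurePreserving_conj_cartan3 :
    MeasurePreserving (fun p : (Fin 3 → SU2) × (Fin 3 → ℝ) =>
      (fun i => p.1 i * cartan (p.2 i) * (p.1 i)⁻¹ : Fin 3 → SU2))
      ((Measure.pi fun _ => haarSU2).prod (Measure.pi fun _ => weylMeasure))
      (Measure.pi fun _ => haarSU2) :=
  measurePreserving_conj_cartan.pi_prod (ι := Fin 3)

lemma integral_haarSU2Cubed_eq_integral_conj_cartan {G : (Fin 3 → SU2) → ℂ} (hG : Continuous G) :
    ∫ h, G h ∂haarSU2Cubed = ∫ a, (∫ t, ((∏ i, Real.sin (t i) ^ 2 / Real.pi : ℝ) : ℂ) *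
      G (fun i => a i * cartan (t i) * (a i)⁻¹) ∂cubeMeasure) ∂haarSU2Cubed := by
  have h := measurePreserving_conj_cartan3
  obtain ⟨C, hC⟩ := isCompact_univ.exists_bound_of_continuousOn hG.continuousOn
  have hi : Integrable (fun p : (Fin 3 → SU2) × (Fin 3 → ℝ) =>
      G (fun i => p.1 i * cartan (p.2 i) * (p.1 i)⁻¹))
      ((Measure.pi fun _ => haarSU2).prod (Measure.pi fun _ => weylMeasure)) :=
    h.integrable_comp_of_integrable hG.integrable_of_compactSpace
  have e := integral_map h.aemeasurable (f := G) hG.aestronglyMeasurable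
  rw [h.map_eq, integral_prod _ hi] at e
  rw [haarSU2Cubed, e]
  congr 1; funext a
  exact integral_pi_weylMeasure (hG.comp (continuous_conj_cartan3 a)) (fun t => hC _ trivial)

/-- The coefficients of the triple character expansion at the identity. -/
noncomputable def cubeCoeff (φ : (Fin 3 → SU2) → ℂ) (n : Fin 3 → ℕ) : ℂ :=
  (∏ i, ((n i : ℂ) + 1)) * ∫ h, (∏ i, spinChar (n i) (h i)) * φ h ∂haarSU2Cubed

lemma continuous_prod_spinChar (n : Fin 3 → ℕ) :
    Continuous fun h : Fin 3 → SU2 => ∏ i, spinChar (n i) (h i) :=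
  continuous_finsetProd _ fun i _ => (continuous_spinChar (n i)).comp (continuous_apply i)

/-- The character expansion at the identity of a continuous function on `SU(2)³`. -/
lemma hasSum_cubeCoeff {φ : (Fin 3 → SU2) → ℂ} (hφ : Continuous φ)
    (hs : Summable (cubeCoeff φ)) : HasSum (cubeCoeff φ) (φ 1) := by
  obtain ⟨l, hl⟩ := hs
  have hl2 : HasSum (fun p : (ℕ × ℕ) × ℕ => cubeCoeff φ ![p.1.1, p.1.2, p.2]) l :=
    (finThreeArrowEquivProd ℕ).hasSum_iff.2 hl
  -- The sum is taken one index at a time. Each one-variable expansion evaluates one more argument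
  -- at `1`: `ψ2` still depends on `z`, and `ψ1` on `y` with `z = 1`.
  set ψ2 : ℕ × ℕ → SU2 → ℂ := fun p z => ((p.1 : ℂ) + 1) * ((p.2 : ℂ) + 1) *
    ∫ x, ∫ y, spinChar p.1 x * (spinChar p.2 y * φ ![x, y, z]) ∂haarSU2 ∂haarSU2 with hψ2
  set ψ1 : ℕ → SU2 → ℂ := fun a y => ((a : ℂ) + 1) *
    ∫ x, spinChar a x * φ ![x, y, 1] ∂haarSU2 with hψ1
  have c2 : ∀ p, Continuous (ψ2 p) := fun p => by
    refine continuous_const.mul (continuous_integral_of_compactSpace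
      (f := fun z x => ∫ y, spinChar p.1 x * (spinChar p.2 y * φ ![x, y, z]) ∂haarSU2) ?_)
    refine continuous_integral_of_compactSpace (f := fun (q : SU2 × SU2) y =>
      spinChar p.1 q.2 * (spinChar p.2 y * φ ![q.2, y, q.1])) ?_
    exact ((continuous_spinChar _).comp (continuous_snd.comp continuous_fst)).mul
      (((continuous_spinChar _).comp continuous_snd).mul (hφ.comp (continuous_vec3
        (continuous_snd.comp continuous_fst) continuous_snd (continuous_fst.comp continuous_fst))))
  have c1 : ∀ a, Continuous (ψ1 a) := fun a => by
    refine continuous_const.mul (continuous_integral_of_compactSpace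
      (f := fun y x => spinChar a x * φ ![x, y, 1]) ?_)
    exact ((continuous_spinChar _).comp continuous_snd).mul
      (hφ.comp (continuous_vec3 continuous_snd continuous_fst continuous_const))
  have e2 : ∀ p : (ℕ × ℕ) × ℕ, cubeCoeff φ ![p.1.1, p.1.2, p.2] =
      ((p.2 : ℂ) + 1) * ∫ z, spinChar p.2 z * ψ2 p.1 z ∂haarSU2 := by
    intro p
    rw [cubeCoeff, haarSU2Cubed,
      integral_pi3_symm (fun _ => haarSU2)
        (F := fun h => (∏ i, spinChar (![p.1.1, p.1.2, p.2] i) (h i)) * φ h) ((continuous_prod_spinChar _).mul hφ)]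
    simp only [Fin.prod_univ_three, Matrix.cons_val_zero, Matrix.cons_val_one, Matrix.cons_val,
      hψ2, ← integral_const_mul]
    congr 1; ext z; congr 1; ext x; congr 1; ext y
    ring
  have h2 : ∀ p, HasSum (fun c : ℕ => cubeCoeff φ ![p.1, p.2, c]) (ψ2 p 1) := by
    intro p
    have hsum : Summable fun c : ℕ => cubeCoeff φ ![p.1, p.2, c] := hl2.summable.prod_factor p
    simp only [fun c => e2 (p, c)] at hsum ⊢
    exact hasSum_spinChar (c2 p) hsum
  have hl1 : HasSum (fun p : ℕ × ℕ => ψ2 p 1) l := hl2.prod_fiberwise h2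
  have e1 : ∀ p : ℕ × ℕ, ψ2 p 1 = ((p.2 : ℂ) + 1) * ∫ y, spinChar p.2 y * ψ1 p.1 y ∂haarSU2 := by
    intro p
    simp only [hψ2, hψ1]
    rw [integral_integral_swap]
    · simp only [← integral_const_mul]
      congr 1; ext y; congr 1; ext x
      ring
    · refine Continuous.integrable_of_compactSpace ?_
      exact ((continuous_spinChar _).comp continuous_fst).mul
        (((continuous_spinChar _).comp continuous_snd).mul (hφ.comp (continuous_vec3
          continuous_fst continuous_snd continuous_const)))
  have h1 : ∀ a, HasSum (fun b : ℕ => ψ2 (a, b) 1) (ψ1 a 1) := by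
    intro a
    have hsum : Summable fun b : ℕ => ψ2 (a, b) 1 := hl1.summable.prod_factor a
    simp only [e1] at hsum ⊢
    exact hasSum_spinChar (c1 a) hsum
  have hl0 : HasSum (fun a => ψ1 a 1) l := hl1.prod_fiberwise h1
  have h0 : HasSum (fun a => ψ1 a 1) (φ ![1, 1, 1]) :=
    hasSum_spinChar (φ := fun x => φ ![x, 1, 1])
      (hφ.comp (continuous_vec3 continuous_id continuous_const continuous_const)) hl0.summable
  have e : (![1, 1, 1] : Fin 3 → SU2) = 1 := by
    funext i; fin_cases i <;> rfl
  rw [hl0.unique h0, e] at hl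
  exact hl

end SU2

/-! ### Uniform decay of the character coefficients of smooth functions -/

namespace SU2

/-- The entries of a group element, as a vector. -/
def entries (g : SU2) : Fin 2 → Fin 2 → ℂ := fun p q => (g : Matrix (Fin 2) (Fin 2) ℂ) p q

lemma continuous_entries : Continuous entries :=
  continuous_pi fun p => continuous_pi fun q =>
    (continuous_apply q).comp ((continuous_apply p).comp continuous_subtype_val)

/-- The ambient space of the parameters `x`, `g`, `a`. -/
abbrev Params : Type :=
  (Fin 3 → Fin 2 → Fin 2 → ℂ) × (Fin 2 → Fin 2 → ℂ) × (Fin 3 → Fin 2 → Fin 2 → ℂ)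

/-- The smooth extension of the entries of `g aᵢ g_{tᵢ} aᵢ⁻¹`. -/
noncomputable def translateEntries (v : Params × (Fin 3 → ℝ)) : Fin 3 → Fin 2 → Fin 2 → ℂ :=
  fun i p s => ∑ q, v.1.2.1 p q * ∑ r, v.1.2.2 i q r *
    Complex.exp ((![Complex.I, -Complex.I] : Fin 2 → ℂ) r * (v.2 i : ℂ)) *
      (starRingEnd ℂ) (v.1.2.2 i s r)

lemma contDiff_translateEntries : ContDiff ℝ ∞ translateEntries := by
  refine contDiff_pi.2 fun i => contDiff_pi.2 fun p => contDiff_pi.2 fun s => ?_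
  refine ContDiff.sum fun q _ => ContDiff.mul (by fun_prop) (ContDiff.sum fun r _ => ?_)
  refine (ContDiff.mul (by fun_prop) (ContDiff.cexp (contDiff_const.mul ?_))).mul ?_
  · exact Complex.ofRealCLM.contDiff.comp (by fun_prop)
  · exact Complex.conjCLE.contDiff.comp (by fun_prop)

lemma translateEntries_periodic (i : Fin 3) (v : Params × (Fin 3 → ℝ)) :
    translateEntries (v + (0, Pi.single i (2 * Real.pi))) = translateEntries v := by
  funext j p s
  simp only [translateEntries, Prod.fst_add, add_zero, Prod.snd_add, Pi.add_apply]
  by_cases h : j = i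
  · subst h
    refine Finset.sum_congr rfl fun q _ => congrArg _ (Finset.sum_congr rfl fun r _ => ?_)
    congr 2
    rw [Pi.single_eq_same]
    push_cast
    rw [mul_add]
    fin_cases r
    · simpa [mul_comm, mul_assoc, mul_left_comm] using
        Complex.exp_periodic (Complex.I * (v.2 j : ℂ))
    · simpa [mul_comm, mul_assoc, mul_left_comm, sub_eq_add_neg] using
        Complex.exp_periodic.sub_eq (-Complex.I * (v.2 j : ℂ))
  · simp [h]

lemma translateEntries_entries (x : Fin 3 → Fin 2 → Fin 2 → ℂ) (g : SU2) (a : Fin 3 → SU2)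
    (t : Fin 3 → ℝ) :
    translateEntries ((x, entries g, fun i => entries (a i)), t) =
      fun i => entries (g * (a i * cartan (t i) * (a i)⁻¹)) := by
  funext i p s
  simp only [entries, translateEntries, Submonoid.coe_mul, coe_inv, Matrix.mul_apply,
    Matrix.star_apply]
  refine Finset.sum_congr rfl fun q _ => congrArg _ ?_
  simp [cartan, Fin.sum_univ_two, Matrix.diagonal]

/-- The integrand of the character coefficients, in the angles. -/
noncomputable def coeffIntegrand
    (F : (Fin 3 → Fin 2 → Fin 2 → ℂ) × (Fin 3 → Fin 2 → Fin 2 → ℂ) → ℂ)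
    (v : Params × (Fin 3 → ℝ)) : ℂ :=
  (∏ i, (Real.sin (v.2 i) : ℂ)) * F (v.1.1, translateEntries v)

lemma smoothPeriodic_coeffIntegrand
    {F : (Fin 3 → Fin 2 → Fin 2 → ℂ) × (Fin 3 → Fin 2 → Fin 2 → ℂ) → ℂ} (hF : ContDiff ℝ ∞ F) :
    SmoothPeriodic (coeffIntegrand F) where
  contDiff := by
    refine ContDiff.mul (contDiff_prod fun i _ => ?_)
      (hF.comp (ContDiff.prodMk (by fun_prop) contDiff_translateEntries))
    exact Complex.ofRealCLM.contDiff.comp (Real.contDiff_sin.comp (by fun_prop))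
  periodic i v := by
    have hs : ∀ j, Real.sin (v.2 j + (Pi.single i (2 * Real.pi) : Fin 3 → ℝ) j) =
        Real.sin (v.2 j) := by
      intro j
      by_cases h : j = i
      · subst h; simp
      · simp [h]
    simp only [coeffIntegrand, translateEntries_periodic, Prod.fst_add, Prod.snd_add, Pi.add_apply,
      add_zero, hs]

/-- One sine of the Weyl density turns the character into `sin ((n i + 1) t i)`, whence the shifted
frequency; the other sine goes into `coeffIntegrand`. -/
lemma prod_sin_mul_spinChar (n : Fin 3 → ℕ) (a : Fin 3 → SU2) (t : Fin 3 → ℝ) :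
    ((∏ i, Real.sin (t i) ^ 2 / Real.pi : ℝ) : ℂ) *
        ∏ i, spinChar (n i) (a i * cartan (t i) * (a i)⁻¹) =
      ((Real.pi : ℂ) ^ 3)⁻¹ * ((∏ i, (Real.sin ((n i + 1 : ℕ) * t i) : ℂ)) *
        ∏ i, (Real.sin (t i) : ℂ)) := by
  have h : ∀ i, ((Real.sin (t i) ^ 2 / Real.pi : ℝ) : ℂ) *
      spinChar (n i) (a i * cartan (t i) * (a i)⁻¹) =
      (Real.pi : ℂ)⁻¹ * ((Real.sin ((n i + 1 : ℕ) * t i) : ℂ) * (Real.sin (t i) : ℂ)) := by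
    intro i
    have := spinChar_conj_cartan (n i) (a i) (t i)
    rw [show ((n i + 1 : ℕ) : ℝ) * t i = (n i + 1) * t i by push_cast; ring, ← this]
    push_cast
    ring
  rw [Complex.ofReal_prod, ← Finset.prod_mul_distrib, Finset.prod_congr rfl fun i _ => h i,
    Finset.prod_mul_distrib, Finset.prod_mul_distrib]
  simp

lemma integral_prod_spinChar_eq
    {F : (Fin 3 → Fin 2 → Fin 2 → ℂ) × (Fin 3 → Fin 2 → Fin 2 → ℂ) → ℂ} (hF : Continuous F)
    (x : Fin 3 → Fin 2 → Fin 2 → ℂ) (g : SU2) (n : Fin 3 → ℕ) :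
    ∫ h, (∏ i, spinChar (n i) (h i)) * F (x, fun i => entries (g * h i)) ∂haarSU2Cubed =
      ((Real.pi : ℂ) ^ 3)⁻¹ * ∫ a, sineCoeff (coeffIntegrand F) (fun i => n i + 1)
        (x, entries g, fun i => entries (a i)) ∂haarSU2Cubed := by
  have hc : Continuous fun h : Fin 3 → SU2 =>
      (∏ i, spinChar (n i) (h i)) * F (x, fun i => entries (g * h i)) :=
    (continuous_prod_spinChar n).mul (hF.comp (continuous_const.prodMk (continuous_pi fun i =>
      continuous_entries.comp (continuous_const.mul (continuous_apply i)))))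
  rw [integral_haarSU2Cubed_eq_integral_conj_cartan hc, ← integral_const_mul]
  congr 1; funext a
  rw [sineCoeff, ← integral_const_mul]
  congr 1; funext t
  rw [coeffIntegrand, translateEntries_entries, ← mul_assoc, prod_sin_mul_spinChar]
  ring

lemma exists_norm_cubeCoeff_le
    {F : (Fin 3 → Fin 2 → Fin 2 → ℂ) × (Fin 3 → Fin 2 → Fin 2 → ℂ) → ℂ} (hF : ContDiff ℝ ∞ F) :
    ∃ C, ∀ (x : Fin 3 → SU2) (g : SU2) (n : Fin 3 → ℕ),
      ‖cubeCoeff (fun h => F (fun i => entries (x i), fun i => entries (g * h i))) n‖ ≤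
        C * ∏ i, (1 / ((n i : ℝ) + 1) ^ 3) := by
  have hκ : Continuous fun k : (Fin 3 → SU2) × SU2 × (Fin 3 → SU2) =>
      ((fun i => entries (k.1 i), entries k.2.1, fun i => entries (k.2.2 i)) : Params) := by
    refine Continuous.prodMk (continuous_pi fun i => continuous_entries.comp ?_)
      ((continuous_entries.comp ?_).prodMk (continuous_pi fun i => continuous_entries.comp ?_))
    all_goals fun_prop
  obtain ⟨C, hC⟩ := (smoothPeriodic_coeffIntegrand hF).exists_sineCoeff_bound hκ
  refine ⟨(Real.pi ^ 3)⁻¹ * C, fun x g n => ?_⟩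
  have hpi := Real.pi_pos
  have hP : ∀ k : ℕ, (0 : ℝ) < ∏ i, ((n i : ℝ) + 1) ^ k := fun k =>
    Finset.prod_pos fun i _ => by positivity
  have hb : ∀ a : Fin 3 → SU2, ‖sineCoeff (coeffIntegrand F) (fun i => n i + 1)
      (fun i => entries (x i), entries g, fun i => entries (a i))‖ ≤
      C / ∏ i, ((n i : ℝ) + 1) ^ 4 := by
    intro a
    rw [le_div_iff₀ (hP 4), mul_comm]
    simpa using hC (x, g, a) (fun i => n i + 1)
  have hb' := norm_integral_le_of_norm_le_const (μ := haarSU2Cubed) (.of_forall hb)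
  rw [probReal_univ, mul_one] at hb'
  rw [cubeCoeff, integral_prod_spinChar_eq hF.continuous, norm_mul, norm_mul, norm_inv, norm_pow,
    Complex.norm_real, Real.norm_of_nonneg hpi.le, norm_prod]
  have e1 : ∀ i, ‖(n i : ℂ) + 1‖ = (n i : ℝ) + 1 := fun i => by
    rw [show (n i : ℂ) + 1 = ((n i + 1 : ℕ) : ℂ) by push_cast; ring, Complex.norm_natCast]
    push_cast; ring
  simp only [e1]
  calc _ ≤ (∏ i, ((n i : ℝ) + 1)) * ((Real.pi ^ 3)⁻¹ * (C / ∏ i, ((n i : ℝ) + 1) ^ 4)) := by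
        gcongr
    _ = (Real.pi ^ 3)⁻¹ * C * ∏ i, (1 / ((n i : ℝ) + 1) ^ 3) := by
        simp only [Fin.prod_univ_three]
        field_simp

lemma summable_prod_one_div_pow_three :
    Summable fun n : Fin 3 → ℕ => ∏ i, (1 / ((n i : ℝ) + 1) ^ 3) := by
  have h : Summable fun n : ℕ => 1 / ((n : ℝ) + 1) ^ 3 := by
    have := (summable_nat_add_iff 1).2 (Real.summable_one_div_nat_pow.2 (by norm_num : 1 < 3))
    simpa using this
  have h0 : ∀ n : ℕ, 0 ≤ 1 / ((n : ℝ) + 1) ^ 3 := fun n => by positivity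
  have h2 := h.mul_of_nonneg h h0 h0
  have h3 := h2.mul_of_nonneg h (fun p => mul_nonneg (h0 _) (h0 _)) h0
  refine (finThreeArrowEquivProd ℕ).summable_iff.1 (h3.congr fun p => ?_)
  change _ = ∏ i, (1 / (((![p.1.1, p.1.2, p.2] : Fin 3 → ℕ) i : ℝ) + 1) ^ 3)
  simp only [Fin.prod_univ_three, Matrix.cons_val_zero, Matrix.cons_val_one, Matrix.cons_val]

lemma spinChar_inv (n : ℕ) (g : SU2) : spinChar n g⁻¹ = spinChar n g := by
  simp [spinChar_eq, ca_inv]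

/-! ### Expansion of the diagonal integral in theta functions -/

/-- The coefficient of `θ_{j₁ j₂ j₃}` in the expansion of the integral over the diagonal. -/
noncomputable def spinCoeff (f : (Fin 3 → SU2) → (Fin 3 → SU2) → ℂ) (n : Fin 3 → ℕ)
    (x : Fin 3 → SU2) : ℂ :=
  (∏ i, ((n i : ℂ) + 1)) * ∫ y, thetaSpin n y * f x y ∂haarSU2Cubed

/-- Simultaneous left translation. -/
def translate (g : SU2) (h : Fin 3 → SU2) : Fin 3 → SU2 := fun i => g * h i

lemma integral_translate (φ : (Fin 3 → SU2) → ℂ) (g : SU2) :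
    ∫ h, φ (translate g h) ∂haarSU2Cubed = ∫ y, φ y ∂haarSU2Cubed :=
  integral_mul_left_eq_self (μ := Measure.pi fun _ : Fin 3 => haarSU2) φ (fun _ => g)

lemma continuous_translate :
    Continuous fun p : SU2 × (Fin 3 → SU2) => translate p.1 p.2 :=
  continuous_pi fun i => continuous_fst.mul ((continuous_apply i).comp continuous_snd)

lemma prod_spinChar_translate (n : Fin 3 → ℕ) (g : SU2) (h : Fin 3 → SU2) :
    ∏ i, spinChar (n i) ((translate g h i)⁻¹ * g) = ∏ i, spinChar (n i) (h i) :=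
  Finset.prod_congr rfl fun i _ => by
    rw [translate, mul_inv_rev, inv_mul_cancel_right, spinChar_inv]

lemma continuous_prod_spinChar_inv_mul (n : Fin 3 → ℕ) :
    Continuous fun p : (Fin 3 → SU2) × SU2 => ∏ i, spinChar (n i) ((p.1 i)⁻¹ * p.2) :=
  continuous_finsetProd _ fun i _ => (continuous_spinChar (n i)).comp
    (f := fun p : (Fin 3 → SU2) × SU2 => (p.1 i)⁻¹ * p.2)
    (((continuous_apply i).comp continuous_fst).inv.mul continuous_snd)

/-- After exchanging the integrals in `g` and `y`, the substitution `y i = g * h i` turns `(y i)⁻¹ *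
g` into `(h i)⁻¹`, on which the character takes the same value as on `h i`. -/
lemma spinCoeff_eq {f : (Fin 3 → SU2) → (Fin 3 → SU2) → ℂ} {x : Fin 3 → SU2}
    (hf : Continuous (f x)) (n : Fin 3 → ℕ) :
    spinCoeff f n x = ∫ g, cubeCoeff (fun h => f x (translate g h)) n ∂haarSU2 := by
  rw [spinCoeff]
  simp only [cubeCoeff]
  rw [integral_const_mul]
  congr 1
  simp only [thetaSpin, ← integral_mul_const]
  rw [integral_integral_swap]
  · refine integral_congr_ae (.of_forall fun g => ?_)
    refine (integral_translate
      (fun y => (∏ i, spinChar (n i) ((y i)⁻¹ * g)) * f x y) g).symm.trans ?_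
    simp only [prod_spinChar_translate]
  · exact ((continuous_prod_spinChar_inv_mul n).mul
      (hf.comp continuous_fst)).integrable_of_compactSpace

lemma continuous_cubeCoeff_translate {φ : (Fin 3 → SU2) → ℂ} (hφ : Continuous φ)
    (n : Fin 3 → ℕ) : Continuous fun g : SU2 => cubeCoeff (fun h => φ (translate g h)) n := by
  refine continuous_const.mul (continuous_integral_of_compactSpace (f := fun (g : SU2) h =>
    (∏ i, spinChar (n i) (h i)) * φ (translate g h)) ?_)
  exact ((continuous_prod_spinChar n).comp continuous_snd).mul (hφ.comp (g := φ) continuous_translate)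

/-- The Peter–Weyl expansion of a test function on the diagonal. -/
theorem exists_hasSum_spinCoeff {f : (Fin 3 → SU2) → (Fin 3 → SU2) → ℂ} (hf : IsTestFunction f) :
    ∃ b : (Fin 3 → ℕ) → ℝ, Summable b ∧ (∀ n x, ‖spinCoeff f n x‖ ≤ b n) ∧
      ∀ x, HasSum (fun n => spinCoeff f n x) (∫ g, f x (fun _ => g) ∂haarSU2) := by
  obtain ⟨F, hF, hfF⟩ := hf
  have hfc : ∀ x, Continuous (f x) := fun x => by
    have : f x = fun y => F (fun i => entries (x i), fun i => entries (y i)) := funext (hfF x)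
    rw [this]
    exact hF.continuous.comp (continuous_const.prodMk (continuous_pi fun i =>
      continuous_entries.comp (continuous_apply i)))
  obtain ⟨C, hC⟩ := exists_norm_cubeCoeff_le hF
  have hC' : ∀ x g n, ‖cubeCoeff (fun h => f x (translate g h)) n‖ ≤
      C * ∏ i, (1 / ((n i : ℝ) + 1) ^ 3) := fun x g n => by
    have : (fun h : Fin 3 → SU2 => f x (translate g h)) =
        fun h => F (fun i => entries (x i), fun i => entries (g * h i)) :=
      funext fun h => hfF x _
    rw [this]
    exact hC x g n
  have hb := summable_prod_one_div_pow_three.mul_left C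
  refine ⟨_, hb, fun n x => ?_, fun x => ?_⟩
  · rw [spinCoeff_eq (hfc x)]
    have := norm_integral_le_of_norm_le_const (μ := haarSU2) (.of_forall fun g => hC' x g n)
    rwa [probReal_univ, mul_one] at this
  · simp only [spinCoeff_eq (hfc x)]
    refine hasSum_integral_of_dominated_convergence
      (fun n _ => C * ∏ i, (1 / ((n i : ℝ) + 1) ^ 3))
      (fun n => (continuous_cubeCoeff_translate (hfc x) n).aestronglyMeasurable)
      (fun n => .of_forall fun g => hC' x g n) (.of_forall fun _ => hb) (integrable_const _)
      (.of_forall fun g => ?_)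
    have hg : Continuous fun h : Fin 3 → SU2 => f x (translate g h) :=
      (hfc x).comp (continuous_translate.comp (f := fun h => (g, h)) (by fun_prop))
    have h1 : translate g 1 = fun _ => g := funext fun _ => mul_one g
    have := hasSum_cubeCoeff hg (Summable.of_norm_bounded hb (hC' x g))
    rwa [h1] at this

end SU2

/-! ### The decomposition of the theta distribution -/

namespace SU2

/-- The angles for which the product of the delta functions exists. -/
structure IsGeneric (t : Fin 3 → ℝ) : Prop where
  regular : Regular (t 0) (t 1)
  mem : t 2 ∈ Set.Ioo 0 Real.pi
  gram_ne : gram (t 0) (t 1) (t 2) ≠ 0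

lemma restrict_Icc_eq_pi :
    (volume.restrict (Set.Icc 0 fun _ => Real.pi) : Measure (Fin 3 → ℝ)) =
      Measure.pi fun _ => volume.restrict (Set.Ioo 0 Real.pi) := by
  have h : (volume.restrict (Set.Icc 0 Real.pi) : Measure ℝ) =
      volume.restrict (Set.Ioo 0 Real.pi) := (Measure.restrict_congr_set Ioo_ae_eq_Icc).symm
  rw [← h, ← Measure.restrict_pi_pi, ← volume_pi, Set.pi_univ_Icc]
  rfl

lemma ae_pi3_of_ae {X : Type*} [MeasurableSpace X] {μ : Measure X} [SigmaFinite μ]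
    {p : (Fin 3 → X) → Prop} (hp : MeasurableSet {t | p t})
    (h : ∀ᵐ a ∂μ, ∀ᵐ b ∂μ, ∀ᵐ s ∂μ, p ![a, b, s]) : ∀ᵐ t ∂(Measure.pi fun _ => μ), p t := by
  have e := measurePreserving_vec3 (fun _ : Fin 3 => μ)
  have hm : Measurable fun p : (X × X) × X => (![p.1.1, p.1.2, p.2] : Fin 3 → X) :=
    measurable_vec3
  rw [← e.map_eq, ae_map_iff e.aemeasurable hp]
  have hp' := hp.preimage hm
  refine (Measure.ae_prod_iff_ae_ae hp').2 ?_
  have h2 : MeasurableSet {q : X × X | ∀ᵐ s ∂μ, p ![q.1, q.2, s]} :=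
    measurable_measure_prodMk_left (ν := μ) hp'.compl (measurableSet_singleton 0)
  exact (Measure.ae_prod_iff_ae_ae h2).2 h

lemma cos_eq_of_gram_eq_zero {a b s : ℝ} (h : gram a b s = 0) :
    Real.cos s = Real.cos (a - b) ∨ Real.cos s = Real.cos (a + b) := by
  rw [gram_eq, sub_eq_zero] at h
  rw [Real.cos_sub, Real.cos_add]
  rcases sq_eq_sq_iff_eq_or_eq_neg.1 h with h | h
  · left; linarith
  · right; linarith

lemma ae_ae_regular : ∀ᵐ a ∂(volume.restrict (Set.Ioo 0 Real.pi)),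
    ∀ᵐ b ∂(volume.restrict (Set.Ioo 0 Real.pi)), Regular a b := by
  filter_upwards [ae_restrict_mem measurableSet_Ioo] with a ha
  have h1 : ∀ᵐ b : ℝ ∂(volume.restrict (Set.Ioo 0 Real.pi)), b ≠ a := Measure.ae_ne _ a
  have h2 : ∀ᵐ b : ℝ ∂(volume.restrict (Set.Ioo 0 Real.pi)), b ≠ Real.pi - a := Measure.ae_ne _ _
  filter_upwards [ae_restrict_mem measurableSet_Ioo, h1, h2] with b hb e1 e2
  exact ⟨ha, hb, e1.symm, fun h => e2 (by linarith)⟩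

/-- On `(0, π)` the cosine is injective, so at most two values of `s` are excluded. -/
lemma ae_gram_ne_zero (a b : ℝ) :
    ∀ᵐ s ∂(volume.restrict (Set.Ioo 0 Real.pi)), gram a b s ≠ 0 := by
  have h1 : ∀ᵐ s : ℝ ∂(volume.restrict (Set.Ioo 0 Real.pi)), s ≠ Real.arccos (Real.cos (a - b)) :=
    Measure.ae_ne _ _
  have h2 : ∀ᵐ s : ℝ ∂(volume.restrict (Set.Ioo 0 Real.pi)), s ≠ Real.arccos (Real.cos (a + b)) :=
    Measure.ae_ne _ _
  filter_upwards [ae_restrict_mem measurableSet_Ioo, h1, h2] with s hs e1 e2 hg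
  have := Real.arccos_cos hs.1.le hs.2.le
  rcases cos_eq_of_gram_eq_zero hg with h | h
  · exact e1 (by rw [← h, this])
  · exact e2 (by rw [← h, this])

lemma isGeneric_iff (t : Fin 3 → ℝ) : IsGeneric t ↔
    (t 0 ∈ Set.Ioo 0 Real.pi ∧ t 1 ∈ Set.Ioo 0 Real.pi ∧ t 0 ≠ t 1 ∧ t 0 + t 1 ≠ Real.pi) ∧
      t 2 ∈ Set.Ioo 0 Real.pi ∧ gram (t 0) (t 1) (t 2) ≠ 0 :=
  ⟨fun h => ⟨⟨h.1.1, h.1.2, h.1.3, h.1.4⟩, h.2, h.3⟩,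
    fun h => ⟨⟨h.1.1, h.1.2.1, h.1.2.2.1, h.1.2.2.2⟩, h.2.1, h.2.2⟩⟩

lemma isOpen_isGeneric : IsOpen {t | IsGeneric t} := by
  simp only [isGeneric_iff]
  have hg : Continuous fun t : Fin 3 → ℝ => gram (t 0) (t 1) (t 2) := by
    unfold gram; fun_prop
  have h : ∀ i : Fin 3, IsOpen {t : Fin 3 → ℝ | t i ∈ Set.Ioo 0 Real.pi} := fun i =>
    isOpen_Ioo.preimage (continuous_apply i)
  exact ((h 0).inter ((h 1).inter ((isOpen_ne_fun (by fun_prop) (by fun_prop)).inter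
    (isOpen_ne_fun (by fun_prop) (by fun_prop))))).inter
    ((h 2).inter (isOpen_ne_fun hg (by fun_prop)))

lemma ae_isGeneric : ∀ᵐ t : Fin 3 → ℝ ∂(volume.restrict (Set.Icc 0 fun _ => Real.pi)),
    IsGeneric t := by
  rw [restrict_Icc_eq_pi]
  refine ae_pi3_of_ae isOpen_isGeneric.measurableSet ?_
  filter_upwards [ae_ae_regular] with a ha
  filter_upwards [ha] with b hb
  filter_upwards [ae_restrict_mem measurableSet_Ioo, ae_gram_ne_zero a b] with s hs hg
  exact ⟨hb, hs, hg⟩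

lemma prod_weylDelta (t : Fin 3 → ℝ) : ∏ i, weylDelta (t i) ^ 2 / Real.pi =
    2 * Real.sin (t 0) ^ 2 / Real.pi * (2 * Real.sin (t 1) ^ 2 / Real.pi) *
      (2 * Real.sin (t 2) ^ 2 / Real.pi) := by
  simp only [Fin.prod_univ_three, weylDelta, mul_pow, Real.sq_sqrt zero_le_two]

/-- The weighted orbital integral. -/
noncomputable def weightedOrbital (φ : SU2 → SU2 → ℂ) (t : Fin 3 → ℝ) : ℂ :=
  ((∏ i, weylDelta (t i) ^ 2 / Real.pi) * triW (t 0) (t 1) (t 2)) •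
    conjAvg2 φ (tri0 (t 0) (t 1) (t 2)) (tri1 (t 0) (t 1) (t 2))

/-- The Weyl densities cancel all three poles of `triW`, so the weight is bounded on the cube. This
is what gives integrability over the angles. -/
lemma IsGeneric.weight_eq {t : Fin 3 → ℝ} (h : IsGeneric t) :
    (∏ i, weylDelta (t i) ^ 2 / Real.pi) * triW (t 0) (t 1) (t 2) =
      if 0 ≤ gram (t 0) (t 1) (t 2) then
        2 / Real.pi ^ 2 * (Real.sin (t 0) * Real.sin (t 1) * Real.sin (t 2)) else 0 := by
  have h0 := (Real.sin_pos_of_mem_Ioo h.regular.a_mem).ne'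
  have h1 := (Real.sin_pos_of_mem_Ioo h.regular.b_mem).ne'
  rw [prod_weylDelta, mul_assoc, SU2.weight_eq]
  have := Real.pi_ne_zero
  split_ifs
  · field_simp
  · simp

lemma integrable_weightedOrbital {φ : SU2 → SU2 → ℂ} (hφ : Continuous (Function.uncurry φ)) :
    IntegrableOn (weightedOrbital φ) (Set.Icc 0 fun _ => Real.pi) := by
  obtain ⟨C, hC⟩ := isCompact_univ.exists_bound_of_continuousOn
    (continuous_conjAvg2 hφ).continuousOn
  have hgen : ∀ᵐ t : Fin 3 → ℝ ∂(volume.restrict (Set.Icc 0 fun _ => Real.pi)),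
    t ∈ {t | IsGeneric t} := ae_isGeneric
  have hr : (volume.restrict (Set.Icc 0 fun _ => Real.pi) : Measure (Fin 3 → ℝ)).restrict
      {t | IsGeneric t} = volume.restrict (Set.Icc 0 fun _ => Real.pi) :=
    Measure.restrict_eq_self_of_ae_mem hgen
  have : IsFiniteMeasure (volume.restrict (Set.Icc 0 fun _ => Real.pi) :
      Measure (Fin 3 → ℝ)) := ⟨by rw [Measure.restrict_apply_univ]; exact measure_Icc_lt_top⟩
  refine Integrable.of_bound (C := 2 / Real.pi ^ 2 * C) ?_ ?_
  · have hA : AEStronglyMeasurable (fun t : Fin 3 → ℝ => (∏ i, weylDelta (t i) ^ 2 / Real.pi) *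
        triW (t 0) (t 1) (t 2)) (volume.restrict (Set.Icc 0 fun _ => Real.pi)) := by
      refine Measurable.aestronglyMeasurable (Measurable.mul ?_ ?_)
      · simp only [prod_weylDelta]; fun_prop
      · unfold triW
        refine Measurable.ite (measurableSet_le measurable_const ?_) (by fun_prop) measurable_const
        unfold gram; fun_prop
    have hB : AEStronglyMeasurable (fun t : Fin 3 → ℝ =>
        conjAvg2 φ (tri0 (t 0) (t 1) (t 2)) (tri1 (t 0) (t 1) (t 2)))
        (volume.restrict (Set.Icc 0 fun _ => Real.pi)) := by
      -- The standard pair is continuous only at regular third angles, so the cube is first cut down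
      -- to the generic set, which has full measure.
      rw [← hr]
      refine ContinuousOn.aestronglyMeasurable (fun t ht => ContinuousAt.continuousWithinAt ?_)
        isOpen_isGeneric.measurableSet
      have hs : Real.sin (t 2) ≠ 0 := (Real.sin_pos_of_mem_Ioo ht.mem).ne'
      have ht3 : ContinuousAt (fun t : Fin 3 → ℝ => (t 0, t 1, t 2)) t := by fun_prop
      have e0 : ContinuousAt (fun t : Fin 3 → ℝ => tri0 (t 0) (t 1) (t 2)) t :=
        ContinuousAt.comp (f := fun t : Fin 3 → ℝ => (t 0, t 1, t 2)) (continuousAt_tri0 hs) ht3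
      have e1 : ContinuousAt (fun t : Fin 3 → ℝ => tri1 (t 0) (t 1) (t 2)) t :=
        ContinuousAt.comp (f := fun t : Fin 3 → ℝ => (t 0, t 1, t 2)) (continuousAt_tri1 hs) ht3
      exact ContinuousAt.comp (f := fun t : Fin 3 → ℝ => (tri0 (t 0) (t 1) (t 2),
        tri1 (t 0) (t 1) (t 2))) (continuous_conjAvg2 hφ).continuousAt (e0.prodMk e1)
    exact hA.smul hB
  · filter_upwards [ae_isGeneric] with t ht
    rw [weightedOrbital, norm_smul, ht.weight_eq]
    have hpi := Real.pi_pos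
    refine mul_le_mul ?_ (hC (tri0 (t 0) (t 1) (t 2), tri1 (t 0) (t 1) (t 2)) (Set.mem_univ _))
      (norm_nonneg _) (by positivity)
    split_ifs
    · have hs : ∀ x, ‖Real.sin x‖ ≤ 1 := Real.abs_sin_le_one
      rw [norm_mul, norm_mul, norm_mul, Real.norm_of_nonneg (by positivity)]
      refine mul_le_of_le_one_right (by positivity) ?_
      exact mul_le_one₀ (mul_le_one₀ (hs _) (norm_nonneg _) (hs _)) (norm_nonneg _) (hs _)
    · simp only [norm_zero]; positivity

end SU2

/-! ### Integration over the three angles -/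

namespace SU2

lemma integral_integral_weyl {φ : SU2 → SU2 → ℂ} (hφ : Continuous (Function.uncurry φ)) :
    ∫ x, ∫ y, φ x y ∂haarSU2 ∂haarSU2 =
      ∫ a in (0 : ℝ)..Real.pi, (2 * Real.sin a ^ 2 / Real.pi) •
        ∫ b in (0 : ℝ)..Real.pi, (2 * Real.sin b ^ 2 / Real.pi) •
          ∫ x, ∫ y, φ x y ∂(classDelta b) ∂(classDelta a) := by
  have hx : ∀ x, Continuous (φ x) := fun x =>
    hφ.comp (f := fun y => (x, y)) (by fun_prop)
  have hK : Continuous fun p : SU2 × ℝ => conjAvg (φ p.1) (cartan p.2) := by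
    refine continuous_integral_of_compactSpace
      (f := fun (p : SU2 × ℝ) r => φ p.1 (r * cartan p.2 * r⁻¹)) ?_
    exact hφ.comp (g := Function.uncurry φ) (f := fun q : (SU2 × ℝ) × SU2 =>
      (q.1.1, q.2 * cartan q.1.2 * q.2⁻¹)) (by fun_prop)
  obtain ⟨C, hC⟩ := ((isCompact_univ (X := SU2)).prod (isCompact_Icc (a := (0 : ℝ))
    (b := Real.pi))).exists_bound_of_continuousOn (f := fun p =>
      (2 * Real.sin p.2 ^ 2 / Real.pi) • conjAvg (φ p.1) (cartan p.2))
      (Continuous.continuousOn ((by fun_prop : Continuous fun p : SU2 × ℝ =>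
        2 * Real.sin p.2 ^ 2 / Real.pi).smul hK))
  have hf : Continuous fun x => ∫ y, φ x y ∂haarSU2 := continuous_integral_of_compactSpace hφ
  rw [integral_weyl hf]
  congr 1; funext a; congr 1
  rw [conjAvg, ← classDelta_integral a hf]
  have e1 : ∀ x, ∫ y, φ x y ∂haarSU2 = ∫ b in Set.Ioc 0 Real.pi,
      (2 * Real.sin b ^ 2 / Real.pi) • conjAvg (φ x) (cartan b) := fun x => by
    rw [integral_weyl (hx x), intervalIntegral.integral_of_le Real.pi_pos.le]
  simp only [e1]
  rw [integral_integral_swap, intervalIntegral.integral_of_le Real.pi_pos.le]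
  · refine integral_congr_ae (.of_forall fun b => ?_)
    simp only
    rw [integral_smul]
    congr 1
    refine integral_congr_ae (.of_forall fun x => ?_)
    exact (classDelta_integral b (hx x)).symm
  · refine Integrable.of_bound (C := C) ?_ ?_
    · exact Continuous.aestronglyMeasurable ((by fun_prop : Continuous fun p : SU2 × ℝ =>
        2 * Real.sin p.2 ^ 2 / Real.pi).smul hK)
    · have h1 : ∀ᵐ p : SU2 × ℝ ∂((classDelta a).prod (volume.restrict (Set.Ioc 0 Real.pi))),
          p.2 ∈ Set.Ioc 0 Real.pi :=
        Measure.quasiMeasurePreserving_snd.ae (ae_restrict_mem measurableSet_Ioc)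
      filter_upwards [h1] with p hp
      exact hC p ⟨trivial, hp.1.le, hp.2⟩

/-- Weyl's formula in each of `x` and `y` produces the angles `a` and `b`. For almost all of these,
disintegrating the product of the two classes produces `s` with its density. -/
lemma integral_weightedOrbital {φ : SU2 → SU2 → ℂ} (hφ : Continuous (Function.uncurry φ)) :
    ∫ t in Set.Icc 0 fun _ => Real.pi, weightedOrbital φ t =
      ∫ x, ∫ y, φ x y ∂haarSU2 ∂haarSU2 := by
  have hi := integrable_weightedOrbital hφ
  rw [IntegrableOn, restrict_Icc_eq_pi] at hi
  have hI : ∀ f : ℝ → ℂ, ∫ t in (0 : ℝ)..Real.pi, f t = ∫ t in Set.Ioo 0 Real.pi, f t := fun f => by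
    rw [intervalIntegral.integral_of_le Real.pi_pos.le, integral_Ioc_eq_integral_Ioo]
  rw [restrict_Icc_eq_pi, integral_pi3 _ hi, integral_integral_weyl hφ, hI]
  refine integral_congr_ae ?_
  filter_upwards [ae_ae_regular] with a ha
  rw [hI, ← integral_smul]
  refine integral_congr_ae ?_
  filter_upwards [ha] with b hb
  rw [integral_classDelta_prod_eq hb hφ, hI, ← integral_smul, ← integral_smul]
  refine integral_congr_ae (.of_forall fun s => ?_)
  simp only [weightedOrbital, prod_weylDelta, smul_smul, Matrix.cons_val_zero, Matrix.cons_val_one,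
    Matrix.cons_val]
  congr 1
  ring

lemma IsGeneric.isDeltaProduct {t : Fin 3 → ℝ} (h : IsGeneric t) :
    IsDeltaProduct (classDelta3 t) closing (closedClasses (t 0) (t 1) (t 2)) :=
  isDeltaProduct_classDelta3 h.regular h.mem h.gram_ne

lemma IsGeneric.integral_deltaProduct {t : Fin 3 → ℝ} (h : IsGeneric t)
    {φ : (Fin 3 → SU2) → ℂ} (hφ : Continuous φ) :
    ∫ x, φ x ∂(deltaProduct (classDelta3 t) closing) =
      triW (t 0) (t 1) (t 2) • ∫ r, φ (orbit (t 0) (t 1) (t 2) r) ∂haarSU2 := by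
  rw [h.isDeltaProduct.integral_deltaProduct hφ,
    integral_closedClasses h.regular.a_mem h.regular.b_mem h.mem hφ]

lemma integral_orbit (φ : (Fin 3 → SU2) → ℂ) (a b s : ℝ) :
    ∫ r, φ (orbit a b s r) ∂haarSU2 =
      conjAvg2 (fun x y => φ ![x, y, x⁻¹ * y⁻¹]) (tri0 a b s) (tri1 a b s) := by
  simp only [conjAvg2, tri_inv_mul_inv]
  rfl

lemma continuous_closedTriple_uncurry {φ : (Fin 3 → SU2) → ℂ} (hφ : Continuous φ) :
    Continuous (Function.uncurry fun x y => φ ![x, y, x⁻¹ * y⁻¹]) :=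
  hφ.comp (f := fun p : SU2 × SU2 => ![p.1, p.2, p.1⁻¹ * p.2⁻¹])
    (continuous_vec3 (by fun_prop) (by fun_prop) (by fun_prop))

end SU2

lemma IsTestFunction.continuous {f : (Fin 3 → SU2) → (Fin 3 → SU2) → ℂ} (hf : IsTestFunction f) :
    Continuous (Function.uncurry f) := by
  obtain ⟨F, hF, hfF⟩ := hf
  have e : Function.uncurry f = fun p : (Fin 3 → SU2) × (Fin 3 → SU2) =>
      F (fun i => SU2.entries (p.1 i), fun i => SU2.entries (p.2 i)) := funext fun p => hfF p.1 p.2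
  rw [e]
  exact hF.continuous.comp (Continuous.prodMk
    (continuous_pi fun i => SU2.continuous_entries.comp
      ((continuous_apply i).comp continuous_fst))
    (continuous_pi fun i => SU2.continuous_entries.comp
      ((continuous_apply i).comp continuous_snd)))

namespace SU2

lemma continuous_thetaSpin (n : Fin 3 → ℕ) : Continuous (thetaSpin n) :=
  continuous_integral_of_compactSpace (f := fun (y : Fin 3 → SU2) g =>
    ∏ i, spinChar (n i) ((y i)⁻¹ * g)) (continuous_prod_spinChar_inv_mul n)

lemma continuous_spinCoeff {f : (Fin 3 → SU2) → (Fin 3 → SU2) → ℂ} (hf : IsTestFunction f)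
    (n : Fin 3 → ℕ) : Continuous (spinCoeff f n) :=
  continuous_const.mul (continuous_integral_of_compactSpace
    (f := fun x y => thetaSpin n y * f x y)
    (((continuous_thetaSpin n).comp continuous_snd).mul hf.continuous))

lemma continuous_integral_diagonal {f : (Fin 3 → SU2) → (Fin 3 → SU2) → ℂ}
    (hf : IsTestFunction f) : Continuous fun x => ∫ g, f x (fun _ => g) ∂haarSU2 :=
  continuous_integral_of_compactSpace (f := fun x g => f x (fun _ => g))
    (hf.continuous.comp (f := fun p : (Fin 3 → SU2) × SU2 => (p.1, fun _ => p.2)) (by fun_prop))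

/-- The sum of the character expansion, for generic angles. -/
lemma IsGeneric.hasSum_thetaCharPairing {t : Fin 3 → ℝ} (h : IsGeneric t)
    {f : (Fin 3 → SU2) → (Fin 3 → SU2) → ℂ} (hf : IsTestFunction f) :
    HasSum (fun n : Fin 3 → ℕ => (∏ i, ((n i : ℂ) + 1)) * thetaCharPairing t n f)
      (triW (t 0) (t 1) (t 2) •
        ∫ r, ∫ g, f (orbit (t 0) (t 1) (t 2) r) (fun _ => g) ∂haarSU2 ∂haarSU2) := by
  obtain ⟨b, hb, hle, hsum⟩ := exists_hasSum_spinCoeff hf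
  have e : ∀ n : Fin 3 → ℕ, (∏ i, ((n i : ℂ) + 1)) * thetaCharPairing t n f =
      triW (t 0) (t 1) (t 2) • ∫ r, spinCoeff f n (orbit (t 0) (t 1) (t 2) r) ∂haarSU2 := by
    intro n
    rw [← h.integral_deltaProduct (continuous_spinCoeff hf n), thetaCharPairing,
      ← integral_const_mul]
    rfl
  simp only [e]
  refine HasSum.const_smul _ ?_
  exact hasSum_integral_of_dominated_convergence (fun n _ => b n)
    (fun n => ((continuous_spinCoeff hf n).comp
      (continuous_orbit (t 0) (t 1) (t 2))).aestronglyMeasurable)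
    (fun n => .of_forall fun r => hle n _) (.of_forall fun _ => hb) (integrable_const _)
    (.of_forall fun r => hsum _)

/-- The function of two variables whose Haar integral is the theta pairing. -/
noncomputable def diagonalPairing (f : (Fin 3 → SU2) → (Fin 3 → SU2) → ℂ) (x y : SU2) : ℂ :=
  ∫ g, f ![x, y, x⁻¹ * y⁻¹] (fun _ => g) ∂haarSU2

lemma continuous_diagonalPairing {f : (Fin 3 → SU2) → (Fin 3 → SU2) → ℂ}
    (hf : IsTestFunction f) : Continuous (Function.uncurry (diagonalPairing f)) :=
  continuous_closedTriple_uncurry (continuous_integral_diagonal hf)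

lemma thetaPairing_eq {f : (Fin 3 → SU2) → (Fin 3 → SU2) → ℂ} (hf : IsTestFunction f) :
    thetaPairing f = ∫ x, ∫ y, diagonalPairing f x y ∂haarSU2 ∂haarSU2 := by
  rw [thetaPairing,
    isDeltaProduct_haarSU2Cubed.integral_deltaProduct (continuous_integral_diagonal hf),
    integral_closedHaar (continuous_integral_diagonal hf)]
  rfl

lemma ae_tsum_thetaCharPairing {f : (Fin 3 → SU2) → (Fin 3 → SU2) → ℂ} (hf : IsTestFunction f) :
    weightedOrbital (diagonalPairing f) =ᵐ[volume.restrict (Set.Icc 0 fun _ => Real.pi)]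
      fun t : Fin 3 → ℝ => ((∏ i, weylDelta (t i) ^ 2 / Real.pi : ℝ) : ℂ) *
        ∑' n : Fin 3 → ℕ, (∏ i, ((n i : ℂ) + 1)) * thetaCharPairing t n f := by
  filter_upwards [ae_isGeneric] with t ht
  rw [(ht.hasSum_thetaCharPairing hf).tsum_eq,
    integral_orbit (fun x => ∫ g, f x (fun _ => g) ∂haarSU2), weightedOrbital, mul_smul,
    ← Complex.real_smul]
  rfl

end SU2

theorem mainTheorem8 :
    -- the two products with the delta function `δ_e(x₁⁻¹ x₂⁻¹ x₃⁻¹)` exist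
    IsDeltaProduct haarSU2Cubed closing (deltaProduct haarSU2Cubed closing) ∧
    (∀ᵐ t : Fin 3 → ℝ ∂volume.restrict (Set.Icc 0 (fun _ => Real.pi)),
      IsDeltaProduct (classDelta3 t) closing (deltaProduct (classDelta3 t) closing)) ∧
    -- the decomposition, as an identity of distributions on `SU(2)⁶`
    ∀ f : (Fin 3 → SU2) → (Fin 3 → SU2) → ℂ, IsTestFunction f →
      (∀ᵐ t : Fin 3 → ℝ ∂volume.restrict (Set.Icc 0 (fun _ => Real.pi)),
        Summable fun n : Fin 3 → ℕ => (∏ i, ((n i : ℂ) + 1)) * thetaCharPairing t n f) ∧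
      IntegrableOn (fun t : Fin 3 → ℝ => ((∏ i, weylDelta (t i) ^ 2 / Real.pi : ℝ) : ℂ) *
          ∑' n : Fin 3 → ℕ, (∏ i, ((n i : ℂ) + 1)) * thetaCharPairing t n f)
        (Set.Icc 0 (fun _ => Real.pi)) ∧
      thetaPairing f =
        ∫ t : Fin 3 → ℝ in Set.Icc 0 (fun _ => Real.pi),
          ((∏ i, weylDelta (t i) ^ 2 / Real.pi : ℝ) : ℂ) *
            ∑' n : Fin 3 → ℕ, (∏ i, ((n i : ℂ) + 1)) * thetaCharPairing t n f := by
  refine ⟨isDeltaProduct_haarSU2Cubed.deltaProduct, ?_, fun f hf => ⟨?_, ?_, ?_⟩⟩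
  · filter_upwards [SU2.ae_isGeneric] with t ht
    exact ht.isDeltaProduct.deltaProduct
  · filter_upwards [SU2.ae_isGeneric] with t ht
    exact (ht.hasSum_thetaCharPairing hf).summable
  · exact (SU2.integrable_weightedOrbital (SU2.continuous_diagonalPairing hf)).congr
      (SU2.ae_tsum_thetaCharPairing hf)
  · rw [← integral_congr_ae (SU2.ae_tsum_thetaCharPairing hf),
      SU2.integral_weightedOrbital (SU2.continuous_diagonalPairing hf), SU2.thetaPairing_eq hf]
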